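/- **Setting.** Let $d\in\mathbb N$, $T>0$, $\mathbb T^d=\mathbb R^d/\mathbb Z^d$, $q>1$, $r>\max\{d(q-1),1\}$, $r'=r/(r-1)$. Assume: * $m_0\in C(\mathbb T^d)$, $m_0>0$, $\int_{\mathbb T^d}m_0\,dx=1$, and $\phi_T:\mathbb T^d\to\mathbb R$ is Lipschitz continuous; * $H:\mathbb T^d\times\mathbb R^d\to\mathbb R$ is continuous, convex and differentiable in the second variable with $D_pH$ continuous in both variables, and for some $C>0$, $\frac1{rC}|p|^r-C\le H(x,p)\le \frac Cr|p|^r+C$ for all $x,p$; * $f:\mathbb T^d\times(0,\infty)\to\mathbb R$ is continuous, strictly increasing in the second variable, and for some $C>0$, $\frac1C m^{q-1}-C\le f(x,m)\le Cm^{q-1}+C$ for all $x$ and all $m\ge1$. Put $F(x,m)=\int_1^m f(x,s)\,ds$ for $m>0$, $F(x,0)=\lim_{m\to0^+}F(x,m)\in(-\infty,+\infty]$, $F(x,m)=+\infty$ for $m<0$. Let $F^*(x,\cdot)$ and $H^*(x,\cdot)$ be the Fenchel conjugates of $F(x,\cdot)$ and $H(x,\cdot)$, and let $L(x,v)=H^*(x,-v)$.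 Let $\mathcal K_0$ be the set of $\phi\in C^1([0,T]\times\mathbb T^d)$ with $\phi(T,\cdot)=\phi_T$, and $$\mathcal A(\phi)=\int_0^T\!\!\int_{\mathbb T^d}F^*(x,-\partial_t\phi+H(x,D\phi))\,dx\,dt-\int_{\mathbb T^d}\phi(0,x)m_0(x)\,dx .$$ Let $\mathcal K_1$ be the set of pairs $(m,w)\in L^1((0,T)\times\mathbb T^d)\times L^1((0,T)\times\mathbb T^d;\mathbb R^d)$ such that $m\ge0$ a.e., $\int_{\mathbb T^d}m(t,x)\,dx=1$ for a.e. $t\in(0,T)$, and $\partial_tm+\mathrm{div}\,w=0$, $m(0,\cdot)=m_0$ in the sense of distributions on $[0,T)\times\mathbb T^d$. For such a pair, $m$ has a unique representative $t\mapsto m(t)$, $t\in[0,T]$, with values in the probability measures on $\mathbb T^d$, such that $t\mapsto\int\psi\,dm(t)$ is continuous on $[0,T]$ for every $\psi\in C^\infty(\mathbb T^d)$; $m(T)$ denotes its value at $T$. Set $$\mathcal B(m,w)=\int_{\mathbb T^d}\phi_T\,dm(T)+\int_0^T\!\!\int_{\mathbb T^d}\Big(m\,L\big(x,\tfrac wm\big)+F(x,m)\Big)dx\,dt\in(-\infty,+\infty],$$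 with the convention that, where $m=0$, $mL(x,w/m)$ is $0$ if $w=0$ and $+\infty$ if $w\ne0$. **Theorem.** The minimum of $\mathcal B$ over $\mathcal K_1$ is achieved by a unique pair $(m,w)\in\mathcal K_1$, and this pair satisfies $m\in L^q((0,T)\times\mathbb T^d)$ and $w\in L^{\frac{r'q}{r'+q-1}}((0,T)\times\mathbb T^d)$. Moreover, if $\phi_T$ is of class $C^1$ (equivalently, if $\mathcal K_0\neq\emptyset$), then $$\inf_{\phi\in\mathcal K_0}\mathcal A(\phi)=-\min_{(m,w)\in\mathcal K_1}\mathcal B(m,w).$$ -/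

import Mathlib

open MeasureTheory Set Filter Topology
open scoped ContDiff

noncomputable section

namespace MFG

/-- The space `ℝ^d` with its Euclidean structure. -/
abbrev E (d : ℕ) := EuclideanSpace ℝ (Fin d)

/-- The flat torus `𝕋^d = ℝ^d / ℤ^d`; its `volume` is the Lebesgue (Haar) probability measure. -/
abbrev Torus (d : ℕ) := UnitAddTorus (Fin d)

/-- The canonical projection `ℝ^d → 𝕋^d`. -/
def proj {d : ℕ} (v : E d) : Torus d := fun i => ((v i : ℝ) : UnitAddCircle)

/-- Lebesgue measure on `(0,T) × 𝕋^d`. -/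
def vol (d : ℕ) (T : ℝ) : Measure (ℝ × Torus d) :=
  (volume.restrict (Ioo 0 T)).prod volume

/-! ### Differential calculus on the torus -/

/-- A function on the torus is of class `C^n` when its periodic lift to `ℝ^d` is. -/
def SpaceContDiff {d : ℕ} (n : WithTop ℕ∞) (ψ : Torus d → ℝ) : Prop :=
  ContDiff ℝ n (fun v : E d => ψ (proj v))

/-- The gradient of a function on the torus at `x`, read in the chart `v ↦ x + v` around `x`. -/
def spaceGrad {d : ℕ} (ψ : Torus d → ℝ) (x : Torus d) : E d :=
  gradient (fun v : E d => ψ (x + proj v)) 0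

/-- `φ ∈ C¹([0,T] × 𝕋^d)`: the periodic lift of `φ` is `C¹` on `[0,T] × ℝ^d`, up to the
boundary. Values `φ t` for `t ∉ [0,T]` play no role. -/
def IsC1 {d : ℕ} (T : ℝ) (φ : ℝ → Torus d → ℝ) : Prop :=
  ContDiffOn ℝ 1 (fun z : ℝ × E d => φ z.1 (proj z.2)) (Icc 0 T ×ˢ univ)

/-! ### Convex duality and integrals with values in the extended reals -/

/-- The Fenchel conjugate `G^*(y) = sup_z ⟨y, z⟩ - G(z)`. -/
def fenchelConj {V : Type*} [NormedAddCommGroup V] [InnerProductSpace ℝ V]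
    (G : V → EReal) (y : V) : EReal :=
  ⨆ z : V, ((inner ℝ y z : ℝ) : EReal) - G z

/-- The integral `∫ g⁺ - ∫ g⁻` of an extended-real valued function; this is meaningful as soon as
one of the two integrals is finite. -/
def eintegral {α : Type*} [MeasurableSpace α] (μ : Measure α) (g : α → EReal) : EReal :=
  ((∫⁻ a, (g a).toENNReal ∂μ : ENNReal) : EReal) -
    ((∫⁻ a, (-(g a)).toENNReal ∂μ : ENNReal) : EReal)

/-! ### The data -/

/-- `F(x,m) = ∫_1^m f(x,s) ds` for `m > 0`, `F(x,0) = lim_{m → 0⁺} F(x,m)` (possibly `+∞`), and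
`F(x,m) = +∞` for `m < 0`. -/
def F {d : ℕ} (f : Torus d → ℝ → ℝ) (x : Torus d) (m : ℝ) : EReal :=
  if m < 0 then ⊤
  else if m = 0 then
    limUnder (𝓝[>] (0 : ℝ)) (fun s : ℝ => ((∫ u in (1 : ℝ)..s, f x u : ℝ) : EReal))
  else ((∫ u in (1 : ℝ)..m, f x u : ℝ) : EReal)

/-- `F^*(x,·)`, the Fenchel conjugate of `F(x,·)`. -/
def Fstar {d : ℕ} (f : Torus d → ℝ → ℝ) (x : Torus d) (a : ℝ) : EReal :=
  fenchelConj (F f x) a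

/-- The Lagrangian `L(x,q) = H^*(x,-q)`. -/
def L {d : ℕ} (H : Torus d → E d → ℝ) (x : Torus d) (q : E d) : EReal :=
  fenchelConj (fun p : E d => ((H x p : ℝ) : EReal)) (-q)

open Classical in
/-- `m L(x, w/m)`, with the convention that for `m = 0` it is `0` if `w = 0` and `+∞` if
`w ≠ 0`. -/
def kinetic {d : ℕ} (H : Torus d → E d → ℝ) (x : Torus d) (m : ℝ) (w : E d) : EReal :=
  if m = 0 then (if w = 0 then 0 else ⊤) else (m : EReal) * L H x (m⁻¹ • w)

/-! ### The optimal control problem for the Hamilton-Jacobi equation -/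

/-- The set `𝒦₀` of the maps `φ ∈ C¹([0,T] × 𝕋^d)` with `φ(T,·) = φ_T`. -/
def K0 {d : ℕ} (T : ℝ) (φT : Torus d → ℝ) : Set (ℝ → Torus d → ℝ) :=
  {φ | IsC1 T φ ∧ ∀ x, φ T x = φT x}

/-- `𝒜(φ) = ∫_0^T ∫ F^*(x, -∂_t φ + H(x, Dφ)) dx dt - ∫ φ(0,x) m₀(x) dx`. -/
def A {d : ℕ} (T : ℝ) (H : Torus d → E d → ℝ) (f : Torus d → ℝ → ℝ) (m₀ : Torus d → ℝ)
    (φ : ℝ → Torus d → ℝ) : EReal :=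
  eintegral (vol d T) (fun z =>
      Fstar f z.2 (-(derivWithin (fun s => φ s z.2) (Icc 0 T) z.1)
        + H z.2 (spaceGrad (φ z.1) z.2)))
    - ((∫ x, φ 0 x * m₀ x : ℝ) : EReal)

/-! ### The optimal control problem for the continuity equation -/

/-- Test functions in `C_c^∞([0,T) × 𝕋^d)`: restrictions of smooth functions on `ℝ × 𝕋^d` that
vanish for times `≥ τ`, for some `τ < T`. -/
def IsTest {d : ℕ} (T : ℝ) (φ : ℝ → Torus d → ℝ) : Prop :=
  ContDiff ℝ ∞ (fun z : ℝ × E d => φ z.1 (proj z.2)) ∧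
    ∃ τ < T, ∀ t ≥ τ, ∀ x, φ t x = 0

/-- `∂_t m + div w = 0` in `(0,T) × 𝕋^d` and `m(0,·) = m₀`, in the sense of distributions. -/
def ContinuityEq {d : ℕ} (T : ℝ) (m₀ : Torus d → ℝ) (m : ℝ × Torus d → ℝ)
    (w : ℝ × Torus d → E d) : Prop :=
  ∀ φ : ℝ → Torus d → ℝ, IsTest T φ →
    (∫ z, (deriv (fun s => φ s z.2) z.1 * m z + inner ℝ (spaceGrad (φ z.1) z.2) (w z)) ∂(vol d T))
      + ∫ x, φ 0 x * m₀ x = 0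

/-- The set `𝒦₁` of the pairs `(m,w) ∈ L¹ × L¹` such that `m ≥ 0` a.e., `∫ m(t,x) dx = 1` for a.e.
`t ∈ (0,T)`, and `(m,w)` solves the continuity equation with initial datum `m₀`. -/
def K1 {d : ℕ} (T : ℝ) (m₀ : Torus d → ℝ) : Set (Lp ℝ 1 (vol d T) × Lp (E d) 1 (vol d T)) :=
  {p | (∀ᵐ z ∂(vol d T), 0 ≤ p.1 z) ∧
    (∀ᵐ t ∂(volume.restrict (Ioo 0 T)), ∫ x, p.1 (t, x) = 1) ∧
    ContinuityEq T m₀ p.1 p.2}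

/-- `ρ` is a weakly continuous representative of `t ↦ m(t,·)` on `[0,T]`: a path of probability
measures on the torus with `ρ t = m(t,x) dx` for a.e. `t ∈ (0,T)`, and such that `t ↦ ∫ ψ dρ(t)` is
continuous on `[0,T]` for all smooth `ψ`. (On `[0,T]` there is at most one.) -/
structure IsWeakRep {d : ℕ} (T : ℝ) (m : ℝ × Torus d → ℝ)
    (ρ : ℝ → ProbabilityMeasure (Torus d)) : Prop where
  ae_eq : ∀ᵐ t ∂(volume.restrict (Ioo 0 T)),
    (ρ t : Measure (Torus d)) = volume.withDensity (fun x => ENNReal.ofReal (m (t, x)))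
  cont : ∀ ψ : Torus d → ℝ, SpaceContDiff ∞ ψ →
    ContinuousOn (fun t => ∫ x, ψ x ∂(ρ t : Measure (Torus d))) (Icc 0 T)

open Classical in
/-- The value at time `t` of the weakly continuous representative of `m`. It exists for every pair
`(m,w) ∈ 𝒦₁` (the value `0` for other `m` is never used). At a single time such as `t = T` it is in
general a measure, not a density. -/
def slice {d : ℕ} (T : ℝ) (m : ℝ × Torus d → ℝ) (t : ℝ) : Measure (Torus d) :=
  if h : ∃ ρ : ℝ → ProbabilityMeasure (Torus d), IsWeakRep T m ρ then
    (h.choose t : Measure (Torus d)) else 0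

/-- `ℬ(m,w) = ∫ φ_T dm(T) + ∫_0^T ∫ m L(x, w/m) + F(x,m) dx dt`. -/
def B {d : ℕ} (T : ℝ) (H : Torus d → E d → ℝ) (f : Torus d → ℝ → ℝ) (φT : Torus d → ℝ)
    (p : Lp ℝ 1 (vol d T) × Lp (E d) 1 (vol d T)) : EReal :=
  ((∫ x, φT x ∂(slice T p.1 T) : ℝ) : EReal) +
    eintegral (vol d T) (fun z => kinetic H z.2 (p.1 z) (p.2 z) + F f z.2 (p.1 z))

end MFG

end

/-! The running cost m L(x, w/m) + F(x,m) is, for m ≥ 0, a supremum of functions affine in (m,w):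
momenta p give -⟨p,w⟩ - m H(x,p), and tangents to the convex primitive of f give the rest
(`runningCost_le_iff`). Convexity and lower semicontinuity are read off from this formula. The
growth of H and f bounds m|w/m|^{r'} and m^q by the cost; since w = m·(w/m), weighted AM-GM between
these two quantities gives the exponent r'q/(r'+q-1) for w (`rpow_mul_le_add`, `exists_coercive`).

The constraint set is closed and convex in L¹ × L¹. The terminal value m(T) is governed by an
identity linear in w and m₀ (`slice_spec`), so the terminal cost is continuous and affine on that
set. Compactness is used in this form: a directed family of nonempty closed convex sets, bounded in
L^σ × L^ς with σ, ς > 1, has a common point (`nonempty_iInter_of_bounded`). That point is the limit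
of almost-minimizers of the functional ∫ √(1+|u|²), which is uniformly convex on such sets. Applied
to the sublevel sets of ℬ, this yields a minimizer. Uniqueness is strict convexity of the cost
jointly in (m,w): strict monotonicity of f fixes m, and differentiability of H fixes w through w =
-m D_pH (`strictConvex_runningCost`).

The inequality -ℬ ≤ 𝒜 is Fenchel's inequality integrated against the continuity equation, which may
be tested with C¹ functions on the closed strip (`weak_identity`, `neg_B_le_A`). For the converse,
let c be below the minimum. By the same compactness, finitely many tests of the continuity equation,
satisfied only up to a small tolerance, already force the cost above c. Separation of convex sets in
finite dimension (`exists_multiplier`) then gives multipliers; the corresponding combination of test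
functions, added to φ_T, is an element φ of 𝒦₀ for which c bounds the Lagrangian from below over all
(m,w) of finite energy (`exists_multiplier_K0`). Evaluating the Lagrangian where m almost attains
F^* and w = -m D_pH(x,Dφ) bounds 𝒜(φ) by -c, up to ε and normalization (`A_le_of_le_weakForm`). -/

noncomputable section

namespace MFG

/-! ### Intersections of directed families of bounded closed convex sets in `L¹ × L¹` -/

section ConvexCompactness

/-- A directed family of nonempty closed convex sets has a common point as soon as a real function,
bounded on one of them, is uniformly convex there. -/
theorem nonempty_iInter_of_uniformlyConvex {X ι : Type*} [NormedAddCommGroup X] [NormedSpace ℝ X]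
    [CompleteSpace X] [Nonempty ι] (S : ι → Set X) (hdir : Directed (· ⊇ ·) S)
    (hne : ∀ i, (S i).Nonempty) (hcl : ∀ i, IsClosed (S i)) (hconv : ∀ i, Convex ℝ (S i))
    (J : X → ℝ) (C : ℝ) (hJ0 : ∀ u, 0 ≤ J u) (hJC : ∀ i, ∀ u ∈ S i, J u ≤ C)
    (hgap : ∀ ε > 0, ∃ δ > 0, ∀ i, ∀ u ∈ S i, ∀ v ∈ S i,
      J u + J v - 2 * J ((1 / 2 : ℝ) • (u + v)) < δ → dist u v < ε) :
    (⋂ i, S i).Nonempty := by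
  let I : ι → ℝ := fun i => sInf (J '' S i)
  have hbd : ∀ i, BddBelow (J '' S i) := fun i => ⟨0, by rintro _ ⟨u, -, rfl⟩; exact hJ0 u⟩
  have hI : ∀ i, ∀ u ∈ S i, I i ≤ J u := fun i u hu => csInf_le (hbd i) ⟨u, hu, rfl⟩
  have hIC : BddAbove (range I) := by
    refine ⟨C, ?_⟩
    rintro _ ⟨i, rfl⟩
    obtain ⟨u, hu⟩ := hne i
    exact (hI i u hu).trans (hJC i u hu)
  set Js : ℝ := sSup (range I)
  have hIs : ∀ i, I i ≤ Js := fun i => le_csSup hIC ⟨i, rfl⟩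
  -- Almost-minimizers of `J` on `S i`, measured against the supremum `Js` of all the infima. They
  -- form a filter base, and uniform convexity makes the filter Cauchy.
  let K : ι × {η : ℝ // 0 < η} → Set X := fun k => {u | u ∈ S k.1 ∧ J u < Js + k.2}
  have hKne : ∀ k, (K k).Nonempty := by
    rintro ⟨i, η, hη⟩
    obtain ⟨_, ⟨u, hu, rfl⟩, h⟩ := exists_lt_of_csInf_lt ((hne i).image J)
      (show sInf (J '' S i) < Js + η from (hIs i).trans_lt (by linarith))
    exact ⟨u, hu, h⟩
  have hKdir : Directed (· ⊇ ·) K := by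
    rintro ⟨i, η, hη⟩ ⟨j, ζ, hζ⟩
    obtain ⟨k, hki, hkj⟩ := hdir i j
    refine ⟨⟨k, min η ζ, lt_min hη hζ⟩, ?_, ?_⟩
    · rintro u ⟨h1, h2⟩
      exact ⟨hki h1, h2.trans_le (by simp)⟩
    · rintro u ⟨h1, h2⟩
      exact ⟨hkj h1, h2.trans_le (by simp)⟩
  let ℱ : Filter X := ⨅ k, 𝓟 (K k)
  have : Nonempty {η : ℝ // 0 < η} := ⟨⟨1, one_pos⟩⟩
  have : NeBot ℱ := by
    refine iInf_neBot_of_directed' ?_ (fun k => principal_neBot_iff.2 (hKne k))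
    exact fun a b => (hKdir a b).imp fun c h => ⟨principal_mono.2 h.1, principal_mono.2 h.2⟩
  have hmem : ∀ k, K k ∈ ℱ := fun k => mem_iInf_of_mem k (mem_principal_self _)
  have hcau : Cauchy ℱ := by
    rw [Metric.cauchy_iff]
    refine ⟨inferInstance, fun ε hε => ?_⟩
    obtain ⟨δ, hδ, h⟩ := hgap ε hε
    -- Two points with `J` below `Js + δ/4`, whose midpoint has `J` above `Js - δ/4`, have convexity
    -- gap below δ.
    obtain ⟨_, ⟨i, rfl⟩, hi⟩ := exists_lt_of_lt_csSup (range_nonempty I)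
      (show Js - δ / 4 < sSup (range I) by change Js - δ / 4 < Js; linarith)
    refine ⟨K ⟨i, δ / 4, by positivity⟩, hmem _, ?_⟩
    rintro u ⟨hu, hu'⟩ v ⟨hv, hv'⟩
    refine h i u hu v hv ?_
    have hm : (1 / 2 : ℝ) • (u + v) ∈ S i := by
      rw [smul_add]
      exact hconv i hu hv (by norm_num) (by norm_num) (by norm_num)
    have := hI i _ hm
    simp only at hu' hv'
    linarith
  obtain ⟨x, hx⟩ := CompleteSpace.complete hcau
  refine ⟨x, mem_iInter.2 fun i => ?_⟩
  refine (isClosed_iff_clusterPt.1 (hcl i)) x ?_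
  have : S i ∈ ℱ := mem_of_superset (hmem ⟨i, 1, one_pos⟩) fun u hu => hu.1
  exact NeBot.mono ‹NeBot ℱ› (le_inf hx (le_principal_iff.2 this))

variable {V : Type*} [NormedAddCommGroup V]

/-- The strictly convex function `√(1 + ‖u‖²)`. -/
def japanese (u : V) : ℝ := Real.sqrt (1 + ‖u‖ ^ 2)

theorem one_le_japanese (u : V) : 1 ≤ japanese u :=
  Real.one_le_sqrt.2 (by nlinarith [sq_nonneg ‖u‖])

theorem norm_le_japanese (u : V) : ‖u‖ ≤ japanese u :=
  Real.le_sqrt_of_sq_le (by linarith)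

theorem japanese_le (u : V) : japanese u ≤ 1 + ‖u‖ :=
  Real.sqrt_le_iff.2 ⟨by positivity, by nlinarith [norm_nonneg u]⟩

theorem japanese_sq (u : V) : japanese u ^ 2 = 1 + ‖u‖ ^ 2 := Real.sq_sqrt (by positivity)

theorem continuous_japanese : Continuous (japanese : V → ℝ) := by
  unfold japanese; fun_prop

variable {Ω : Type*} [MeasurableSpace Ω] {μ : Measure Ω}

theorem integrable_japanese [IsFiniteMeasure μ] {u : Ω → V} (hu : Integrable u μ) :
    Integrable (fun z => japanese (u z)) μ := by
  refine Integrable.mono' ((integrable_const 1).add hu.norm)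
    (continuous_japanese.comp_aestronglyMeasurable hu.1) (ae_of_all _ fun z => ?_)
  rw [Real.norm_of_nonneg (by linarith [one_le_japanese (u z)])]
  exact japanese_le _

theorem lintegral_japanese_rpow_le {u v : Ω → V} (hu : AEStronglyMeasurable u μ)
    {σ τ : ℝ} (hτ : 0 < τ) (hτσ : τ ≤ σ) {M : ENNReal}
    (hMu : ∫⁻ z, ENNReal.ofReal (‖u z‖ ^ σ) ∂μ ≤ M)
    (hMv : ∫⁻ z, ENNReal.ofReal (‖v z‖ ^ σ) ∂μ ≤ M) :
    ∫⁻ z, ENNReal.ofReal (japanese (u z) + japanese (v z)) ^ τ ∂μ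
      ≤ ENNReal.ofReal (4 ^ σ) * (μ univ + M + M) := by
  have hpt : ∀ z, ENNReal.ofReal (japanese (u z) + japanese (v z)) ^ τ ≤
      ENNReal.ofReal (4 ^ σ) *
        (1 + ENNReal.ofReal (‖u z‖ ^ σ) + ENNReal.ofReal (‖v z‖ ^ σ)) := by
    intro z
    have h1 := one_le_japanese (u z)
    have h2 := one_le_japanese (v z)
    rw [ENNReal.ofReal_rpow_of_nonneg (by linarith) hτ.le, ← ENNReal.ofReal_one,
      ← ENNReal.ofReal_add (by positivity) (by positivity),
      ← ENNReal.ofReal_add (by positivity) (by positivity),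
      ← ENNReal.ofReal_mul (by positivity)]
    refine ENNReal.ofReal_le_ofReal ?_
    -- The constant 4 arises from `japanese u + japanese v ≤ 2 + ‖u‖ + ‖v‖ ≤ 4x`.
    set x := max 1 (max ‖u z‖ ‖v z‖)
    have hσ : 0 < σ := hτ.trans_le hτσ
    have hx1 : 1 ≤ x := le_max_left _ _
    have hxu : ‖u z‖ ≤ x := (le_max_left _ _).trans (le_max_right _ _)
    have hxv : ‖v z‖ ≤ x := (le_max_right _ _).trans (le_max_right _ _)
    calc (japanese (u z) + japanese (v z)) ^ τ ≤ (japanese (u z) + japanese (v z)) ^ σ :=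
          Real.rpow_le_rpow_of_exponent_le (by linarith) hτσ
      _ ≤ (4 * x) ^ σ := by
          gcongr
          linarith [japanese_le (u z), japanese_le (v z)]
      _ = 4 ^ σ * x ^ σ := Real.mul_rpow (by norm_num) (by linarith)
      _ ≤ 4 ^ σ * (1 + ‖u z‖ ^ σ + ‖v z‖ ^ σ) := by
          gcongr
          have hu0 : 0 ≤ ‖u z‖ ^ σ := by positivity
          have hv0 : 0 ≤ ‖v z‖ ^ σ := by positivity
          rcases max_choice 1 (max ‖u z‖ ‖v z‖) with h | h
          · simp only [x, h, Real.one_rpow]; linarith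
          · rcases max_choice ‖u z‖ ‖v z‖ with h' | h' <;>
            · simp only [x, h, h']; linarith
  have hmu : AEMeasurable (fun z => ENNReal.ofReal (‖u z‖ ^ σ)) μ :=
    (hu.norm.aemeasurable.pow_const σ).ennreal_ofReal
  refine (lintegral_mono hpt).trans ?_
  rw [lintegral_const_mul' _ _ ENNReal.ofReal_ne_top]
  gcongr
  rw [lintegral_add_left' (by fun_prop), lintegral_add_left' (by fun_prop), lintegral_one]
  gcongr

theorem integral_japanese_le [IsFiniteMeasure μ] {u : Ω → V} (hu : Integrable u μ) {σ : ℝ}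
    (hσ : 1 < σ) {M : ENNReal} (hM : M ≠ ⊤) (hMu : ∫⁻ z, ENNReal.ofReal (‖u z‖ ^ σ) ∂μ ≤ M) :
    ∫ z, japanese (u z) ∂μ ≤ (2 * μ univ + M).toReal := by
  have hfin : 2 * μ univ + M ≠ ⊤ :=
    ENNReal.add_ne_top.2 ⟨ENNReal.mul_ne_top (by simp) (measure_ne_top _ _), hM⟩
  refine (ENNReal.ofReal_le_iff_le_toReal hfin).1 ?_
  rw [ofReal_integral_eq_lintegral_ofReal (integrable_japanese hu)
    (ae_of_all _ fun z => by have := one_le_japanese (u z); simp only [Pi.zero_apply]; linarith)]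
  calc ∫⁻ z, ENNReal.ofReal (japanese (u z)) ∂μ
      ≤ ∫⁻ z, (2 + ENNReal.ofReal (‖u z‖ ^ σ)) ∂μ := by
        refine lintegral_mono fun z => ?_
        rw [show (2 : ENNReal) = ENNReal.ofReal 2 by simp,
          ← ENNReal.ofReal_add (by norm_num) (by positivity)]
        refine ENNReal.ofReal_le_ofReal ((japanese_le _).trans ?_)
        rcases le_total ‖u z‖ 1 with h | h
        · have : 0 ≤ ‖u z‖ ^ σ := by positivity
          linarith
        · have := Real.self_le_rpow_of_one_le h hσ.le
          linarith
    _ ≤ 2 * μ univ + M := by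
        rw [lintegral_add_left (by fun_prop), lintegral_const]
        gcongr

variable [InnerProductSpace ℝ V]

/-- The convexity gap of `japanese` at the midpoint. -/
def japaneseGap (a b : V) : ℝ :=
  japanese a + japanese b - 2 * japanese ((1 / 2 : ℝ) • (a + b))

/-- Here (A+B)² - D² = 2(AB - P), hence AB - P ≤ (A+B)(A+B-D), while AB + P ≤ (A+B)². The product of
these bounds is the cubic estimate. -/
theorem gap_of_sq_eq {A B D P e : ℝ} (hA : 1 ≤ A) (hB : 1 ≤ B)
    (hD : D ^ 2 = A ^ 2 + B ^ 2 + 2 * P) (he0 : 0 ≤ e) (he : e ≤ (A * B - P) * (A * B + P)) :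
    0 ≤ A + B - D ∧ e ≤ (A + B) ^ 3 * (A + B - D) := by
  have hAB : 0 < A * B := by positivity
  have hP2 : P ^ 2 ≤ (A * B) ^ 2 := by nlinarith
  have hP := abs_le_of_sq_le_sq' hP2 hAB.le
  have hDK : D ≤ A + B := by
    refine (abs_le_of_sq_le_sq' ?_ (by linarith)).2
    rw [hD]; linarith [show (A + B) ^ 2 = A ^ 2 + B ^ 2 + 2 * (A * B) by ring]
  refine ⟨by linarith, ?_⟩
  have h1 : A * B - P ≤ (A + B - D) * (A + B) := by
    have h2 : (A + B - D) * (A + B + D) = 2 * (A * B - P) := by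
      linear_combination -hD
    have h3 : (A + B - D) * (A + B + D) ≤ (A + B - D) * (2 * (A + B)) :=
      mul_le_mul_of_nonneg_left (by linarith) (by linarith)
    linarith
  calc e ≤ (A * B - P) * (A * B + P) := he
    _ ≤ (A * B - P) * (A + B) ^ 2 := by
        refine mul_le_mul_of_nonneg_left ?_ (by linarith)
        nlinarith [sq_nonneg (A - B)]
    _ ≤ ((A + B - D) * (A + B)) * (A + B) ^ 2 := by gcongr
    _ = (A + B) ^ 3 * (A + B - D) := by ring

theorem japaneseGap_aux (a b : V) : 0 ≤ japaneseGap a b ∧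
    ‖a - b‖ ^ 2 ≤ (japanese a + japanese b) ^ 3 * japaneseGap a b := by
  have hA := japanese_sq a
  have hB := japanese_sq b
  have hcs : (inner ℝ a b : ℝ) ^ 2 ≤ ‖a‖ ^ 2 * ‖b‖ ^ 2 := by
    rw [← mul_pow]; exact sq_le_sq' (by
      have := abs_real_inner_le_norm a b; linarith [neg_abs_le (inner ℝ a b : ℝ)])
      (real_inner_le_norm a b)
  -- P is the inner product of (1,a) and (1,b), whose norms are the two values of `japanese`. The
  -- defect A²B² - P² equals ‖a-b‖² + ‖a‖²‖b‖² - ⟨a,b⟩², and Cauchy–Schwarz disposes of the last two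
  -- terms.
  refine gap_of_sq_eq (P := 1 + inner ℝ a b) (one_le_japanese a) (one_le_japanese b) ?_
    (by positivity) ?_
  · rw [mul_pow, japanese_sq, norm_smul, mul_pow, hA, hB, norm_add_sq_real]
    norm_num
    ring
  · have : (japanese a * japanese b - (1 + inner ℝ a b)) *
        (japanese a * japanese b + (1 + inner ℝ a b)) =
        japanese a ^ 2 * japanese b ^ 2 - (1 + inner ℝ a b) ^ 2 := by ring
    rw [this, hA, hB, norm_sub_sq_real]
    linarith

/-- Interpolation: the quadratic bound of `japaneseGap_aux` to the power θ, times ‖a-b‖ ≤ A+B to the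
power 1-2θ. For small θ the weight A+B enters with a power only slightly above 1, which an L^σ bound
with σ > 1 controls. -/
theorem norm_sub_le_japaneseGap (a b : V) {θ : ℝ} (h0 : 0 < θ) (h1 : θ ≤ 1 / 2) :
    ‖a - b‖ ≤ japaneseGap a b ^ θ * (japanese a + japanese b) ^ (1 + θ) := by
  obtain ⟨hg, h⟩ := japaneseGap_aux a b
  have hK : 0 < japanese a + japanese b := by
    linarith [one_le_japanese a, one_le_japanese b]
  have hle : ‖a - b‖ ≤ japanese a + japanese b :=
    (norm_sub_le a b).trans (add_le_add (norm_le_japanese a) (norm_le_japanese b))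
  rcases (norm_nonneg (a - b)).eq_or_lt with h00 | hpos
  · rw [← h00]; positivity
  calc ‖a - b‖ = (‖a - b‖ ^ 2) ^ θ * ‖a - b‖ ^ (1 - 2 * θ) := by
        rw [← Real.rpow_natCast, ← Real.rpow_mul hpos.le, ← Real.rpow_add hpos]
        norm_num
    _ ≤ ((japanese a + japanese b) ^ 3 * japaneseGap a b) ^ θ *
          (japanese a + japanese b) ^ (1 - 2 * θ) := by
        gcongr
        linarith
    _ = japaneseGap a b ^ θ * (japanese a + japanese b) ^ (1 + θ) := by
        rw [Real.mul_rpow (by positivity) hg, ← Real.rpow_natCast, ← Real.rpow_mul hK.le,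
          mul_comm (_ ^ (_ * θ)), mul_assoc, ← Real.rpow_add hK]
        congr 2
        push_cast; ring

/-- Uniform convexity of ∫ `japanese` on sets bounded in L^σ: the pointwise interpolation bound is
integrated by Hölder with weights θ and 1-θ. -/
theorem exists_gap_modulus [IsFiniteMeasure μ] {σ : ℝ} (hσ : 1 < σ) {M : ENNReal}
    (hM : M ≠ ⊤) {ε : ℝ} (hε : 0 < ε) :
    ∃ δ > 0, ∀ u v : Ω → V, Integrable u μ → Integrable v μ →
      ∫⁻ z, ENNReal.ofReal (‖u z‖ ^ σ) ∂μ ≤ M → ∫⁻ z, ENNReal.ofReal (‖v z‖ ^ σ) ∂μ ≤ M →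
      ∫ z, japaneseGap (u z) (v z) ∂μ < δ → ∫ z, ‖u z - v z‖ ∂μ < ε := by
  set τ := min σ 2
  have hτ1 : 1 < τ := lt_min hσ (by norm_num)
  have hτ2 : τ ≤ 2 := min_le_right _ _
  -- θ solves τ(1-θ) = 1+θ, so that the second Hölder factor is exactly the integral of the τ-th
  -- power. Capping τ at 2 ensures θ ≤ 1/2.
  set θ := (τ - 1) / (τ + 1) with hθ
  have hθ0 : 0 < θ := by apply div_pos <;> linarith
  have hθ1 : θ ≤ 1 / 2 := by rw [hθ, div_le_iff₀ (by linarith)]; linarith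
  have hτθ : τ * (1 - θ) = 1 + θ := by rw [hθ]; field_simp; ring
  set N : ENNReal := ENNReal.ofReal (4 ^ σ) * (μ univ + M + M)
  have hN : N ≠ ⊤ := ENNReal.mul_ne_top ENNReal.ofReal_ne_top (by simp [hM])
  set c : ℝ := (N.toReal + 1) ^ (1 - θ)
  have hc : 0 < c := by positivity
  refine ⟨(ε / c) ^ (1 / θ), by positivity, fun u v hu hv hMu hMv hgap => ?_⟩
  have hgi : Integrable (fun z => japaneseGap (u z) (v z)) μ := by
    unfold japaneseGap
    exact ((integrable_japanese hu).add (integrable_japanese hv)).sub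
      ((integrable_japanese ((hu.add hv).smul (1 / 2 : ℝ))).const_mul 2)
  have hg0 : 0 ≤ ∫ z, japaneseGap (u z) (v z) ∂μ :=
    integral_nonneg fun z => (japaneseGap_aux _ _).1
  have hKm : AEMeasurable
      (fun z => ENNReal.ofReal (japanese (u z) + japanese (v z)) ^ τ) μ :=
    (((integrable_japanese hu).add
      (integrable_japanese hv)).aestronglyMeasurable.aemeasurable.ennreal_ofReal).pow_const τ
  have key : ENNReal.ofReal (∫ z, ‖u z - v z‖ ∂μ) ≤
      ENNReal.ofReal ((∫ z, japaneseGap (u z) (v z) ∂μ) ^ θ * c) := by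
    rw [ofReal_integral_eq_lintegral_ofReal (f := fun z => ‖u z - v z‖) (hu.sub hv).norm
      (ae_of_all _ fun z => norm_nonneg _)]
    calc ∫⁻ z, ENNReal.ofReal ‖u z - v z‖ ∂μ
        ≤ ∫⁻ z, ENNReal.ofReal (japaneseGap (u z) (v z)) ^ θ *
            (ENNReal.ofReal (japanese (u z) + japanese (v z)) ^ τ) ^ (1 - θ) ∂μ := by
          refine lintegral_mono fun z => ?_
          have h1 := one_le_japanese (u z)
          have h2 := one_le_japanese (v z)
          rw [← ENNReal.rpow_mul, hτθ, ENNReal.ofReal_rpow_of_nonneg (japaneseGap_aux _ _).1 hθ0.le,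
            ENNReal.ofReal_rpow_of_nonneg (by linarith) (by linarith),
            ← ENNReal.ofReal_mul (Real.rpow_nonneg (japaneseGap_aux _ _).1 _)]
          exact ENNReal.ofReal_le_ofReal (norm_sub_le_japaneseGap _ _ hθ0 hθ1)
      _ ≤ (∫⁻ z, ENNReal.ofReal (japaneseGap (u z) (v z)) ∂μ) ^ θ *
            (∫⁻ z, ENNReal.ofReal (japanese (u z) + japanese (v z)) ^ τ ∂μ) ^ (1 - θ) :=
          ENNReal.lintegral_mul_norm_pow_le hgi.aestronglyMeasurable.aemeasurable.ennreal_ofReal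
            hKm hθ0.le (by linarith) (by ring)
      _ ≤ (ENNReal.ofReal (∫ z, japaneseGap (u z) (v z) ∂μ)) ^ θ *
            (ENNReal.ofReal (N.toReal + 1)) ^ (1 - θ) := by
          rw [← ofReal_integral_eq_lintegral_ofReal hgi (ae_of_all _ fun z => (japaneseGap_aux _ _).1)]
          gcongr
          · linarith
          · refine (lintegral_japanese_rpow_le hu.1 (by linarith) (min_le_left _ _) hMu hMv).trans
              ?_
            rw [ENNReal.le_ofReal_iff_toReal_le hN (by positivity)]
            linarith
      _ = ENNReal.ofReal ((∫ z, japaneseGap (u z) (v z) ∂μ) ^ θ * c) := by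
          rw [ENNReal.ofReal_rpow_of_nonneg hg0 hθ0.le,
            ENNReal.ofReal_rpow_of_nonneg (by positivity) (by linarith),
            ← ENNReal.ofReal_mul (by positivity)]
  rw [ENNReal.ofReal_le_ofReal_iff (by positivity)] at key
  refine key.trans_lt ?_
  calc (∫ z, japaneseGap (u z) (v z) ∂μ) ^ θ * c < ((ε / c) ^ (1 / θ)) ^ θ * c := by gcongr
    _ = ε := by
      rw [← Real.rpow_mul (by positivity), one_div_mul_cancel hθ0.ne', Real.rpow_one]
      field_simp

variable {W : Type*} [NormedAddCommGroup W] [InnerProductSpace ℝ W]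

theorem L1_dist_eq_integral_norm {V : Type*} [NormedAddCommGroup V] (a b : Lp V 1 μ) :
    dist a b = ∫ z, ‖a z - b z‖ ∂μ := by
  rw [dist_eq_norm, L1.norm_eq_integral_norm]
  refine integral_congr_ae ?_
  filter_upwards [Lp.coeFn_sub a b] with z hz
  rw [hz, Pi.sub_apply]

theorem integral_japaneseGap [IsFiniteMeasure μ] (a b : Lp V 1 μ) :
    ∫ z, japaneseGap (a z) (b z) ∂μ = ∫ z, japanese (a z) ∂μ + ∫ z, japanese (b z) ∂μ
      - 2 * ∫ z, japanese (((1 / 2 : ℝ) • (a + b)) z) ∂μ := by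
  have ha := integrable_japanese (L1.integrable_coeFn a)
  have hb := integrable_japanese (L1.integrable_coeFn b)
  have hc := integrable_japanese (L1.integrable_coeFn ((1 / 2 : ℝ) • (a + b)))
  have hsub := integral_sub (ha.add hb) (hc.const_mul 2)
  rw [← integral_add ha hb, ← integral_const_mul]
  refine Eq.trans ?_ hsub
  refine integral_congr_ae ?_
  filter_upwards [Lp.coeFn_smul (1 / 2 : ℝ) (a + b), Lp.coeFn_add a b] with z h1 h2
  simp only [japaneseGap, h1, Pi.smul_apply, h2, Pi.add_apply]

/-- A directed family of nonempty closed convex subsets of `L¹ × L¹` that are bounded in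
`L^σ × L^ς` for some `σ, ς > 1` has a common point. -/
theorem nonempty_iInter_of_bounded [IsFiniteMeasure μ] [CompleteSpace V] [CompleteSpace W]
    {ι : Type*} [Nonempty ι] (S : ι → Set (Lp V 1 μ × Lp W 1 μ)) (hdir : Directed (· ⊇ ·) S)
    (hne : ∀ i, (S i).Nonempty) (hcl : ∀ i, IsClosed (S i)) (hconv : ∀ i, Convex ℝ (S i))
    {σ ς : ℝ} (hσ : 1 < σ) (hς : 1 < ς) {M : ENNReal} (hM : M ≠ ⊤)
    (hbd : ∀ i, ∀ u ∈ S i, ∫⁻ z, ENNReal.ofReal (‖u.1 z‖ ^ σ) ∂μ ≤ M ∧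
      ∫⁻ z, ENNReal.ofReal (‖u.2 z‖ ^ ς) ∂μ ≤ M) :
    (⋂ i, S i).Nonempty := by
  have i1 : ∀ u : Lp V 1 μ × Lp W 1 μ, Integrable u.1 μ := fun u => L1.integrable_coeFn _
  have i2 : ∀ u : Lp V 1 μ × Lp W 1 μ, Integrable u.2 μ := fun u => L1.integrable_coeFn _
  refine nonempty_iInter_of_uniformlyConvex S hdir hne hcl hconv
    (fun u => ∫ z, japanese (u.1 z) ∂μ + ∫ z, japanese (u.2 z) ∂μ)
    ((2 * μ univ + M).toReal + (2 * μ univ + M).toReal) (fun u => ?_) (fun i u hu => ?_) ?_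
  · exact add_nonneg (integral_nonneg fun z => zero_le_one.trans (one_le_japanese _))
      (integral_nonneg fun z => zero_le_one.trans (one_le_japanese _))
  · exact add_le_add (integral_japanese_le (i1 u) hσ hM (hbd i u hu).1)
      (integral_japanese_le (i2 u) hς hM (hbd i u hu).2)
  · intro ε hε
    obtain ⟨δ, hδ, h⟩ := exists_gap_modulus (V := V) (μ := μ) hσ hM hε
    obtain ⟨δ', hδ', h'⟩ := exists_gap_modulus (V := W) (μ := μ) hς hM hε
    refine ⟨min δ δ', lt_min hδ hδ', fun i u hu v hv huv => ?_⟩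
    have g1 := integral_japaneseGap u.1 v.1
    have g2 := integral_japaneseGap u.2 v.2
    have p1 : 0 ≤ ∫ z, japaneseGap (u.1 z) (v.1 z) ∂μ :=
      integral_nonneg fun z => (japaneseGap_aux _ _).1
    have p2 : 0 ≤ ∫ z, japaneseGap (u.2 z) (v.2 z) ∂μ :=
      integral_nonneg fun z => (japaneseGap_aux _ _).1
    simp only [Prod.smul_fst, Prod.fst_add, Prod.smul_snd, Prod.snd_add] at huv
    rw [Prod.dist_eq, max_lt_iff, L1_dist_eq_integral_norm, L1_dist_eq_integral_norm]
    refine ⟨h _ _ (i1 u) (i1 v) (hbd i u hu).1 (hbd i v hv).1 ?_,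
      h' _ _ (i2 u) (i2 v) (hbd i u hu).2 (hbd i v hv).2 ?_⟩
    · exact lt_of_lt_of_le (by linarith) (min_le_left _ _)
    · exact lt_of_lt_of_le (by linarith) (min_le_right _ _)

end ConvexCompactness

/-! ### The coupling and its primitive -/

section Coupling

variable {d : ℕ}

/-- The assumptions on the coupling `f`. -/
structure IsCoupling (q : ℝ) (f : Torus d → ℝ → ℝ) : Prop where
  one_lt : 1 < q
  cont : ContinuousOn (fun z : Torus d × ℝ => f z.1 z.2) (univ ×ˢ Ioi (0 : ℝ))
  mono : ∀ x, StrictMonoOn (f x) (Ioi (0 : ℝ))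
  growth : ∃ C > 0, ∀ x, ∀ m ≥ 1,
    1 / C * m ^ (q - 1) - C ≤ f x m ∧ f x m ≤ C * m ^ (q - 1) + C

/-- The primitive `∫_1^s f(x,u) du`. -/
def primitive (f : Torus d → ℝ → ℝ) (x : Torus d) (s : ℝ) : ℝ := ∫ u in (1 : ℝ)..s, f x u

/-- The tangent to the primitive of `f` at `s`, evaluated at `m`. -/
def tangent (f : Torus d → ℝ → ℝ) (x : Torus d) (s m : ℝ) : ℝ :=
  primitive f x s + f x s * (m - s)

variable {q : ℝ} {f : Torus d → ℝ → ℝ}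

theorem IsCoupling.continuousOn (hf : IsCoupling q f) (x : Torus d) :
    ContinuousOn (f x) (Ioi 0) :=
  hf.cont.comp (f := fun u : ℝ => (x, u)) (by fun_prop) fun _ hu => ⟨mem_univ _, hu⟩

theorem IsCoupling.intervalIntegrable (hf : IsCoupling q f) (x : Torus d) {a b : ℝ} (ha : 0 < a)
    (hb : 0 < b) : IntervalIntegrable (f x) volume a b :=
  ((hf.continuousOn x).mono fun _ hu => (lt_min ha hb).trans_le hu.1).intervalIntegrable

theorem IsCoupling.primitive_sub (hf : IsCoupling q f) (x : Torus d) {a b : ℝ} (ha : 0 < a)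
    (hb : 0 < b) : primitive f x b - primitive f x a = ∫ u in a..b, f x u :=
  intervalIntegral.integral_interval_sub_left (hf.intervalIntegrable x one_pos hb)
    (hf.intervalIntegrable x one_pos ha)

theorem primitive_one (f : Torus d → ℝ → ℝ) (x : Torus d) : primitive f x 1 = 0 :=
  intervalIntegral.integral_same

/-- Strict convexity of the primitive: the integral of the strictly increasing `f x` over an
interval lies strictly between the values obtained from its endpoint constants. -/
theorem IsCoupling.tangent_lt (hf : IsCoupling q f) (x : Torus d) {s m : ℝ} (hs : 0 < s)
    (hm : 0 < m) (h : m ≠ s) : tangent f x s m < primitive f x m := by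
  have key : ∀ a b : ℝ, 0 < a → a < b → f x a * (b - a) < ∫ u in a..b, f x u ∧
      ∫ u in a..b, f x u < f x b * (b - a) := by
    intro a b ha hab
    have hb := ha.trans hab
    have hc : ContinuousOn (f x) (Icc a b) :=
      (hf.continuousOn x).mono fun _ hu => ha.trans_le hu.1
    have hconst : ∀ c : ℝ, ∫ _ in a..b, c = c * (b - a) := fun c => by simp [mul_comm]
    rw [← hconst, ← hconst]
    constructor
    · refine intervalIntegral.integral_lt_integral_of_continuousOn_of_le_of_exists_lt hab
        continuousOn_const hc (fun u hu => ((hf.mono x) ha (ha.trans hu.1) hu.1).le)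
        ⟨b, right_mem_Icc.2 hab.le, (hf.mono x) ha hb hab⟩
    · refine intervalIntegral.integral_lt_integral_of_continuousOn_of_le_of_exists_lt hab
        hc continuousOn_const (fun u hu => ((hf.mono x).monotoneOn (ha.trans hu.1) hb hu.2))
        ⟨a, left_mem_Icc.2 hab.le, (hf.mono x) ha hb hab⟩
  have hsub := hf.primitive_sub x hs hm
  unfold tangent
  rcases lt_or_gt_of_ne h with h | h
  · have := (key m s hm h).2
    rw [intervalIntegral.integral_symm] at hsub
    linarith [mul_comm (f x s) (m - s), mul_sub (f x s) m s, mul_sub (f x s) s m]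
  · have := (key s m hs h).1
    linarith

theorem tangent_self (f : Torus d → ℝ → ℝ) (x : Torus d) (m : ℝ) :
    tangent f x m m = primitive f x m := by simp [tangent]

theorem IsCoupling.tangent_le (hf : IsCoupling q f) (x : Torus d) {s m : ℝ} (hs : 0 < s)
    (hm : 0 < m) : tangent f x s m ≤ primitive f x m := by
  rcases eq_or_ne m s with rfl | h
  · exact (tangent_self f x m).le
  · exact (hf.tangent_lt x hs hm h).le

theorem F_of_pos (f : Torus d → ℝ → ℝ) (x : Torus d) {m : ℝ} (hm : 0 < m) :
    F f x m = (primitive f x m : ℝ) := by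
  simp [F, primitive, hm.not_gt, hm.ne']

theorem F_of_neg (f : Torus d → ℝ → ℝ) (x : Torus d) {m : ℝ} (hm : m < 0) : F f x m = ⊤ := by
  simp [F, hm]

/-- The limit defining F(x,0) exists because the primitive minus the linear function f(x,1)s is
antitone on (0,1), and the linear part tends to 0. -/
theorem IsCoupling.tendsto_F_zero (hf : IsCoupling q f) (x : Torus d) :
    Tendsto (fun s : ℝ => ((primitive f x s : ℝ) : EReal)) (𝓝[>] 0) (𝓝 (F f x 0)) := by
  have hlim : ∃ l : EReal,
      Tendsto (fun s : ℝ => ((primitive f x s : ℝ) : EReal)) (𝓝[>] 0) (𝓝 l) := by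
    have hanti : AntitoneOn
        (fun s : ℝ => ((primitive f x s - f x 1 * s : ℝ) : EReal)) (Ioo 0 1) := by
      intro a ha b hb hab
      refine EReal.coe_le_coe_iff.2 ?_
      have h1 := hf.tangent_le x hb.1 ha.1
      have h2 := hf.mono x hb.1 (mem_Ioi.2 one_pos) hb.2
      unfold tangent at h1
      nlinarith
    have h1 := hanti.tendsto_nhdsWithin_Ioo_right (by simp) (OrderTop.bddAbove _)
    have h2 : Tendsto (fun s : ℝ => ((f x 1 * s : ℝ) : EReal)) (𝓝[>] 0) (𝓝 ((0 : ℝ) : EReal)) := by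
      refine (continuous_coe_real_ereal.tendsto _).comp ?_
      have : Tendsto (fun s : ℝ => f x 1 * s) (𝓝 0) (𝓝 (f x 1 * 0)) :=
        (continuous_const.mul continuous_id).tendsto 0
      rw [mul_zero] at this
      exact this.mono_left nhdsWithin_le_nhds
    refine ⟨_, ((EReal.continuousAt_add (Or.inr (EReal.coe_ne_bot 0))
      (Or.inr (EReal.coe_ne_top 0))).tendsto.comp (h1.prodMk_nhds h2)).congr fun s => ?_⟩
    simp only [Function.comp]
    rw [← EReal.coe_add, sub_add_cancel]
  have : F f x 0 = limUnder (𝓝[>] (0 : ℝ)) (fun s : ℝ => ((primitive f x s : ℝ) : EReal)) := by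
    simp [F, primitive]
  rw [this]
  exact tendsto_nhds_limUnder hlim

/-- Together with `F_le_of_tangent_le` this identifies F(x,·) on [0,∞), the endpoint 0 included,
with the supremum of its tangents at positive points. -/
theorem IsCoupling.tangent_le_F (hf : IsCoupling q f) (x : Torus d) {s : ℝ} (m : ℝ) (hs : 0 < s) :
    (tangent f x s m : EReal) ≤ F f x m := by
  rcases lt_trichotomy m 0 with hm | rfl | hm
  · rw [F_of_neg f x hm]; exact le_top
  · have h1 : Tendsto (fun e : ℝ => ((tangent f x s e : ℝ) : EReal)) (𝓝[>] 0)
        (𝓝 ((tangent f x s 0 : ℝ) : EReal)) := by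
      refine (continuous_coe_real_ereal.tendsto _).comp ?_
      have : Continuous (fun e : ℝ => tangent f x s e) := by unfold tangent; fun_prop
      exact (this.tendsto 0).mono_left nhdsWithin_le_nhds
    refine le_of_tendsto_of_tendsto h1 (hf.tendsto_F_zero x) ?_
    filter_upwards [self_mem_nhdsWithin] with e he
    exact EReal.coe_le_coe_iff.2 (hf.tangent_le x hs he)
  · rw [F_of_pos f x hm]
    exact EReal.coe_le_coe_iff.2 (hf.tangent_le x hs hm)

theorem IsCoupling.F_le_of_tangent_le (hf : IsCoupling q f) (x : Torus d) {m a : ℝ} (hm : 0 ≤ m)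
    (h : ∀ s > 0, tangent f x s m ≤ a) : F f x m ≤ a := by
  rcases hm.eq_or_lt with rfl | hm
  -- The tangent at s takes at 0 the value `primitive f x s - s * f x s`. Since f(x,s) < f(x,1) for
  -- s < 1, the primitive is at most a + s|f(x,1)|, which tends to a.
  · have h2 : Tendsto (fun s : ℝ => ((a + s * |f x 1| : ℝ) : EReal)) (𝓝[>] 0)
        (𝓝 ((a : ℝ) : EReal)) := by
      refine (continuous_coe_real_ereal.tendsto _).comp ?_
      have : Tendsto (fun s : ℝ => a + s * |f x 1|) (𝓝 0) (𝓝 (a + 0 * |f x 1|)) :=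
        (continuous_const.add (continuous_id.mul continuous_const)).tendsto 0
      rw [zero_mul, add_zero] at this
      exact this.mono_left nhdsWithin_le_nhds
    refine le_of_tendsto_of_tendsto (hf.tendsto_F_zero x) h2 ?_
    filter_upwards [Ioo_mem_nhdsGT (zero_lt_one (α := ℝ))] with s hs
    refine EReal.coe_le_coe_iff.2 ?_
    have h3 := h s hs.1
    have h4 := hf.mono x hs.1 (mem_Ioi.2 one_pos) hs.2
    have h5 := le_abs_self (f x 1)
    have h6 : s * f x s ≤ s * |f x 1| := mul_le_mul_of_nonneg_left (by linarith) hs.1.le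
    unfold tangent at h3
    linarith [mul_comm s (f x s), mul_sub (f x s) 0 s]
  · rw [F_of_pos f x hm]
    refine EReal.coe_le_coe_iff.2 ?_
    simpa [tangent_self] using h m hm

theorem IsCoupling.continuous_primitive (hf : IsCoupling q f) {s : ℝ} (hs : 0 < s) :
    Continuous (fun x => primitive f x s) := by
  set e := min 1 s
  have he : 0 < e := lt_min one_pos hs
  -- Clamping the variable at min(1,s) > 0 does not change the integral and makes the integrand
  -- continuous on the whole of 𝕋^d × ℝ.
  have : (fun x => primitive f x s) = fun x => ∫ u in (1 : ℝ)..s, f x (max u e) := by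
    ext x
    refine intervalIntegral.integral_congr fun u hu => ?_
    rw [max_eq_left hu.1]
  rw [this]
  refine intervalIntegral.continuous_parametric_intervalIntegral_of_continuous
    (f := fun x u => f x (max u e)) ?_ continuous_const
  refine hf.cont.comp_continuous (f := fun p : Torus d × ℝ => (p.1, max p.2 e)) (by fun_prop) ?_
  exact fun p => ⟨mem_univ _, he.trans_le (le_max_right _ _)⟩

theorem IsCoupling.continuous_apply (hf : IsCoupling q f) {s : ℝ} (hs : 0 < s) :
    Continuous (fun x => f x s) :=
  hf.cont.comp_continuous (f := fun x : Torus d => (x, s)) (by fun_prop) fun _ => ⟨mem_univ _, hs⟩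

/-- The two sides balance at m = (A/e)^{1/(q-1)}: below that value the constant suffices, above it
the power does. -/
theorem exists_mul_le_rpow {q : ℝ} (hq : 1 < q) {A e : ℝ} (hA : 0 ≤ A) (he : 0 < e) :
    ∃ K ≥ 0, ∀ m : ℝ, 0 ≤ m → A * m ≤ e * m ^ q + K := by
  refine ⟨A * (A / e) ^ (1 / (q - 1)), by positivity, fun m hm => ?_⟩
  rcases le_total m ((A / e) ^ (1 / (q - 1))) with h | h
  · have : 0 ≤ e * m ^ q := by positivity
    nlinarith
  · have h1 : A / e ≤ m ^ (q - 1) := by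
      calc A / e = ((A / e) ^ (1 / (q - 1))) ^ (q - 1) := by
            rw [← Real.rpow_mul (by positivity), one_div_mul_cancel (by linarith), Real.rpow_one]
        _ ≤ m ^ (q - 1) := Real.rpow_le_rpow (by positivity) h (by linarith)
    have h2 : A * m ≤ e * m ^ q := by
      rcases hm.eq_or_lt with rfl | hm
      · simp only [mul_zero]; positivity
      rw [div_le_iff₀ he] at h1
      have h3 : m ^ q = m ^ (q - 1) * m := by
        rw [← Real.rpow_add_one hm.ne']; ring_nf
      rw [h3]
      nlinarith
    have : 0 ≤ A * (A / e) ^ (1 / (q - 1)) := by positivity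
    linarith

/-- For m ≤ 1 the tangent at 1 works; for m ≥ 1 the tangent at m works, its value there being the
primitive. Half of the coefficient 1/(qC) of m^q is spent on absorbing the linear term Cm. -/
theorem IsCoupling.exists_rpow_le_tangent (hf : IsCoupling q f) :
    ∃ c > 0, ∃ K ≥ 0, ∀ x, ∀ m : ℝ, 0 ≤ m → ∃ s > 0, c * m ^ q - K ≤ tangent f x s m := by
  obtain ⟨C, hC, h⟩ := hf.growth
  have hq := hf.one_lt
  obtain ⟨K, hK, hK'⟩ := exists_mul_le_rpow hq hC.le (show 0 < 1 / (2 * (q * C)) by positivity)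
  refine ⟨1 / (2 * (q * C)), by positivity, K + 2 * C + 1 / (q * C), by positivity,
    fun x m hm => ?_⟩
  rcases le_total m 1 with h1 | h1
  · refine ⟨1, one_pos, ?_⟩
    have h2 := (h x 1 le_rfl).2
    rw [Real.one_rpow] at h2
    have h3 : m ^ q ≤ 1 := Real.rpow_le_one hm h1 (by linarith)
    have h4 : 1 / (2 * (q * C)) * m ^ q ≤ 1 / (q * C) := by
      have : 1 / (2 * (q * C)) ≤ 1 / (q * C) := by
        apply one_div_le_one_div_of_le (by positivity); nlinarith [mul_pos (zero_lt_one.trans hq) hC]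
      have h0 : 0 < 1 / (2 * (q * C)) := by positivity
      nlinarith
    unfold tangent
    rw [primitive_one]
    nlinarith
  · refine ⟨m, by linarith, ?_⟩
    rw [tangent_self]
    have hcont : Continuous fun u : ℝ => 1 / C * u ^ (q - 1) - C :=
      (continuous_const.mul (Real.continuous_rpow_const (by linarith))).sub continuous_const
    have hint : ∫ u in (1 : ℝ)..m, (1 / C * u ^ (q - 1) - C) ≤ primitive f x m := by
      refine intervalIntegral.integral_mono_on h1 (hcont.intervalIntegrable _ _)
        (hf.intervalIntegrable x one_pos (by linarith)) fun u hu => (h x u hu.1).1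
    have hval : ∫ u in (1 : ℝ)..m, (1 / C * u ^ (q - 1) - C)
        = 1 / (q * C) * (m ^ q - 1) - C * (m - 1) := by
      rw [intervalIntegral.integral_sub, intervalIntegral.integral_const_mul,
        integral_rpow (Or.inl (by linarith))]
      · simp only [intervalIntegral.integral_const, smul_eq_mul, sub_add_cancel, Real.one_rpow]
        field_simp
      · exact (continuous_const.mul
          (Real.continuous_rpow_const (by linarith))).intervalIntegrable _ _
      · simp
    have h2 := hK' m hm
    have h3 : 1 / (q * C) = 2 * (1 / (2 * (q * C))) := by field_simp
    have h4 : 0 ≤ 1 / (2 * (q * C)) * m ^ q := by positivity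
    have h5 : 1 / (q * C) * (m ^ q - 1) = 2 * (1 / (2 * (q * C)) * m ^ q) - 1 / (q * C) := by
      rw [h3]; ring
    rw [hval, h5] at hint
    linarith

end Coupling

/-! ### The Hamiltonian and the kinetic energy -/

section Hamiltonian

variable {d : ℕ}

/-- The assumptions on the Hamiltonian `H`. -/
structure IsHamiltonian (r : ℝ) (H : Torus d → E d → ℝ) : Prop where
  one_lt : 1 < r
  cont : Continuous (fun z : Torus d × E d => H z.1 z.2)
  conv : ∀ x, ConvexOn ℝ univ (H x)
  diff : ∀ x, Differentiable ℝ (H x)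
  grad : Continuous (fun z : Torus d × E d => gradient (H z.1) z.2)
  growth : ∃ C > 0, ∀ x p, 1 / (r * C) * ‖p‖ ^ r - C ≤ H x p ∧ H x p ≤ C / r * ‖p‖ ^ r + C

variable {r : ℝ} {H : Torus d → E d → ℝ}

theorem IsHamiltonian.continuous_right (hH : IsHamiltonian r H) (x : Torus d) :
    Continuous (H x) := hH.cont.comp (f := fun p : E d => (x, p)) (by fun_prop)

/-- Superlinear growth of H dominates the linear term, so the concave objective is coercive.
Attainment makes L finite and supplies the optimal momentum used in the equality case of strict
convexity. -/
theorem IsHamiltonian.exists_isMax (hH : IsHamiltonian r H) (x : Torus d) {m : ℝ} (hm : 0 < m)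
    (w : E d) : ∃ p₀, ∀ p, -inner ℝ p w - m * H x p ≤ -inner ℝ p₀ w - m * H x p₀ := by
  obtain ⟨C, hC, h⟩ := hH.growth
  have hr := hH.one_lt
  have hcont : Continuous fun p : E d => inner ℝ p w + m * H x p := by
    have := hH.continuous_right x
    fun_prop
  obtain ⟨K, hK, hK'⟩ := exists_mul_le_rpow hr (A := ‖w‖ + 1) (e := m * (1 / (r * C)))
    (by positivity) (by positivity)
  obtain ⟨p₀, hp₀⟩ := hcont.exists_forall_le (by
    refine tendsto_atTop_mono (f := fun p : E d => ‖p‖ - (K + m * C)) (fun p => ?_) ?_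
    · have h1 := hK' ‖p‖ (norm_nonneg _)
      have h2 := mul_le_mul_of_nonneg_left (h x p).1 hm.le
      have h3 := neg_le_of_abs_le (abs_real_inner_le_norm p w)
      nlinarith
    · exact tendsto_atTop_add_const_right _ _ (tendsto_norm_cocompact_atTop))
  exact ⟨p₀, fun p => by have := hp₀ p; linarith⟩

theorem IsHamiltonian.exists_L_eq (hH : IsHamiltonian r H) (x : Torus d) (v : E d) :
    ∃ l : ℝ, L H x v = l ∧ (∀ p, -inner ℝ p v - H x p ≤ l) ∧
      ∃ p₀, l = -inner ℝ p₀ v - H x p₀ := by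
  obtain ⟨p₀, hp₀⟩ := hH.exists_isMax x one_pos v
  simp only [one_mul] at hp₀
  refine ⟨_, ?_, hp₀, p₀, rfl⟩
  unfold L fenchelConj
  refine le_antisymm (iSup_le fun p => ?_) (le_iSup_of_le p₀ ?_)
  · rw [← EReal.coe_sub, inner_neg_left, real_inner_comm]
    exact EReal.coe_le_coe_iff.2 (hp₀ p)
  · rw [← EReal.coe_sub, inner_neg_left, real_inner_comm]

theorem IsHamiltonian.kinetic_ne_bot (hH : IsHamiltonian r H) (x : Torus d) (m : ℝ) (w : E d) :
    kinetic H x m w ≠ ⊥ := by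
  unfold kinetic
  split_ifs
  · simp
  · simp
  · obtain ⟨l, hl, -⟩ := hH.exists_L_eq x (m⁻¹ • w)
    rw [hl, ← EReal.coe_mul]
    exact EReal.coe_ne_bot _

theorem IsHamiltonian.kinetic_eq (hH : IsHamiltonian r H) (x : Torus d) {m : ℝ} (hm : 0 < m)
    (w : E d) : ∃ k : ℝ, kinetic H x m w = k ∧ (∀ p, -inner ℝ p w - m * H x p ≤ k) ∧
      ∃ p₀, k = -inner ℝ p₀ w - m * H x p₀ := by
  obtain ⟨l, hl, h1, p₀, h2⟩ := hH.exists_L_eq x (m⁻¹ • w)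
  have key : ∀ p : E d, m * (-inner ℝ p (m⁻¹ • w) - H x p) = -inner ℝ p w - m * H x p := by
    intro p
    rw [inner_smul_right]
    field_simp
  refine ⟨m * l, ?_, fun p => ?_, p₀, ?_⟩
  · simp [kinetic, hm.ne', hl]
  · rw [← key]; exact mul_le_mul_of_nonneg_left (h1 p) hm.le
  · rw [h2, key]

/-- At zero density the supremum over momenta is finite only for zero flux. This is the convention
built into `kinetic`, so the dual formula also covers m = 0. -/
theorem eq_zero_of_forall_inner_le {w : E d} {a : ℝ} (h : ∀ p : E d, -inner ℝ p w ≤ a) :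
    w = 0 := by
  by_contra hw
  have hw' : 0 < ‖w‖ ^ 2 := by positivity
  have := h (-((a + 1) / ‖w‖ ^ 2) • w)
  rw [inner_smul_left, real_inner_self_eq_norm_sq] at this
  simp only [map_neg, conj_trivial] at this
  rw [neg_mul, neg_neg, div_mul_cancel₀ _ hw'.ne'] at this
  linarith

theorem IsHamiltonian.le_kinetic (hH : IsHamiltonian r H) (x : Torus d) {m : ℝ} (hm : 0 ≤ m)
    (w p : E d) : ((-inner ℝ p w - m * H x p : ℝ) : EReal) ≤ kinetic H x m w := by
  rcases hm.eq_or_lt with rfl | hm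
  · by_cases hw : w = 0
    · simp [kinetic, hw]
    · simp [kinetic, hw]
  · obtain ⟨k, hk, h, -⟩ := hH.kinetic_eq x hm w
    rw [hk]
    exact EReal.coe_le_coe_iff.2 (h p)

theorem IsHamiltonian.kinetic_le (hH : IsHamiltonian r H) (x : Torus d) {m a : ℝ} (hm : 0 ≤ m)
    {w : E d} (h : ∀ p, -inner ℝ p w - m * H x p ≤ a) : kinetic H x m w ≤ a := by
  rcases hm.eq_or_lt with rfl | hm
  · have hw : w = 0 := eq_zero_of_forall_inner_le (a := a) fun p => by simpa using h p
    have := h 0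
    simp only [inner_zero_left, neg_zero, zero_mul, sub_zero] at this
    simpa [kinetic, hw] using EReal.coe_le_coe_iff.2 this
  · obtain ⟨k, hk, -, p₀, rfl⟩ := hH.kinetic_eq x hm w
    rw [hk]
    exact EReal.coe_le_coe_iff.2 (h p₀)

/-- First-order condition at the maximizing momentum. As it determines w from m and p₀, it plays the
role of strict convexity of L. -/
theorem IsHamiltonian.gradient_of_isMax (hH : IsHamiltonian r H) (x : Torus d) {m : ℝ}
    {w p₀ : E d} (h : ∀ p, -inner ℝ p w - m * H x p ≤ -inner ℝ p₀ w - m * H x p₀) :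
    w = -(m • gradient (H x) p₀) := by
  have h1 : HasFDerivAt (H x) (InnerProductSpace.toDual ℝ (E d) (gradient (H x) p₀)) p₀ :=
    ((hH.diff x) p₀).hasGradientAt.hasFDerivAt
  have h2 : HasFDerivAt (fun p : E d => inner ℝ w p + m * H x p)
      (InnerProductSpace.toDual ℝ (E d) w +
        m • InnerProductSpace.toDual ℝ (E d) (gradient (H x) p₀)) p₀ := by
    exact ((InnerProductSpace.toDual ℝ (E d) w).hasFDerivAt (x := p₀)).add (h1.const_mul m)
  have h3 : IsLocalMin (fun p : E d => inner ℝ w p + m * H x p) p₀ :=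
    Filter.Eventually.of_forall fun p => by
      have := h p
      rw [real_inner_comm w p, real_inner_comm w p₀] at this
      linarith
  have h4 := h3.hasFDerivAt_eq_zero h2
  refine eq_neg_of_add_eq_zero_left (ext_inner_right ℝ fun u => ?_)
  simpa [inner_add_left, inner_smul_left] using DFunLike.congr_fun h4 u

end Hamiltonian

/-! ### The running cost -/

section RunningCost

variable {d : ℕ} {q r : ℝ} {f : Torus d → ℝ → ℝ} {H : Torus d → E d → ℝ}

/-- The integrand `m L(x, w/m) + F(x,m)`. -/
def runningCost (H : Torus d → E d → ℝ) (f : Torus d → ℝ → ℝ) (x : Torus d) (m : ℝ) (w : E d) :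
    EReal := kinetic H x m w + F f x m

/-- Affine minorant of the running cost with slopes given by `p` and `s`. -/
def minorant (H : Torus d → E d → ℝ) (f : Torus d → ℝ → ℝ) (x : Torus d) (p : E d) (s m : ℝ)
    (w : E d) : ℝ := -inner ℝ p w - m * H x p + tangent f x s m

/-- Sublevel sets of the cost are intersections of half-spaces whose coefficients depend
continuously on x. Convexity, lower semicontinuity, strict convexity and coercivity all rest on this
description. -/
theorem runningCost_le_iff (hH : IsHamiltonian r H) (hf : IsCoupling q f) (x : Torus d)
    (m : ℝ) (w : E d) (a : ℝ) : runningCost H f x m w ≤ a ↔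
      0 ≤ m ∧ ∀ p, ∀ s > 0, minorant H f x p s m w ≤ a := by
  constructor
  · intro h
    have hm : 0 ≤ m := by
      by_contra hm
      rw [runningCost, F_of_neg f x (not_le.1 hm),
        EReal.add_top_of_ne_bot (hH.kinetic_ne_bot x m w)] at h
      simp at h
    refine ⟨hm, fun p s hs => ?_⟩
    have := (add_le_add (hH.le_kinetic x hm w p) (hf.tangent_le_F x m hs)).trans h
    rw [← EReal.coe_add] at this
    exact EReal.coe_le_coe_iff.1 this
  · rintro ⟨hm, h⟩
    -- The tangent at s = 1 alone makes the kinetic term finite; it can then be subtracted before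
    -- taking the supremum over s.
    have hk : ∃ k : ℝ, kinetic H x m w = k := by
      have h1 : kinetic H x m w ≤ ((a - tangent f x 1 m : ℝ) : EReal) :=
        hH.kinetic_le x hm fun p => by have := h p 1 one_pos; unfold minorant at this; linarith
      exact ⟨_, (EReal.coe_toReal (ne_top_of_le_ne_top (EReal.coe_ne_top _) h1)
        (hH.kinetic_ne_bot x m w)).symm⟩
    obtain ⟨k, hk⟩ := hk
    have hF : F f x m ≤ ((a - k : ℝ) : EReal) := hf.F_le_of_tangent_le x hm fun s hs => by
      have : kinetic H x m w ≤ ((a - tangent f x s m : ℝ) : EReal) :=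
        hH.kinetic_le x hm fun p => by have := h p s hs; unfold minorant at this; linarith
      rw [hk, EReal.coe_le_coe_iff] at this
      linarith
    calc runningCost H f x m w ≤ (k : EReal) + ((a - k : ℝ) : EReal) := by
          rw [runningCost, hk]; exact add_le_add le_rfl hF
      _ = a := by rw [← EReal.coe_add]; simp

theorem convex_runningCost (hH : IsHamiltonian r H) (hf : IsCoupling q f) (x : Torus d)
    {m n : ℝ} {v w : E d} {a b s t : ℝ} (hs : 0 ≤ s) (ht : 0 ≤ t) (hst : s + t = 1)
    (hm : runningCost H f x m v ≤ a) (hn : runningCost H f x n w ≤ b) :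
    runningCost H f x (s * m + t * n) (s • v + t • w) ≤ ((s * a + t * b : ℝ) : EReal) := by
  rw [runningCost_le_iff hH hf] at hm hn ⊢
  obtain ⟨hm0, hm⟩ := hm
  obtain ⟨hn0, hn⟩ := hn
  refine ⟨by positivity, fun p σ hσ => ?_⟩
  have h1 := mul_le_mul_of_nonneg_left (hm p σ hσ) hs
  have h2 := mul_le_mul_of_nonneg_left (hn p σ hσ) ht
  have h3 : minorant H f x p σ (s * m + t * n) (s • v + t • w) =
      s * minorant H f x p σ m v + t * minorant H f x p σ n w := by
    simp only [minorant, tangent, inner_add_right, inner_smul_right]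
    linear_combination -(primitive f x σ - f x σ * σ) * hst
  linarith

theorem lowerSemicontinuous_runningCost (hH : IsHamiltonian r H) (hf : IsCoupling q f) :
    LowerSemicontinuous fun y : Torus d × ℝ × E d => runningCost H f y.1 y.2.1 y.2.2 := by
  have hreal : ∀ a : ℝ, IsClosed
      {y : Torus d × ℝ × E d | runningCost H f y.1 y.2.1 y.2.2 ≤ a} := by
    intro a
    simp only [runningCost_le_iff hH hf, ofPred_and, ofPred_forall]
    refine (isClosed_le continuous_const (by fun_prop)).inter (isClosed_iInter fun p =>
      isClosed_iInter fun s => isClosed_iInter fun hs => isClosed_le ?_ continuous_const)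
    have h1 := hf.continuous_primitive hs
    have h2 := hf.continuous_apply hs
    have h3 : Continuous fun x => H x p := hH.cont.comp (f := fun x => (x, p)) (by fun_prop)
    unfold minorant tangent
    fun_prop
  rw [lowerSemicontinuous_iff_isClosed_preimage]
  intro y
  induction y with
  | coe a => exact hreal a
  | top => simp
  | bot =>
    have : (fun y : Torus d × ℝ × E d => runningCost H f y.1 y.2.1 y.2.2) ⁻¹' Iic ⊥ =
        ⋂ a : ℝ, {y | runningCost H f y.1 y.2.1 y.2.2 ≤ a} := by
      ext y
      simp only [mem_preimage, mem_Iic, mem_iInter, mem_ofPred_eq, le_bot_iff]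
      exact ⟨fun h a => h ▸ bot_le, fun h => (EReal.eq_bot_iff_forall_lt _).2 fun a =>
        (h (a - 1)).trans_lt (EReal.coe_lt_coe_iff.2 (by linarith))⟩
    rw [this]
    exact isClosed_iInter hreal

theorem IsCoupling.eq_of_tangent_le (hf : IsCoupling q f) (x : Torus d) {m n : ℝ} (hn : 0 < n)
    (hm : 0 ≤ m) (h : ∀ s > 0, tangent f x s m ≤ tangent f x n m) : m = n := by
  by_contra hmn
  rcases hm.eq_or_lt with rfl | hm
  -- At 0 the tangents take larger values as their base point decreases, so the one based at n/2
  -- already contradicts the maximality of the one based at n.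
  · have h1 := h (n / 2) (by positivity)
    have h2 := hf.tangent_lt x hn (m := n / 2) (by positivity) (by linarith)
    have h3 := hf.mono x (mem_Ioi.2 (half_pos hn)) hn (by linarith)
    simp only [tangent] at h1 h2
    nlinarith
  · have h1 := h m hm
    rw [tangent_self] at h1
    exact absurd h1 (not_le.2 (hf.tangent_lt x hn hm hmn))

/-- Take the affine minorant that is exact at the midpoint. Its midpoint value is the average of its
endpoint values, which are at most a and b, so it is exact at both endpoints. Exactness forces m and
n to equal the midpoint density, and makes p₀ optimal for both fluxes, so both are -m D_pH(x,p₀). If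
the midpoint density is 0, both densities and both fluxes vanish. -/
theorem strictConvex_runningCost (hH : IsHamiltonian r H) (hf : IsCoupling q f) (x : Torus d)
    {m n : ℝ} {v w : E d} {a b : ℝ} (hm : runningCost H f x m v ≤ a)
    (hn : runningCost H f x n w ≤ b)
    (hmid : (((a + b) / 2 : ℝ) : EReal) ≤
      runningCost H f x (1 / 2 * m + 1 / 2 * n) ((1 / 2 : ℝ) • v + (1 / 2 : ℝ) • w)) :
    m = n ∧ v = w := by
  rw [runningCost_le_iff hH hf] at hm hn
  obtain ⟨hm0, hm⟩ := hm
  obtain ⟨hn0, hn⟩ := hn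
  set k := 1 / 2 * m + 1 / 2 * n with hk
  have hk0 : 0 ≤ k := by positivity
  rcases hk0.eq_or_lt with hk0 | hk0
  · obtain rfl : m = 0 := by linarith
    obtain rfl : n = 0 := by linarith
    refine ⟨rfl, ?_⟩
    rw [eq_zero_of_forall_inner_le (w := v) (a := a - tangent f x 1 0) fun p => ?_,
      eq_zero_of_forall_inner_le (w := w) (a := b - tangent f x 1 0) fun p => ?_]
    · have := hn p 1 one_pos
      simp only [minorant, zero_mul, sub_zero] at this
      linarith
    · have := hm p 1 one_pos
      simp only [minorant, zero_mul, sub_zero] at this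
      linarith
  obtain ⟨p₀, hp₀⟩ := hH.exists_isMax x hk0 ((1 / 2 : ℝ) • v + (1 / 2 : ℝ) • w)
  have hle : runningCost H f x k ((1 / 2 : ℝ) • v + (1 / 2 : ℝ) • w) ≤
      (minorant H f x p₀ k k ((1 / 2 : ℝ) • v + (1 / 2 : ℝ) • w) : EReal) := by
    rw [runningCost_le_iff hH hf]
    refine ⟨hk0.le, fun p s hs => ?_⟩
    unfold minorant
    have := hf.tangent_le x hs hk0
    rw [tangent_self]
    linarith [hp₀ p]
  have havg : minorant H f x p₀ k k ((1 / 2 : ℝ) • v + (1 / 2 : ℝ) • w) =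
      1 / 2 * minorant H f x p₀ k m v + 1 / 2 * minorant H f x p₀ k n w := by
    simp only [minorant, tangent, inner_add_right, inner_smul_right, hk]
    ring
  have h1 := EReal.coe_le_coe_iff.1 (hmid.trans hle)
  have hm1 := hm p₀ k hk0
  have hn1 := hn p₀ k hk0
  have ea : minorant H f x p₀ k m v = a := by linarith
  have eb : minorant H f x p₀ k n w = b := by linarith
  have hmk : m = k := hf.eq_of_tangent_le x hk0 hm0 fun s hs => by
    have := hm p₀ s hs
    rw [← ea] at this
    simp only [minorant] at this
    linarith
  have hnk : n = k := hf.eq_of_tangent_le x hk0 hn0 fun s hs => by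
    have := hn p₀ s hs
    rw [← eb] at this
    simp only [minorant] at this
    linarith
  refine ⟨hmk.trans hnk.symm, ?_⟩
  have hv : v = -(m • gradient (H x) p₀) := hH.gradient_of_isMax x fun p => by
    have := hm p k hk0
    rw [← ea] at this
    simp only [minorant] at this
    linarith
  have hw : w = -(n • gradient (H x) p₀) := hH.gradient_of_isMax x fun p => by
    have := hn p k hk0
    rw [← eb] at this
    simp only [minorant] at this
    linarith
  rw [hv, hw, hmk, ← hnk]

/-- Dual form of the lower bound L(x,v) ≥ c|v|^{r'} - C, obtained from the upper bound on H. -/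
theorem IsHamiltonian.exists_momentum (hH : IsHamiltonian r H) : ∃ c > 0, ∃ C ≥ 0, ∀ x (v : E d),
    ∃ p : E d, c * ‖v‖ ^ r.conjExponent - C ≤ -inner ℝ p v - H x p := by
  obtain ⟨C, hC, h⟩ := hH.growth
  have hr := hH.one_lt
  have hrc : r.HolderConjugate r.conjExponent := Real.HolderConjugate.conjExponent hr
  have hr' := hrc.symm.lt
  -- Chosen so that (C/r)λ^r = λ/2: the cost H(x,p) then consumes only half of the gain -⟨p,v⟩.
  set lam : ℝ := (r / (2 * C)) ^ (1 / (r - 1))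
  have hlam : 0 < lam := by positivity
  have hlam' : C / r * lam ^ r = lam / 2 := by
    have h1 : lam ^ r = lam ^ (r - 1) * lam := by
      rw [← Real.rpow_add_one hlam.ne']; ring_nf
    have h2 : lam ^ (r - 1) = r / (2 * C) := by
      rw [← Real.rpow_mul (by positivity), one_div_mul_cancel (by linarith), Real.rpow_one]
    rw [h1, h2]
    field_simp
  refine ⟨lam / 2, by positivity, C, hC.le, fun x v => ?_⟩
  rcases eq_or_ne v 0 with rfl | hv
  · refine ⟨0, ?_⟩
    have := (h x 0).2
    rw [norm_zero, Real.zero_rpow (by linarith)] at this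
    rw [norm_zero, Real.zero_rpow (by linarith), inner_zero_left]
    linarith
  have hv' : 0 < ‖v‖ := norm_pos_iff.2 hv
  -- This p has degree r'-1 in v, so that ⟨p,v⟩ and |p|^r are both multiples of |v|^{r'}.
  refine ⟨-(lam * ‖v‖ ^ (r.conjExponent - 2)) • v, ?_⟩
  have h1 : inner ℝ (-(lam * ‖v‖ ^ (r.conjExponent - 2)) • v) v
      = -(lam * ‖v‖ ^ r.conjExponent) := by
    rw [inner_smul_left, real_inner_self_eq_norm_sq, conj_trivial, neg_mul, mul_assoc,
      ← Real.rpow_natCast, ← Real.rpow_add hv']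
    norm_num
  have h2 : ‖-(lam * ‖v‖ ^ (r.conjExponent - 2)) • v‖ ^ r
      = lam ^ r * ‖v‖ ^ r.conjExponent := by
    rw [norm_smul, norm_neg, Real.norm_of_nonneg (by positivity), mul_assoc,
      ← Real.rpow_add_one hv'.ne', Real.mul_rpow hlam.le (by positivity), ← Real.rpow_mul hv'.le]
    congr 2
    rw [Real.conjExponent]
    have : r - 1 ≠ 0 := by linarith
    field_simp
    ring
  have h3 := (h x (-(lam * ‖v‖ ^ (r.conjExponent - 2)) • v)).2
  rw [h2, ← mul_assoc, hlam'] at h3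
  rw [h1]
  linarith

/-- Weighted AM-GM with weights q/(ρ+q-1) and (ρ-1)/(ρ+q-1); the exponent on the left is the one for
which the powers of m and y agree. -/
theorem rpow_mul_le_add {ρ q m y : ℝ} (hρ : 1 < ρ) (hq : 1 < q) (hm : 0 < m) (hy : 0 ≤ y) :
    (m * y) ^ (ρ * q / (ρ + q - 1)) ≤ m * y ^ ρ + m ^ q := by
  have hD : 0 < ρ + q - 1 := by linarith
  have h := Real.geom_mean_le_arith_mean2_weighted (w₁ := q / (ρ + q - 1))
    (w₂ := (ρ - 1) / (ρ + q - 1)) (p₁ := m * y ^ ρ) (p₂ := m ^ q) (by positivity)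
    (div_nonneg (by linarith) hD.le) (by positivity) (by positivity) (by field_simp; ring)
  have e1 : (m * y ^ ρ) ^ (q / (ρ + q - 1)) * (m ^ q) ^ ((ρ - 1) / (ρ + q - 1)) =
      (m * y) ^ (ρ * q / (ρ + q - 1)) := by
    rw [Real.mul_rpow hm.le (by positivity), Real.mul_rpow hm.le hy, ← Real.rpow_mul hy,
      ← Real.rpow_mul hm.le, mul_right_comm, ← Real.rpow_add hm]
    congr 2
    · field_simp; ring
    · field_simp
  rw [e1] at h
  have h1 : q / (ρ + q - 1) ≤ 1 := by rw [div_le_one hD]; linarith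
  have h2 : (ρ - 1) / (ρ + q - 1) ≤ 1 := by rw [div_le_one hD]; linarith
  have h3 : 0 ≤ m * y ^ ρ := by positivity
  have h4 : 0 ≤ m ^ q := by positivity
  nlinarith

/-- Coercivity of the running cost. -/
theorem exists_coercive (hH : IsHamiltonian r H) (hf : IsCoupling q f) :
    ∃ K > 0, ∃ C ≥ 0, ∀ x (m : ℝ) (w : E d) (a : ℝ), runningCost H f x m w ≤ a →
      m ^ q + ‖w‖ ^ (r.conjExponent * q / (r.conjExponent + q - 1)) ≤ K * (a + C) := by
  obtain ⟨c, hc, C, hC, h⟩ := hH.exists_momentum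
  obtain ⟨c', hc', K, hK, h'⟩ := hf.exists_rpow_le_tangent
  have hq := hf.one_lt
  obtain ⟨K', hK', h''⟩ := exists_mul_le_rpow hq hC (half_pos hc')
  have hρ : 1 < r.conjExponent := (Real.HolderConjugate.conjExponent hH.one_lt).symm.lt
  set ρ := r.conjExponent
  have hexp : 0 < ρ * q / (ρ + q - 1) := by
    apply div_pos <;> nlinarith
  -- With Y = m|w/m|^ρ, the left-hand side is at most Y + 2m^q, while cY + (c'/2)m^q ≤ a + K + K'.
  -- These two facts give 1/c and 4/c'.
  refine ⟨1 / c + 4 / c', by positivity, K + K', by positivity, fun x m w a ha => ?_⟩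
  rw [runningCost_le_iff hH hf] at ha
  obtain ⟨hm, ha⟩ := ha
  obtain ⟨s, hs, hs'⟩ := h' x m hm
  have hCm := h'' m hm
  rcases hm.eq_or_lt with rfl | hm
  · have hw : w = 0 := eq_zero_of_forall_inner_le (a := a - tangent f x s 0) fun p => by
      have := ha p s hs
      simp only [minorant, zero_mul, sub_zero] at this
      linarith
    have h0 := ha 0 s hs
    rw [Real.zero_rpow (by linarith)] at hs' ⊢
    simp only [minorant, inner_zero_left, zero_mul, neg_zero, sub_zero, zero_add, mul_zero,
      zero_sub] at h0 hs'
    rw [hw, norm_zero, Real.zero_rpow hexp.ne']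
    have : 0 ≤ a + (K + K') := by linarith
    simp only [add_zero]
    positivity
  obtain ⟨p, hp⟩ := h x (m⁻¹ • w)
  have h1 := ha p s hs
  have h2 : m * (-inner ℝ p (m⁻¹ • w) - H x p) = -inner ℝ p w - m * H x p := by
    rw [inner_smul_right]; field_simp
  have h3 := mul_le_mul_of_nonneg_left hp hm.le
  rw [h2] at h3
  have h4 := rpow_mul_le_add hρ hq hm (norm_nonneg (m⁻¹ • w))
  have h5 : m * ‖m⁻¹ • w‖ = ‖w‖ := by
    rw [norm_smul, norm_inv, Real.norm_of_nonneg hm.le]; field_simp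
  rw [h5] at h4
  unfold minorant at h1
  set Y := m * ‖m⁻¹ • w‖ ^ ρ with hY
  have hY0 : 0 ≤ Y := by positivity
  have hmq : 0 ≤ m ^ q := by positivity
  have h6 : c * Y + c' / 2 * m ^ q ≤ a + (K + K') := by
    have : m * (c * ‖m⁻¹ • w‖ ^ ρ - C) = c * Y - C * m := by rw [hY]; ring
    rw [this] at h3
    linarith
  have h7 : Y ≤ 1 / c * (a + (K + K')) := by
    rw [one_div, le_inv_mul_iff₀ hc]
    have : 0 ≤ c' / 2 * m ^ q := by positivity
    linarith
  have h8 : 2 * m ^ q ≤ 4 / c' * (a + (K + K')) := by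
    have h9 : c' / 2 * m ^ q ≤ a + (K + K') := by
      have : 0 ≤ c * Y := by positivity
      linarith
    calc 2 * m ^ q = 4 / c' * (c' / 2 * m ^ q) := by field_simp; norm_num
      _ ≤ _ := by gcongr
  linarith [add_mul (1 / c) (4 / c') (a + (K + K'))]

end RunningCost

/-! ### Calculus on the torus through periodic lifts -/

section Lift

variable {d : ℕ}

theorem proj_add (v w : E d) : proj (v + w) = proj v + proj w := by
  ext i; simp [proj]

theorem proj_sub (v w : E d) : proj (v - w) = proj v - proj w := by
  ext i; simp [proj]

theorem proj_zero : proj (0 : E d) = 0 := by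
  ext i; simp [proj]

theorem isOpenQuotientMap_proj : IsOpenQuotientMap (proj : E d → Torus d) := by
  have h : IsOpenQuotientMap (Pi.map (fun (_ : Fin d) (t : ℝ) => (t : UnitAddCircle))) :=
    IsOpenQuotientMap.piMap fun _ => QuotientAddGroup.isOpenQuotientMap_mk
  exact h.comp (EuclideanSpace.equiv (Fin d) ℝ).toHomeomorph.isOpenQuotientMap

theorem continuous_proj : Continuous (proj : E d → Torus d) := isOpenQuotientMap_proj.continuous

/-- The projection `ℝ × ℝ^d → ℝ × 𝕋^d`. -/
def stProj (z : ℝ × E d) : ℝ × Torus d := (z.1, proj z.2)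

theorem isOpenQuotientMap_stProj : IsOpenQuotientMap (stProj : ℝ × E d → ℝ × Torus d) :=
  IsOpenQuotientMap.id.prodMap isOpenQuotientMap_proj

/-- Since `stProj` is open and continuous and the strip is saturated, neighbourhoods within the
strip upstairs push forward to neighbourhoods within the strip downstairs. -/
theorem continuousOn_of_comp_stProj {X : Type*} [TopologicalSpace X] {g : ℝ × Torus d → X}
    {I : Set ℝ} (h : ContinuousOn (fun z : ℝ × E d => g (stProj z)) (I ×ˢ univ)) :
    ContinuousOn g (I ×ˢ univ) := by
  rintro ⟨t, x⟩ hz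
  obtain ⟨v, rfl⟩ := isOpenQuotientMap_proj.surjective x
  have h1 := h (t, v) hz
  have h2 : (I ×ˢ univ : Set (ℝ × E d)) = stProj ⁻¹' (I ×ˢ univ) := by
    ext z; simp [stProj]
  have h3 : map stProj (𝓝[I ×ˢ univ] (t, v)) = 𝓝[I ×ˢ univ] (stProj (t, v)) := by
    rw [nhdsWithin, h2, Filter.map_inf_principal_preimage, isOpenQuotientMap_stProj.map_nhds_eq]
    rfl
  change Tendsto g (𝓝[I ×ˢ univ] (stProj (t, v))) _
  rw [← h3]
  exact tendsto_map'_iff.2 h1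

/-- The periodic lift of a function on `ℝ × 𝕋^d`. -/
def lift (φ : ℝ → Torus d → ℝ) (z : ℝ × E d) : ℝ := φ z.1 (proj z.2)

theorem spaceGrad_proj (ψ : Torus d → ℝ) (v : E d) :
    spaceGrad ψ (proj v) = gradient (fun u => ψ (proj u)) v := by
  unfold spaceGrad gradient
  simp only [← proj_add]
  rw [fderiv_comp_add_left (f := fun u => ψ (proj u)), add_zero]

variable {φ : ℝ → Torus d → ℝ} {I : Set ℝ}

theorem uniqueDiffOn_strip (hI : UniqueDiffOn ℝ I) :
    UniqueDiffOn ℝ (I ×ˢ (univ : Set (E d))) := hI.prod uniqueDiffOn_univ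

theorem hasFDerivWithinAt_lift (h : ContDiffOn ℝ 1 (lift φ) (I ×ˢ univ)) {t : ℝ} (ht : t ∈ I)
    (v : E d) : HasFDerivWithinAt (lift φ) (fderivWithin ℝ (lift φ) (I ×ˢ univ) (t, v))
      (I ×ˢ univ) (t, v) :=
  ((h.differentiableOn one_ne_zero) (t, v) ⟨ht, mem_univ _⟩).hasFDerivWithinAt

theorem hasDerivWithinAt_time (h : ContDiffOn ℝ 1 (lift φ) (I ×ˢ univ)) {t : ℝ} (ht : t ∈ I)
    (v : E d) : HasDerivWithinAt (fun s => φ s (proj v))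
      (fderivWithin ℝ (lift φ) (I ×ˢ univ) (t, v) (1, 0)) I t := by
  have h1 := hasFDerivWithinAt_lift h ht v
  have h2 : HasDerivWithinAt (fun s : ℝ => ((s, v) : ℝ × E d)) (1, 0) I t :=
    (hasDerivWithinAt_id t I).prodMk (hasDerivWithinAt_const t I v)
  have h3 : MapsTo (fun s : ℝ => ((s, v) : ℝ × E d)) I (I ×ˢ univ) := fun s hs => ⟨hs, mem_univ _⟩
  exact h1.comp_hasDerivWithinAt t h2 h3

theorem hasFDerivAt_space (h : ContDiffOn ℝ 1 (lift φ) (I ×ˢ univ)) {t : ℝ} (ht : t ∈ I)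
    (v : E d) : HasFDerivAt (fun u => φ t (proj u))
      ((fderivWithin ℝ (lift φ) (I ×ˢ univ) (t, v)).comp (ContinuousLinearMap.inr ℝ ℝ (E d))) v := by
  have h1 := hasFDerivWithinAt_lift h ht v
  have h2 : HasFDerivAt (fun u : E d => ((t, u) : ℝ × E d)) (ContinuousLinearMap.inr ℝ ℝ (E d)) v :=
    hasFDerivAt_prodMk_right t v
  have h3 := h1.comp v h2.hasFDerivWithinAt (s := univ) fun u _ => ⟨ht, mem_univ _⟩
  rwa [hasFDerivWithinAt_univ] at h3

theorem derivWithin_time (hI : UniqueDiffOn ℝ I) (h : ContDiffOn ℝ 1 (lift φ) (I ×ˢ univ)) {t : ℝ}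
    (ht : t ∈ I) (v : E d) : derivWithin (fun s => φ s (proj v)) I t =
      fderivWithin ℝ (lift φ) (I ×ˢ univ) (t, v) (1, 0) :=
  (hasDerivWithinAt_time h ht v).derivWithin (hI t ht)

theorem spaceGrad_eq (h : ContDiffOn ℝ 1 (lift φ) (I ×ˢ univ)) {t : ℝ} (ht : t ∈ I)
    (v : E d) : spaceGrad (φ t) (proj v) = (InnerProductSpace.toDual ℝ (E d)).symm
      ((fderivWithin ℝ (lift φ) (I ×ˢ univ) (t, v)).comp (ContinuousLinearMap.inr ℝ ℝ (E d))) := by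
  rw [spaceGrad_proj, gradient, (hasFDerivAt_space h ht v).fderiv]

theorem continuousOn_derivWithin_time (hI : UniqueDiffOn ℝ I)
    (h : ContDiffOn ℝ 1 (lift φ) (I ×ˢ univ)) :
    ContinuousOn (fun z : ℝ × Torus d => derivWithin (fun s => φ s z.2) I z.1) (I ×ˢ univ) := by
  refine continuousOn_of_comp_stProj ?_
  have h1 := h.continuousOn_fderivWithin (uniqueDiffOn_strip hI) le_rfl
  exact (h1.clm_apply continuousOn_const).congr fun z hz => derivWithin_time hI h hz.1 z.2

theorem continuousOn_spaceGrad (hI : UniqueDiffOn ℝ I)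
    (h : ContDiffOn ℝ 1 (lift φ) (I ×ˢ univ)) :
    ContinuousOn (fun z : ℝ × Torus d => spaceGrad (φ z.1) z.2) (I ×ˢ univ) := by
  refine continuousOn_of_comp_stProj ?_
  have h1 := h.continuousOn_fderivWithin (uniqueDiffOn_strip hI) le_rfl
  refine ((InnerProductSpace.toDual ℝ (E d)).symm.continuous.comp_continuousOn
    (h1.clm_comp (continuousOn_const (c := ContinuousLinearMap.inr ℝ ℝ (E d))))).congr fun z hz => ?_
  exact spaceGrad_eq h hz.1 z.2

theorem continuousOn_of_lift (h : ContDiffOn ℝ 1 (lift φ) (I ×ˢ univ)) :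
    ContinuousOn (fun z : ℝ × Torus d => φ z.1 z.2) (I ×ˢ univ) :=
  continuousOn_of_comp_stProj h.continuousOn

section Global

theorem contDiffOn_univ_lift (h : ContDiff ℝ 1 (lift φ)) :
    ContDiffOn ℝ 1 (lift φ) ((univ : Set ℝ) ×ˢ univ) := by
  rw [univ_prod_univ]; exact h.contDiffOn

theorem deriv_time (h : ContDiff ℝ 1 (lift φ)) (t : ℝ) (v : E d) :
    deriv (fun s => φ s (proj v)) t = fderiv ℝ (lift φ) (t, v) (1, 0) := by
  have := derivWithin_time uniqueDiffOn_univ (contDiffOn_univ_lift h) (mem_univ t) v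
  rwa [derivWithin_univ, univ_prod_univ, fderivWithin_univ] at this

theorem hasDerivAt_time (h : ContDiff ℝ 1 (lift φ)) (t : ℝ) (x : Torus d) :
    HasDerivAt (fun s => φ s x) (deriv (fun s => φ s x) t) t := by
  obtain ⟨v, rfl⟩ := isOpenQuotientMap_proj.surjective x
  have := (hasDerivWithinAt_time (contDiffOn_univ_lift h) (mem_univ t) v)
  exact (hasDerivWithinAt_univ.1 this).differentiableAt.hasDerivAt

theorem spaceGrad_eq_global (h : ContDiff ℝ 1 (lift φ)) (t : ℝ) (v : E d) :
    spaceGrad (φ t) (proj v) = (InnerProductSpace.toDual ℝ (E d)).symm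
      ((fderiv ℝ (lift φ) (t, v)).comp (ContinuousLinearMap.inr ℝ ℝ (E d))) := by
  have := spaceGrad_eq (contDiffOn_univ_lift h) (mem_univ t) v
  rwa [univ_prod_univ, fderivWithin_univ] at this

theorem continuous_deriv_time (h : ContDiff ℝ 1 (lift φ)) :
    Continuous (fun z : ℝ × Torus d => deriv (fun s => φ s z.2) z.1) := by
  have := continuousOn_derivWithin_time uniqueDiffOn_univ (contDiffOn_univ_lift h)
  rw [univ_prod_univ, continuousOn_univ] at this
  simpa only [derivWithin_univ] using this

theorem continuous_spaceGrad (h : ContDiff ℝ 1 (lift φ)) :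
    Continuous (fun z : ℝ × Torus d => spaceGrad (φ z.1) z.2) := by
  have := continuousOn_spaceGrad uniqueDiffOn_univ (contDiffOn_univ_lift h)
  rwa [univ_prod_univ, continuousOn_univ] at this

theorem continuous_of_lift (h : ContDiff ℝ 1 (lift φ)) :
    Continuous (fun z : ℝ × Torus d => φ z.1 z.2) := by
  have := continuousOn_of_lift (contDiffOn_univ_lift h)
  rwa [univ_prod_univ, continuousOn_univ] at this

/-- A function of space only, seen as a function of time and space. -/
theorem SpaceContDiff.contDiff_lift {n : WithTop ℕ∞} {ψ : Torus d → ℝ} (h : SpaceContDiff n ψ) :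
    ContDiff ℝ n (lift fun _ : ℝ => ψ) :=
  ContDiff.comp (g := fun v : E d => ψ (proj v)) h contDiff_snd

theorem SpaceContDiff.continuous {ψ : Torus d → ℝ} (h : SpaceContDiff 1 ψ) : Continuous ψ :=
  (isOpenQuotientMap_proj.continuous_comp_iff).1 (ContDiff.continuous h)

theorem SpaceContDiff.continuous_spaceGrad {ψ : Torus d → ℝ} (h : SpaceContDiff 1 ψ) :
    Continuous (spaceGrad ψ) :=
  (MFG.continuous_spaceGrad h.contDiff_lift).comp (f := fun x => ((0 : ℝ), x)) (by fun_prop)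

end Global
end Lift

/-! ### Mollification -/

section Mollification

open scoped Convolution

/-- The derivative is put on the C¹ factor rather than on the kernel, so gradients of mollifications
are mollifications of the gradient and converge to it. -/
theorem hasFDerivAt_convolution {G : Type*} [NormedAddCommGroup G] [NormedSpace ℝ G]
    [FiniteDimensional ℝ G] [MeasurableSpace G] [BorelSpace G] {μ : Measure G} [μ.IsAddHaarMeasure]
    {ρ g : G → ℝ} (hρ : Continuous ρ) (hρc : HasCompactSupport ρ) (hg : ContDiff ℝ 1 g) (x : G) :
    HasFDerivAt (ρ ⋆[ContinuousLinearMap.lsmul ℝ ℝ, μ] g)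
      ((ρ ⋆[ContinuousLinearMap.lsmul ℝ ℝ, μ] (fderiv ℝ g : G → G →L[ℝ] ℝ)) x) x := by
  have hg' : Continuous (fderiv ℝ g) := hg.continuous_fderiv one_ne_zero
  have hK : IsCompact ((fun p : G × G => p.1 - p.2) '' (Metric.closedBall x 1 ×ˢ tsupport ρ)) :=
    ((isCompact_closedBall x 1).prod hρc).image (by fun_prop)
  obtain ⟨C, hC⟩ := hK.exists_bound_of_continuousOn hg'.continuousOn
  refine hasFDerivAt_integral_of_dominated_of_fderiv_le (𝕜 := ℝ)
    (F := fun z y => ContinuousLinearMap.lsmul ℝ ℝ (ρ y) (g (z - y)))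
    (F' := fun z y => ContinuousLinearMap.lsmul ℝ ℝ (ρ y) (fderiv ℝ g (z - y)))
    (bound := fun y => ‖ρ y‖ * C)
    (Metric.closedBall_mem_nhds x one_pos) (Eventually.of_forall fun z => ?_) ?_ ?_
    (ae_of_all _ fun y z hz => ?_) ?_ (ae_of_all _ fun y z _ => ?_)
  · exact (by fun_prop : Continuous fun y => ρ y * g (z - y)).aestronglyMeasurable
  · exact Continuous.integrable_of_hasCompactSupport
      (by fun_prop : Continuous fun y => ρ y * g (x - y)) hρc.mul_right
  · exact (by fun_prop : Continuous fun y => ρ y • fderiv ℝ g (x - y)).aestronglyMeasurable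
  · rw [ContinuousLinearMap.lsmul_apply, norm_smul]
    by_cases hy : ρ y = 0
    · simp [hy]
    · gcongr
      exact hC _ ⟨(z, y), ⟨hz, subset_tsupport _ hy⟩, rfl⟩
  · exact (hρ.norm.integrable_of_hasCompactSupport hρc.norm).mul_const C
  · have h1 : HasFDerivAt g (fderiv ℝ g (z - y)) (z - y) :=
      (hg.differentiable one_ne_zero _).hasFDerivAt
    have h2 := h1.comp z ((hasFDerivAt_id z).sub_const y)
    exact (h2.const_smul (ρ y)).congr_fderiv (by simp)

variable {d : ℕ}

instance isAddHaarMeasure_volume_spacetime :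
    (volume : Measure (ℝ × E d)).IsAddHaarMeasure :=
  inferInstanceAs (((volume : Measure ℝ).prod (volume : Measure (E d))).IsAddHaarMeasure)

theorem uniformContinuous_proj : UniformContinuous (proj : E d → Torus d) :=
  uniformContinuous_addMonoidHom_of_continuous
    (f := (⟨⟨proj, proj_zero⟩, proj_add⟩ : E d →+ Torus d)) continuous_proj

theorem exists_smooth_near {ψ : Torus d → ℝ} (hψ : Continuous ψ) {e : ℝ} (he : 0 < e) :
    ∃ ψ' : Torus d → ℝ, SpaceContDiff ∞ ψ' ∧ ∀ x, |ψ' x - ψ x| ≤ e := by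
  have hu : UniformContinuous fun v : E d => ψ (proj v) :=
    (CompactSpace.uniformContinuous_of_continuous hψ).comp uniformContinuous_proj
  obtain ⟨δ, hδ, h⟩ := Metric.uniformContinuous_iff.1 hu e he
  let b : ContDiffBump (0 : E d) := ⟨δ / 2, δ, by positivity, by linarith⟩
  refine ⟨fun x => ∫ y, b.normed volume y * ψ (x - proj y), ?_, fun x => ?_⟩
  · have h1 : ContDiff ℝ ∞ (b.normed volume ⋆[ContinuousLinearMap.lsmul ℝ ℝ, volume]
        fun v : E d => ψ (proj v)) :=
      b.hasCompactSupport_normed.contDiff_convolution_left _ b.contDiff_normed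
        (hψ.comp continuous_proj).locallyIntegrable
    unfold SpaceContDiff
    convert h1 using 2 with v
    simp [convolution, proj_sub]
  · obtain ⟨v, rfl⟩ := isOpenQuotientMap_proj.surjective x
    have h1 := b.dist_normed_convolution_le (μ := volume) (g := fun v : E d => ψ (proj v))
      (x₀ := v) (ε := e) (hψ.comp continuous_proj).aestronglyMeasurable fun w hw => (h hw).le
    rw [Real.dist_eq] at h1
    simpa [convolution, proj_sub] using h1

/-- Composing with any section of `proj` gives a function on [a,b] × 𝕋^d that is continuous by
periodicity, whatever the section; compactness then applies. -/
theorem exists_bound_lift {X : Type*} [NormedAddCommGroup X] {g : ℝ × E d → X} (hg : Continuous g)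
    (hper : ∀ t v w, proj v = proj w → g (t, v) = g (t, w)) (a b : ℝ) :
    ∃ C, ∀ t ∈ Icc a b, ∀ v, ‖g (t, v)‖ ≤ C := by
  choose s hs using isOpenQuotientMap_proj (d := d).surjective
  let g' : ℝ × Torus d → X := fun z => g (z.1, s z.2)
  have hg' : Continuous g' := by
    refine (isOpenQuotientMap_stProj.continuous_comp_iff).1 (hg.congr fun z => ?_)
    exact hper _ _ _ (hs _).symm
  obtain ⟨C, hC⟩ := (isCompact_Icc.prod isCompact_univ).exists_bound_of_continuousOn
    (s := Icc a b ×ˢ (univ : Set (Torus d))) hg'.continuousOn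
  refine ⟨C, fun t ht v => ?_⟩
  have := hC (t, proj v) ⟨ht, mem_univ _⟩
  rwa [show g' (t, proj v) = g (t, v) from hper _ _ _ (hs _)] at this

theorem fderiv_lift_periodic {φ : ℝ → Torus d → ℝ} (t : ℝ) {v w : E d}
    (h : proj v = proj w) : fderiv ℝ (lift φ) (t, v) = fderiv ℝ (lift φ) (t, w) := by
  have h1 : lift φ = fun z => lift φ (z + (0, w - v)) := by
    ext z
    simp only [lift, Prod.fst_add, Prod.snd_add, add_zero, proj_add, proj_sub, h, sub_self]
  conv_lhs => rw [h1]
  rw [fderiv_comp_add_right]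
  simp

/-- Smooth approximation of a `C¹` function on `ℝ × 𝕋^d`. -/
theorem exists_smooth_seq {φ : ℝ → Torus d → ℝ} (h : ContDiff ℝ 1 (lift φ)) (T : ℝ) :
    ∃ φs : ℕ → ℝ → Torus d → ℝ, (∀ k, ContDiff ℝ ∞ (lift (φs k))) ∧
      (∀ z, Tendsto (fun k => lift (φs k) z) atTop (𝓝 (lift φ z))) ∧
      (∀ z, Tendsto (fun k => fderiv ℝ (lift (φs k)) z) atTop (𝓝 (fderiv ℝ (lift φ) z))) ∧
      (∃ C, ∀ k, ∀ t ∈ Icc 0 T, ∀ v, |lift (φs k) (t, v)| ≤ C ∧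
        ‖fderiv ℝ (lift (φs k)) (t, v)‖ ≤ C) ∧
      ∀ τ, (∀ t ≥ τ, ∀ x, φ t x = 0) → ∀ τ' > τ, ∀ᶠ k in atTop, ∀ t ≥ τ', ∀ x, φs k t x = 0 := by
  let b : ℕ → ContDiffBump (0 : ℝ × E d) := fun k =>
    ⟨1 / (k + 1) / 2, 1 / (k + 1), by positivity, half_lt_self (by positivity)⟩
  have hb : Tendsto (fun k => (b k).rOut) atTop (𝓝 0) := tendsto_one_div_add_atTop_nhds_zero_nat
  have hb1 : ∀ k, (b k).rOut ≤ 1 := fun k => by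
    change 1 / ((k : ℝ) + 1) ≤ 1
    rw [div_le_one (by positivity)]
    linarith [(Nat.cast_nonneg k : (0 : ℝ) ≤ k)]
  let φs : ℕ → ℝ → Torus d → ℝ := fun k t x =>
    ∫ y : ℝ × E d, (b k).normed volume y * φ (t - y.1) (x - proj y.2)
  have hlift : ∀ k, lift (φs k) =
      ((b k).normed volume ⋆[ContinuousLinearMap.lsmul ℝ ℝ, volume] lift φ) := by
    intro k
    ext z
    simp [lift, φs, convolution, proj_sub]
  have hfd : ∀ k z, fderiv ℝ (lift (φs k)) z =
      ((b k).normed volume ⋆[ContinuousLinearMap.lsmul ℝ ℝ, volume] fderiv ℝ (lift φ)) z := by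
    intro k z
    rw [hlift]
    exact (hasFDerivAt_convolution (b k).continuous_normed (b k).hasCompactSupport_normed h z).fderiv
  have hφ' : Continuous (fderiv ℝ (lift φ)) := h.continuous_fderiv one_ne_zero
  -- The kernels have radius at most 1, so only times in [-1,T+1] matter. The mollified value
  -- differs from `g` by at most 2C, whence 3C.
  have hbound : ∀ {X : Type} [NormedAddCommGroup X] [NormedSpace ℝ X] [CompleteSpace X]
      {g : ℝ × E d → X}, Continuous g → ∀ {C : ℝ}, (∀ t ∈ Icc (-1) (T + 1), ∀ v, ‖g (t, v)‖ ≤ C) →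
      ∀ k, ∀ t ∈ Icc 0 T, ∀ v, ‖((b k).normed volume
        ⋆[ContinuousLinearMap.lsmul ℝ ℝ, volume] g) (t, v)‖ ≤ 3 * C := by
    intro X _ _ _ g hg C hC k t ht v
    have h0 := hC t ⟨by linarith [ht.1], by linarith [ht.2]⟩ v
    have h1 := (b k).dist_normed_convolution_le (μ := volume) (g := g) (x₀ := (t, v)) (ε := 2 * C)
      hg.aestronglyMeasurable fun w hw => by
        have hw1 : |w.1 - t| < 1 := by
          have := (norm_fst_le (w - (t, v))).trans_lt (mem_ball_iff_norm.1 hw)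
          exact this.trans_le (hb1 k)
        rw [abs_lt] at hw1
        have h2 := hC w.1 ⟨by linarith [ht.1], by linarith [ht.2]⟩ w.2
        rw [dist_eq_norm]
        exact (norm_sub_le _ _).trans (by linarith)
    rw [dist_eq_norm] at h1
    have h2 := norm_le_norm_add_norm_sub' (((b k).normed volume
        ⋆[ContinuousLinearMap.lsmul ℝ ℝ, volume] g) (t, v)) (g (t, v))
    linarith
  refine ⟨φs, fun k => ?_, fun z => ?_, fun z => ?_, ?_, fun τ hτ τ' hτ' => ?_⟩
  · rw [hlift]
    exact (b k).hasCompactSupport_normed.contDiff_convolution_left _ (b k).contDiff_normed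
      h.continuous.locallyIntegrable
  · simp only [hlift]
    exact ContDiffBump.convolution_tendsto_right_of_continuous hb h.continuous z
  · simp only [hfd]
    exact ContDiffBump.convolution_tendsto_right_of_continuous hb hφ' z
  · obtain ⟨C₁, hC₁⟩ := exists_bound_lift h.continuous
      (fun t v w hvw => by simp [lift, hvw]) (-1) (T + 1)
    obtain ⟨C₂, hC₂⟩ := exists_bound_lift hφ'
      (fun t v w hvw => fderiv_lift_periodic t hvw) (-1) (T + 1)
    refine ⟨max (3 * C₁) (3 * C₂), fun k t ht v => ⟨?_, ?_⟩⟩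
    · rw [hlift, ← Real.norm_eq_abs]
      exact (hbound h.continuous hC₁ k t ht v).trans (le_max_left _ _)
    · rw [hfd]
      exact (hbound hφ' hC₂ k t ht v).trans (le_max_right _ _)
  · filter_upwards [hb.eventually (gt_mem_nhds (sub_pos.2 hτ'))] with k hk t ht x
    refine integral_eq_zero_of_ae (ae_of_all _ fun y => ?_)
    simp only [Pi.zero_apply]
    by_cases hy : (b k).normed volume y = 0
    · rw [hy, zero_mul]
    · have hy' : y ∈ Metric.ball 0 (b k).rOut := by
        rw [← (b k).support_normed_eq (μ := volume)]; exact hy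
      have h1 := (norm_fst_le y).trans_lt (mem_ball_zero_iff.1 hy')
      rw [Real.norm_eq_abs, abs_lt] at h1
      rw [hτ _ (by linarith), mul_zero]

end Mollification

/-! ### Testing the continuity equation with `C¹` functions -/

section Pairing

variable {d : ℕ} {T : ℝ}

instance isFiniteMeasure_vol : IsFiniteMeasure (vol d T) := by
  unfold vol; infer_instance

theorem ae_vol_mem (d : ℕ) (T : ℝ) : ∀ᵐ z ∂(vol d T), z.1 ∈ Ioo 0 T :=
  Measure.quasiMeasurePreserving_fst.ae (p := fun t : ℝ => t ∈ Ioo 0 T)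
    (ae_restrict_mem measurableSet_Ioo)

theorem continuousOn_aestronglyMeasurable_vol {X : Type*} [NormedAddCommGroup X]
    {g : ℝ × Torus d → X} (hg : ContinuousOn g (Icc 0 T ×ˢ univ)) :
    AEStronglyMeasurable g (vol d T) := by
  have h1 : AEStronglyMeasurable g ((volume.prod volume).restrict (Ioo 0 T ×ˢ univ)) := by
    refine (hg.mono (prod_mono Ioo_subset_Icc_self le_rfl)).aestronglyMeasurable
      (measurableSet_Ioo.prod MeasurableSet.univ) |>.mono_measure le_rfl
  rwa [← Measure.prod_restrict, Measure.restrict_univ] at h1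

theorem exists_bound_strip {X : Type*} [NormedAddCommGroup X]
    {g : ℝ × Torus d → X} (hg : ContinuousOn g (Icc 0 T ×ˢ univ)) :
    ∃ C, 0 ≤ C ∧ ∀ t ∈ Icc 0 T, ∀ x, ‖g (t, x)‖ ≤ C := by
  obtain ⟨C, hC⟩ := (isCompact_Icc.prod isCompact_univ).exists_bound_of_continuousOn hg
  exact ⟨max C 0, le_max_right _ _, fun t ht x => (hC _ ⟨ht, mem_univ _⟩).trans (le_max_left _ _)⟩

variable {m : ℝ × Torus d → ℝ} {w : ℝ × Torus d → E d}

theorem integrable_pairing (hm : Integrable m (vol d T)) (hw : Integrable w (vol d T))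
    {a : ℝ × Torus d → ℝ} {b : ℝ × Torus d → E d} (ha : AEStronglyMeasurable a (vol d T))
    (hb : AEStronglyMeasurable b (vol d T)) {C : ℝ}
    (hbd : ∀ t ∈ Ioo 0 T, ∀ x, ‖a (t, x)‖ ≤ C ∧ ‖b (t, x)‖ ≤ C) :
    Integrable (fun z => a z * m z + inner ℝ (b z) (w z)) (vol d T) := by
  refine Integrable.mono' ((hm.norm.add hw.norm).const_mul C)
    ((ha.mul hm.1).add (hb.inner hw.1)) ?_
  filter_upwards [ae_vol_mem d T] with z hz
  obtain ⟨h1, h2⟩ := hbd z.1 hz z.2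
  simp only [Pi.add_apply, mul_add]
  refine (norm_add_le _ _).trans (add_le_add ?_ ?_)
  · rw [norm_mul]; gcongr
  · refine (norm_inner_le_norm _ _).trans ?_
    gcongr

theorem tendsto_pairing (hm : Integrable m (vol d T)) (hw : Integrable w (vol d T))
    {a : ℕ → ℝ × Torus d → ℝ} {b : ℕ → ℝ × Torus d → E d} {a' : ℝ × Torus d → ℝ}
    {b' : ℝ × Torus d → E d} (ha : ∀ k, AEStronglyMeasurable (a k) (vol d T))
    (hb : ∀ k, AEStronglyMeasurable (b k) (vol d T)) {C : ℝ}
    (hbd : ∀ k, ∀ t ∈ Ioo 0 T, ∀ x, ‖a k (t, x)‖ ≤ C ∧ ‖b k (t, x)‖ ≤ C)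
    (hlim : ∀ t ∈ Ioo 0 T, ∀ x, Tendsto (fun k => a k (t, x)) atTop (𝓝 (a' (t, x))) ∧
      Tendsto (fun k => b k (t, x)) atTop (𝓝 (b' (t, x)))) :
    Tendsto (fun k => ∫ z, (a k z * m z + inner ℝ (b k z) (w z)) ∂(vol d T)) atTop
      (𝓝 (∫ z, (a' z * m z + inner ℝ (b' z) (w z)) ∂(vol d T))) := by
  refine tendsto_integral_of_dominated_convergence (fun z => C * (‖m z‖ + ‖w z‖))
    (fun k => ((ha k).mul hm.1).add ((hb k).inner hw.1)) ((hm.norm.add hw.norm).const_mul C)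
    (fun k => ?_) ?_
  · filter_upwards [ae_vol_mem d T] with z hz
    obtain ⟨h1, h2⟩ := hbd k z.1 hz z.2
    rw [mul_add]
    refine (norm_add_le _ _).trans (add_le_add ?_ ?_)
    · rw [norm_mul]; gcongr
    · refine (norm_inner_le_norm _ _).trans ?_
      gcongr
  · filter_upwards [ae_vol_mem d T] with z hz
    obtain ⟨h1, h2⟩ := hlim z.1 hz z.2
    exact (h1.mul_const _).add (h2.inner tendsto_const_nhds)

theorem tendsto_integral_bounded {μ : Measure (Torus d)} [IsFiniteMeasure μ]
    {g : ℕ → Torus d → ℝ} {g' : Torus d → ℝ} (hg : ∀ k, Continuous (g k)) {C : ℝ}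
    (hbd : ∀ k x, |g k x| ≤ C) (hlim : ∀ x, Tendsto (fun k => g k x) atTop (𝓝 (g' x))) :
    Tendsto (fun k => ∫ x, g k x ∂μ) atTop (𝓝 (∫ x, g' x ∂μ)) :=
  tendsto_integral_of_dominated_convergence (fun _ => C)
    (fun k => (hg k).aestronglyMeasurable) (integrable_const C)
    (fun k => ae_of_all _ fun x => hbd k x) (ae_of_all _ hlim)

theorem norm_comp_inr_le (A : ℝ × E d →L[ℝ] ℝ) :
    ‖(InnerProductSpace.toDual ℝ (E d)).symm (A.comp (ContinuousLinearMap.inr ℝ ℝ (E d)))‖ ≤ ‖A‖ := by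
  rw [LinearIsometryEquiv.norm_map]
  refine ContinuousLinearMap.opNorm_le_bound _ (norm_nonneg _) fun u => ?_
  refine (A.le_opNorm _).trans ?_
  gcongr
  simp

theorem norm_apply_one_le (A : ℝ × E d →L[ℝ] ℝ) : ‖A (1, 0)‖ ≤ ‖A‖ := by
  refine (A.le_opNorm _).trans ?_
  simp

/-- The left-hand side of the weak formulation of the continuity equation. -/
def weakForm (T : ℝ) (m₀ : Torus d → ℝ) (m : ℝ × Torus d → ℝ) (w : ℝ × Torus d → E d)
    (φ : ℝ → Torus d → ℝ) : ℝ :=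
  (∫ z, (deriv (fun s => φ s z.2) z.1 * m z + inner ℝ (spaceGrad (φ z.1) z.2) (w z)) ∂(vol d T))
    + ∫ x, φ 0 x * m₀ x

/-- Passage to the limit in the test function of the weak formulation. -/
theorem tendsto_weakForm (hT : 0 < T) (hm : Integrable m (vol d T)) (hw : Integrable w (vol d T))
    {m₀ : Torus d → ℝ} (hm₀ : Continuous m₀) {φs : ℕ → ℝ → Torus d → ℝ} {φ : ℝ → Torus d → ℝ}
    (hφs : ∀ k, ContDiff ℝ 1 (lift (φs k))) {C : ℝ}
    (hbd : ∀ k, ∀ t ∈ Icc 0 T, ∀ x, |φs k t x| ≤ C ∧ |deriv (fun s => φs k s x) t| ≤ C ∧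
      ‖spaceGrad (φs k t) x‖ ≤ C) {a' : ℝ × Torus d → ℝ} {b' : ℝ × Torus d → E d}
    (h0 : ∀ x, Tendsto (fun k => φs k 0 x) atTop (𝓝 (φ 0 x)))
    (hlim : ∀ t ∈ Ioo 0 T, ∀ x,
      Tendsto (fun k => deriv (fun s => φs k s x) t) atTop (𝓝 (a' (t, x))) ∧
      Tendsto (fun k => spaceGrad (φs k t) x) atTop (𝓝 (b' (t, x)))) :
    Tendsto (fun k => weakForm T m₀ m w (φs k)) atTop
      (𝓝 ((∫ z, (a' z * m z + inner ℝ (b' z) (w z)) ∂(vol d T)) + ∫ x, φ 0 x * m₀ x)) := by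
  refine Tendsto.add ?_ ?_
  · refine tendsto_pairing hm hw (a := fun k z => deriv (fun s => φs k s z.2) z.1)
      (b := fun k z => spaceGrad (φs k z.1) z.2) (C := C)
      (fun k => (continuous_deriv_time (hφs k)).aestronglyMeasurable)
      (fun k => (continuous_spaceGrad (hφs k)).aestronglyMeasurable) (fun k t ht x => ?_) hlim
    exact (hbd k t (Ioo_subset_Icc_self ht) x).2
  · obtain ⟨C', hC'⟩ := isCompact_univ.exists_bound_of_continuousOn hm₀.continuousOn
    have hc : ∀ k, Continuous fun x => φs k 0 x := fun k =>
      (continuous_of_lift (hφs k)).comp (f := fun x => ((0 : ℝ), x)) (by fun_prop)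
    refine tendsto_integral_bounded (C := C * C') (fun k => (hc k).mul hm₀) (fun k x => ?_)
      fun x => (h0 x).mul_const _
    have h1 := (hbd k 0 (left_mem_Icc.2 hT.le) x).1
    rw [abs_mul]
    exact mul_le_mul h1 (hC' _ (mem_univ _)) (abs_nonneg _) ((abs_nonneg _).trans h1)

/-- Smooth tests are dense enough: mollification delays the vanishing time of φ only slightly, so
the mollified functions vanish from (τ+T)/2 < T on and are admissible. -/
theorem ContinuityEq.weakForm_eq_zero {m₀ : Torus d → ℝ} (hT : 0 < T)
    (hm : Integrable m (vol d T)) (hw : Integrable w (vol d T)) (hm₀ : Continuous m₀)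
    (h : ContinuityEq T m₀ m w) {φ : ℝ → Torus d → ℝ} (hφ : ContDiff ℝ 1 (lift φ)) {τ : ℝ}
    (hτ : τ < T) (hz : ∀ t ≥ τ, ∀ x, φ t x = 0) : weakForm T m₀ m w φ = 0 := by
  obtain ⟨φs, h1, h2, h3, ⟨C, h4⟩, h5⟩ := exists_smooth_seq hφ T
  have h1' : ∀ k, ContDiff ℝ 1 (lift (φs k)) := fun k => (h1 k).of_le (by simp)
  have hlim := tendsto_weakForm hT hm hw hm₀ (φ := φ) h1' (C := C) (fun k t ht x => by
      obtain ⟨v, rfl⟩ := isOpenQuotientMap_proj.surjective x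
      rw [deriv_time (h1' k), spaceGrad_eq_global (h1' k)]
      exact ⟨(h4 k t ht v).1, (norm_apply_one_le _).trans (h4 k t ht v).2,
        (norm_comp_inr_le _).trans (h4 k t ht v).2⟩)
    (a' := fun z => deriv (fun s => φ s z.2) z.1) (b' := fun z => spaceGrad (φ z.1) z.2)
    (fun x => by
      obtain ⟨v, rfl⟩ := isOpenQuotientMap_proj.surjective x
      exact h2 (0, v))
    (fun t ht x => by
      obtain ⟨v, rfl⟩ := isOpenQuotientMap_proj.surjective x
      simp only [deriv_time (h1' _), spaceGrad_eq_global (h1' _), deriv_time hφ,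
        spaceGrad_eq_global hφ]
      refine ⟨((ContinuousLinearMap.apply ℝ ℝ ((1, 0) : ℝ × E d)).continuous.tendsto _).comp
        (h3 (t, v)), ?_⟩
      refine ((InnerProductSpace.toDual ℝ (E d)).symm.continuous.tendsto _).comp ?_
      exact ((continuous_id.clm_comp (continuous_const
        (y := ContinuousLinearMap.inr ℝ ℝ (E d)))).tendsto _).comp (h3 (t, v)))
  refine tendsto_nhds_unique hlim (tendsto_const_nhds.congr' ?_)
  filter_upwards [h5 τ hz ((τ + T) / 2) (by linarith)] with k hk
  exact (h (φs k) ⟨h1 k, (τ + T) / 2, by linarith, hk⟩).symm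

end Pairing

/-! ### Time slices of solutions of the continuity equation -/

section Slices

/-- Integration by parts for merely integrable W: both primitives are absolutely continuous, one
vanishing at T and the other at 0, so there is no boundary term. -/
theorem integral_primitive_mul {γ W : ℝ → ℝ} {T : ℝ} (hγ : Continuous γ)
    (hW : IntervalIntegrable W volume 0 T) :
    ∫ t in (0 : ℝ)..T, (∫ s in T..t, γ s) * W t =
      - ∫ t in (0 : ℝ)..T, γ t * ∫ s in (0 : ℝ)..t, W s := by
  have h1 := (hγ.intervalIntegrable (μ := volume) 0 T).absolutelyContinuousOnInterval_intervalIntegral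
    (c := T) (by simp)
  have h2 := hW.absolutelyContinuousOnInterval_intervalIntegral (c := 0) (by simp)
  have h3 := h1.integral_mul_deriv_eq_deriv_mul h2
  simp only [intervalIntegral.integral_same, zero_mul, mul_zero, sub_zero, zero_sub] at h3
  rw [← intervalIntegral.integral_congr_ae (g := fun t => (∫ s in T..t, γ s) * W t) ?_, h3]
  · congr 1
    refine intervalIntegral.integral_congr fun t _ => ?_
    rw [hγ.deriv_integral]
  · filter_upwards [hW.ae_hasDerivAt_integral] with t ht ht'
    rw [(ht (uIoc_subset_uIcc ht') 0 (by simp)).deriv]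

variable {d : ℕ} {T : ℝ} {m : ℝ × Torus d → ℝ} {w : ℝ × Torus d → E d} {m₀ : Torus d → ℝ}

/-- The value at time `t` of `∫ ψ dm(t)` predicted by the continuity equation. -/
def weakPath (m₀ : Torus d → ℝ) (w : ℝ × Torus d → E d) (ψ : Torus d → ℝ) (t : ℝ) : ℝ :=
  (∫ x, ψ x * m₀ x) + ∫ s in (0 : ℝ)..t, ∫ x, inner ℝ (spaceGrad ψ x) (w (s, x))

theorem integrable_flux (hw : Integrable w (vol d T)) {ψ : Torus d → ℝ} (hψ : SpaceContDiff 1 ψ) :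
    Integrable (fun z => inner ℝ (spaceGrad ψ z.2) (w z)) (vol d T) := by
  have hc : Continuous fun z : ℝ × Torus d => spaceGrad ψ z.2 :=
    hψ.continuous_spaceGrad.comp continuous_snd
  obtain ⟨C, -, hC⟩ := exists_bound_strip (T := T) hc.continuousOn
  simpa using integrable_pairing (m := fun _ => 0) (integrable_zero _ _ _) hw
    (a := fun _ => 0) aestronglyMeasurable_zero hc.aestronglyMeasurable (C := C)
    fun t ht x => ⟨by simpa using (norm_nonneg _).trans (hC t (Ioo_subset_Icc_self ht) x),
      hC t (Ioo_subset_Icc_self ht) x⟩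

theorem intervalIntegrable_flux (hT : 0 < T) (hw : Integrable w (vol d T)) {ψ : Torus d → ℝ}
    (hψ : SpaceContDiff 1 ψ) : IntervalIntegrable
      (fun s => ∫ x, inner ℝ (spaceGrad ψ x) (w (s, x))) volume 0 T := by
  rw [intervalIntegrable_iff_integrableOn_Ioo_of_le hT.le]
  exact (integrable_flux hw hψ).integral_prod_left

theorem continuousOn_weakPath (hT : 0 < T) (hw : Integrable w (vol d T)) {ψ : Torus d → ℝ}
    (hψ : SpaceContDiff 1 ψ) : ContinuousOn (weakPath m₀ w ψ) (Icc 0 T) := by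
  have h := (intervalIntegrable_flux hT hw hψ).absolutelyContinuousOnInterval_intervalIntegral
    (c := 0) (by simp)
  have h2 := h.continuousOn
  rw [uIcc_of_le hT.le] at h2
  exact continuousOn_const.add h2

theorem weakPath_end (hT : 0 < T) (hw : Integrable w (vol d T)) {ψ : Torus d → ℝ}
    (hψ : SpaceContDiff 1 ψ) : weakPath m₀ w ψ T =
      (∫ x, ψ x * m₀ x) + ∫ z, inner ℝ (spaceGrad ψ z.2) (w z) ∂(vol d T) := by
  rw [weakPath, intervalIntegral.integral_of_le hT.le, integral_Ioc_eq_integral_Ioo]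
  congr 1
  exact (integral_prod _ (integrable_flux hw hψ)).symm

theorem integrable_mul_left_vol (hm : Integrable m (vol d T)) {ψ : Torus d → ℝ}
    (hψ : Continuous ψ) : Integrable (fun z => ψ z.2 * m z) (vol d T) := by
  obtain ⟨C, hC⟩ := isCompact_univ.exists_bound_of_continuousOn hψ.continuousOn
  exact hm.bdd_mul (hψ.comp continuous_snd).aestronglyMeasurable
    (ae_of_all _ fun z => hC z.2 (mem_univ _))

/-- Testing with η(t)ψ(x), where η' = γ and η(T) = 0, shows that the difference of the two sides is
orthogonal to every γ in C_c^∞((0,T)), hence null. Such η vanish near T but not necessarily at 0, so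
they see the initial datum. -/
theorem ContinuityEq.ae_eq_weakPath (hT : 0 < T) (hm : Integrable m (vol d T))
    (hw : Integrable w (vol d T)) (h : ContinuityEq T m₀ m w) {ψ : Torus d → ℝ}
    (hψ : SpaceContDiff ∞ ψ) :
    ∀ᵐ t ∂(volume.restrict (Ioo 0 T)), ∫ x, ψ x * m (t, x) = weakPath m₀ w ψ t := by
  have hψ1 : SpaceContDiff 1 ψ := ContDiff.of_le hψ (by simp)
  have hψm := integrable_mul_left_vol hm hψ1.continuous
  have hM : IntegrableOn (fun t => ∫ x, ψ x * m (t, x)) (Ioo 0 T) := hψm.integral_prod_left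
  have hg : IntegrableOn (weakPath m₀ w ψ) (Ioo 0 T) :=
    ((continuousOn_weakPath hT hw hψ1).integrableOn_Icc).mono_set Ioo_subset_Icc_self
  have key := isOpen_Ioo.ae_eq_zero_of_integral_contDiff_smul_eq_zero (U := Ioo 0 T)
    (f := fun t => (∫ x, ψ x * m (t, x)) - weakPath m₀ w ψ t) (μ := volume)
    (hM.sub hg).locallyIntegrableOn ?_
  · rw [ae_restrict_iff' measurableSet_Ioo]
    filter_upwards [key] with t ht ht'
    exact sub_eq_zero.1 (ht ht')
  intro γ hγ hγc hγs
  set η : ℝ → ℝ := fun t => ∫ s in T..t, γ s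
  have hη' : ∀ t, HasDerivAt η (γ t) t := fun t =>
    intervalIntegral.integral_hasDerivAt_right (hγ.continuous.intervalIntegrable _ _)
      hγ.continuous.stronglyMeasurable.stronglyMeasurableAtFilter hγ.continuous.continuousAt
  have hηd : deriv η = γ := funext fun t => (hη' t).deriv
  have hη : ContDiff ℝ ∞ η := by
    rw [contDiff_infty_iff_deriv, hηd]
    exact ⟨fun t => (hη' t).differentiableAt, hγ⟩
  obtain ⟨τ, hτT, hτ⟩ : ∃ τ < T, ∀ t ≥ τ, γ t = 0 := by
    rcases (tsupport γ).eq_empty_or_nonempty with he | hne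
    · exact ⟨0, hT, fun t _ => image_eq_zero_of_notMem_tsupport (by simp [he])⟩
    · obtain ⟨s, hs, hs'⟩ := hγc.isCompact.exists_isMaxOn hne continuousOn_id
      have hsT := (hγs hs).2
      refine ⟨(s + T) / 2, by linarith, fun t ht => image_eq_zero_of_notMem_tsupport fun h' => ?_⟩
      have : t ≤ s := hs' h'
      linarith
  have hηz : ∀ t ≥ τ, η t = 0 := by
    intro t ht
    refine (intervalIntegral.integral_congr (g := fun _ => (0 : ℝ)) fun s hs => ?_).trans (by simp)
    exact hτ s ((le_inf ht hτT.le).trans ((inf_comm t T).le.trans hs.1))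
  have htest : IsTest T fun t x => η t * ψ x := by
    refine ⟨?_, τ, hτT, fun t ht x => by simp [hηz t ht]⟩
    have h1 : ContDiff ℝ ∞ fun z : ℝ × E d => η z.1 := hη.comp contDiff_fst
    have h2 : ContDiff ℝ ∞ fun z : ℝ × E d => ψ (proj z.2) :=
      ContDiff.comp (g := fun v : E d => ψ (proj v)) hψ contDiff_snd
    exact h1.mul h2
  have heq := h _ htest
  have e1 : ∀ z : ℝ × Torus d, deriv (fun s => η s * ψ z.2) z.1 = γ z.1 * ψ z.2 := fun z =>
    ((hη' z.1).mul_const _).deriv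
  have e2 : ∀ z : ℝ × Torus d, spaceGrad (fun x => η z.1 * ψ x) z.2 = η z.1 • spaceGrad ψ z.2 := by
    rintro ⟨t, x⟩
    obtain ⟨v, rfl⟩ := isOpenQuotientMap_proj.surjective x
    rw [spaceGrad_proj, spaceGrad_proj]
    simp only [gradient]
    rw [fderiv_const_mul ((ContDiff.differentiable hψ1 one_ne_zero) v), map_smulₛₗ]
    simp
  simp only [e1, e2, inner_smul_left, conj_trivial] at heq
  have hfl := integrable_flux hw hψ1
  have i1 : Integrable (fun z : ℝ × Torus d => γ z.1 * ψ z.2 * m z) (vol d T) := by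
    obtain ⟨C, hC⟩ := exists_bound_strip (T := T) (g := fun z : ℝ × Torus d => γ z.1)
      (hγ.continuous.comp continuous_fst).continuousOn
    simp only [mul_assoc]
    refine hψm.bdd_mul (c := C) (hγ.continuous.comp continuous_fst).aestronglyMeasurable ?_
    filter_upwards [ae_vol_mem d T] with z hz
    exact hC.2 z.1 (Ioo_subset_Icc_self hz) z.2
  have i2 : Integrable (fun z : ℝ × Torus d => η z.1 * inner ℝ (spaceGrad ψ z.2) (w z))
      (vol d T) := by
    obtain ⟨C, hC⟩ := exists_bound_strip (T := T) (g := fun z : ℝ × Torus d => η z.1)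
      (hη.continuous.comp continuous_fst).continuousOn
    refine hfl.bdd_mul (c := C) (hη.continuous.comp continuous_fst).aestronglyMeasurable ?_
    filter_upwards [ae_vol_mem d T] with z hz
    exact hC.2 z.1 (Ioo_subset_Icc_self hz) z.2
  have f1 : ∫ z, γ z.1 * ψ z.2 * m z ∂(vol d T) =
      ∫ t in Ioo 0 T, γ t * ∫ x, ψ x * m (t, x) := by
    refine (integral_prod _ i1).trans ?_
    simp only [mul_assoc, integral_const_mul]
  have f2 : ∫ z, η z.1 * inner ℝ (spaceGrad ψ z.2) (w z) ∂(vol d T) =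
      - ∫ t in Ioo 0 T, γ t * ∫ s in (0 : ℝ)..t, ∫ x, inner ℝ (spaceGrad ψ x) (w (s, x)) := by
    refine (integral_prod _ i2).trans ?_
    simp only [integral_const_mul]
    have := integral_primitive_mul hγ.continuous (intervalIntegrable_flux hT hw hψ1)
    rwa [intervalIntegral.integral_of_le hT.le, integral_Ioc_eq_integral_Ioo,
      intervalIntegral.integral_of_le hT.le, integral_Ioc_eq_integral_Ioo] at this
  -- This rewrites the initial term of the weak formulation as the constant part of `weakPath`
  -- integrated against γ.
  have f3 : η 0 = - ∫ t in Ioo 0 T, γ t := by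
    simp only [η]
    rw [intervalIntegral.integral_symm, intervalIntegral.integral_of_le hT.le,
      integral_Ioc_eq_integral_Ioo]
  rw [integral_add i1 i2, f1, f2] at heq
  simp only [mul_assoc, integral_const_mul] at heq
  rw [f3] at heq
  have hγb : ∀ {g : ℝ → ℝ}, IntegrableOn g (Ioo 0 T) →
      IntegrableOn (fun t => γ t * g t) (Ioo 0 T) := by
    intro g hg
    obtain ⟨C, hC⟩ := hγc.exists_bound_of_continuous hγ.continuous
    exact hg.bdd_mul hγ.continuous.aestronglyMeasurable (ae_of_all _ hC)
  have hW : IntegrableOn (fun t => ∫ s in (0 : ℝ)..t, ∫ x, inner ℝ (spaceGrad ψ x) (w (s, x)))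
      (Ioo 0 T) := by
    have h3 := hg.sub (integrable_const (∫ x, ψ x * m₀ x))
    refine h3.congr (ae_of_all _ fun t => ?_)
    simp [weakPath]
  have hsupp : ∫ t, γ t • ((∫ x, ψ x * m (t, x)) - weakPath m₀ w ψ t) =
      ∫ t in Ioo 0 T, γ t * ((∫ x, ψ x * m (t, x)) - weakPath m₀ w ψ t) := by
    symm
    simp only [smul_eq_mul]
    refine setIntegral_eq_integral_of_forall_compl_eq_zero fun t ht => ?_
    rw [image_eq_zero_of_notMem_tsupport fun h' => ht (hγs h'), zero_mul]
  rw [hsupp]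
  have hsplit : ∀ t, γ t * ((∫ x, ψ x * m (t, x)) - weakPath m₀ w ψ t) =
      γ t * (∫ x, ψ x * m (t, x)) - (γ t * (∫ x, ψ x * m₀ x) +
        γ t * ∫ s in (0 : ℝ)..t, ∫ x, inner ℝ (spaceGrad ψ x) (w (s, x))) := fun t => by
    unfold weakPath; ring
  simp only [hsplit]
  have i3 : IntegrableOn (fun t => γ t * ∫ x, ψ x * m₀ x) (Ioo 0 T) :=
    hγb (integrable_const _)
  have s1 := integral_sub (hγb hM) (i3.add (hγb hW))
  have s2 := integral_add i3 (hγb hW)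
  simp only [Pi.add_apply] at s1
  rw [s1, s2, integral_mul_const]
  linarith

end Slices

/-! ### The weakly continuous representative and its terminal value. -/

section Representative

variable {d : ℕ} {T : ℝ} {m : ℝ × Torus d → ℝ} {w : ℝ × Torus d → E d} {m₀ : Torus d → ℝ}

/-- The probability measure with density `m(t,·)`, when this is one. -/
def densityMeasure (m : ℝ × Torus d → ℝ) (t : ℝ) : ProbabilityMeasure (Torus d) :=
  Classical.epsilon fun μ : ProbabilityMeasure (Torus d) =>
    (μ : Measure (Torus d)) = volume.withDensity fun x => ENNReal.ofReal (m (t, x))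

theorem ae_densityMeasure (hm : Integrable m (vol d T)) (hpos : ∀ᵐ z ∂(vol d T), 0 ≤ m z)
    (hmass : ∀ᵐ t ∂(volume.restrict (Ioo 0 T)), ∫ x, m (t, x) = 1) :
    ∀ᵐ t ∂(volume.restrict (Ioo 0 T)),
      (densityMeasure m t : Measure (Torus d)) =
        volume.withDensity (fun x => ENNReal.ofReal (m (t, x))) ∧
      ∀ ψ : Torus d → ℝ, Continuous ψ →
        ∫ x, ψ x ∂(densityMeasure m t : Measure (Torus d)) = ∫ x, ψ x * m (t, x) := by
  filter_upwards [hm.prod_right_ae, Measure.ae_ae_of_ae_prod hpos, hmass] with t h1 h2 h3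
  have hprob : IsProbabilityMeasure ((volume : Measure (Torus d)).withDensity
      fun x => ENNReal.ofReal (m (t, x))) := by
    constructor
    rw [withDensity_apply _ MeasurableSet.univ, setLIntegral_univ,
      ← ofReal_integral_eq_lintegral_ofReal h1 h2, h3, ENNReal.ofReal_one]
  have heq : (densityMeasure m t : Measure (Torus d)) =
      volume.withDensity (fun x => ENNReal.ofReal (m (t, x))) :=
    Classical.epsilon_spec (p := fun μ : ProbabilityMeasure (Torus d) =>
      (μ : Measure (Torus d)) = volume.withDensity fun x => ENNReal.ofReal (m (t, x)))
      ⟨⟨_, hprob⟩, rfl⟩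
  refine ⟨heq, fun ψ hψ => ?_⟩
  rw [heq, integral_withDensity_eq_integral_toReal_smul₀
    h1.aestronglyMeasurable.aemeasurable.ennreal_ofReal (ae_of_all _ fun _ => ENNReal.ofReal_lt_top)]
  refine integral_congr_ae ?_
  filter_upwards [h2] with x hx
  rw [ENNReal.toReal_ofReal hx, smul_eq_mul, mul_comm]

/-- Every t in [0,T], endpoints included, is a limit of times of full measure. A continuous path is
thus determined at t by what holds at almost every time. -/
theorem neBot_nhds_inf_ae {t : ℝ} (hT : 0 < T) (ht : t ∈ Icc 0 T) :
    NeBot (𝓝 t ⊓ ae (volume.restrict (Ioo 0 T))) := by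
  rw [Filter.inf_neBot_iff]
  intro s hs s' hs'
  obtain ⟨U, hUs, hU, htU⟩ := mem_nhds_iff.1 hs
  by_contra hne
  rw [not_nonempty_iff_eq_empty] at hne
  have hcl : t ∈ closure (Ioo 0 T) := by rwa [closure_Ioo hT.ne]
  have hne' : (U ∩ Ioo 0 T).Nonempty := mem_closure_iff.1 hcl U hU htU
  have hpos : 0 < volume (U ∩ Ioo 0 T) := (hU.inter isOpen_Ioo).measure_pos _ hne'
  have hnull : (volume.restrict (Ioo 0 T)) s'ᶜ = 0 := hs'
  have : (volume.restrict (Ioo 0 T)) U ≤ 0 := by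
    rw [← hnull]
    refine measure_mono fun x hx hx' => ?_
    have : x ∈ s ∩ s' := ⟨hUs hx, hx'⟩
    rw [hne] at this
    exact this
  rw [Measure.restrict_apply hU.measurableSet] at this
  exact absurd this (not_le.2 hpos)

theorem nhds_inf_ae_le_nhdsWithin {t : ℝ} :
    𝓝 t ⊓ ae (volume.restrict (Ioo 0 T)) ≤ 𝓝[Icc 0 T] t := by
  refine inf_le_inf_left _ (le_principal_iff.2 ?_)
  filter_upwards [ae_restrict_mem measurableSet_Ioo] with s hs using Ioo_subset_Icc_self hs

/-- The measure is a limit of the densities m(s,·) along an ultrafilter of good times s → t, by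
compactness of the probability measures on the torus. The exceptional null set may depend on ψ,
since the ultrafilter refines the a.e. filter. -/
theorem exists_slice (hT : 0 < T) (hm : Integrable m (vol d T)) (hw : Integrable w (vol d T))
    (hpos : ∀ᵐ z ∂(vol d T), 0 ≤ m z)
    (hmass : ∀ᵐ t ∂(volume.restrict (Ioo 0 T)), ∫ x, m (t, x) = 1) (h : ContinuityEq T m₀ m w)
    {t : ℝ} (ht : t ∈ Icc 0 T) : ∃ μ : ProbabilityMeasure (Torus d), ∀ ψ, SpaceContDiff ∞ ψ →
      ∫ x, ψ x ∂(μ : Measure (Torus d)) = weakPath m₀ w ψ t := by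
  have := neBot_nhds_inf_ae hT ht
  let U : Ultrafilter ℝ := Ultrafilter.of (𝓝 t ⊓ ae (volume.restrict (Ioo 0 T)))
  have hU : (U : Filter ℝ) ≤ 𝓝 t ⊓ ae (volume.restrict (Ioo 0 T)) := Ultrafilter.of_le _
  obtain ⟨μ, -, hμ⟩ := isCompact_univ.ultrafilter_le_nhds (U.map (densityMeasure m)) (by simp)
  have hμ' : Tendsto (densityMeasure m) U (𝓝 μ) := hμ
  refine ⟨μ, fun ψ hψ => ?_⟩
  have hψ1 : SpaceContDiff 1 ψ := ContDiff.of_le hψ (by simp)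
  have h1 := (ProbabilityMeasure.tendsto_iff_forall_integral_tendsto.1 hμ')
    (BoundedContinuousFunction.mkOfCompact ⟨ψ, hψ1.continuous⟩)
  have h2 : Tendsto (weakPath m₀ w ψ) U (𝓝 (weakPath m₀ w ψ t)) :=
    Tendsto.mono_left ((continuousOn_weakPath hT hw hψ1) t ht)
      (hU.trans nhds_inf_ae_le_nhdsWithin)
  refine tendsto_nhds_unique h1 (h2.congr' ?_)
  refine (hU.trans inf_le_right) ?_
  filter_upwards [ae_densityMeasure hm hpos hmass, h.ae_eq_weakPath hT hm hw hψ] with s hs hs'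
  rw [← hs', ← hs.2 ψ hψ1.continuous]
  rfl

theorem abs_integral_sub_le {μ : Measure (Torus d)} [IsProbabilityMeasure μ] {ψ ψ' : Torus d → ℝ}
    (hψ : Continuous ψ) (hψ' : Continuous ψ') {e : ℝ} (h : ∀ x, |ψ' x - ψ x| ≤ e) :
    |∫ x, ψ' x ∂μ - ∫ x, ψ x ∂μ| ≤ e := by
  rw [← integral_sub (hψ'.integrable_of_hasCompactSupport (HasCompactSupport.of_compactSpace _))
    (hψ.integrable_of_hasCompactSupport (HasCompactSupport.of_compactSpace _))]
  have := norm_integral_le_of_norm_le_const (μ := μ) (f := fun x => ψ' x - ψ x)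
    (ae_of_all _ fun x => h x)
  simpa using this

theorem integral_eq_of_smooth_dense {μ ν : Measure (Torus d)} [IsProbabilityMeasure μ]
    [IsProbabilityMeasure ν] {D : Set (Torus d → ℝ)} (hD : ∀ ψ ∈ D, Continuous ψ)
    (hdense : ∀ ψ : Torus d → ℝ, Continuous ψ → ∀ e > 0, ∃ ψ' ∈ D, ∀ x, |ψ' x - ψ x| ≤ e)
    (h : ∀ ψ ∈ D, ∫ x, ψ x ∂μ = ∫ x, ψ x ∂ν) : μ = ν := by
  refine ext_of_forall_integral_eq_of_IsFiniteMeasure fun ψ => ?_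
  refine eq_of_abs_sub_le_all fun e he => ?_
  obtain ⟨ψ', hψ', hle⟩ := hdense ψ ψ.continuous (e / 2) (half_pos he)
  have h1 := abs_integral_sub_le (μ := μ) ψ.continuous (hD _ hψ') hle
  have h2 := abs_integral_sub_le (μ := ν) ψ.continuous (hD _ hψ') hle
  rw [h _ hψ'] at h1
  rw [abs_le] at *
  constructor <;> linarith

/-- Countability allows one null set of times to serve for all test functions at once when m(t,·) is
identified with the representative. -/
theorem exists_countable_smooth_dense (d : ℕ) : ∃ D : Set (Torus d → ℝ), D.Countable ∧
    (∀ ψ ∈ D, SpaceContDiff ∞ ψ) ∧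
    ∀ ψ : Torus d → ℝ, Continuous ψ → ∀ e > 0, ∃ ψ' ∈ D, ∀ x, |ψ' x - ψ x| ≤ e := by
  obtain ⟨S, hSc, hS⟩ := TopologicalSpace.exists_countable_dense C(Torus d, ℝ)
  choose! g hg1 hg2 using fun (ψ : C(Torus d, ℝ)) (k : ℕ) =>
    exists_smooth_near ψ.continuous (show (0 : ℝ) < 1 / (k + 1) by positivity)
  refine ⟨⋃ ψ ∈ S, range (g ψ), hSc.biUnion fun ψ _ => countable_range _, ?_, ?_⟩
  · intro ψ hψ
    simp only [mem_iUnion, mem_range] at hψ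
    obtain ⟨ψ', -, k, rfl⟩ := hψ
    exact hg1 ψ' k
  · intro ψ hψ e he
    obtain ⟨ψ₁, h1, h2⟩ := Metric.dense_iff.1 hS ⟨ψ, hψ⟩ (e / 2) (half_pos he)
    obtain ⟨k, hk⟩ := exists_nat_one_div_lt (half_pos he)
    refine ⟨g ψ₁ k, by simp only [mem_iUnion, mem_range]; exact ⟨ψ₁, h2, k, rfl⟩, fun x => ?_⟩
    have h3 := (ContinuousMap.dist_apply_le_dist (f := ψ₁) (g := ⟨ψ, hψ⟩) x).trans
      (Metric.mem_ball.1 h1).le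
    rw [Real.dist_eq] at h3
    have h4 := (hg2 ψ₁ k x).trans hk.le
    simp only [ContinuousMap.coe_mk] at h3
    rw [abs_le] at *
    constructor <;> linarith

theorem exists_isWeakRep (hT : 0 < T) (hm : Integrable m (vol d T)) (hw : Integrable w (vol d T))
    (hpos : ∀ᵐ z ∂(vol d T), 0 ≤ m z)
    (hmass : ∀ᵐ t ∂(volume.restrict (Ioo 0 T)), ∫ x, m (t, x) = 1) (h : ContinuityEq T m₀ m w) :
    ∃ ρ : ℝ → ProbabilityMeasure (Torus d), IsWeakRep T m ρ := by
  have key : ∀ t, ∃ μ : ProbabilityMeasure (Torus d), t ∈ Icc 0 T → ∀ ψ, SpaceContDiff ∞ ψ →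
      ∫ x, ψ x ∂(μ : Measure (Torus d)) = weakPath m₀ w ψ t := fun t => by
    by_cases ht : t ∈ Icc 0 T
    · exact (exists_slice hT hm hw hpos hmass h ht).imp fun μ hμ _ => hμ
    · exact ⟨densityMeasure m 0, fun h => absurd h ht⟩
  choose ρ hρ using key
  refine ⟨ρ, ?_, fun ψ hψ => (continuousOn_weakPath (m₀ := m₀) hT hw
    (ContDiff.of_le hψ (by simp))).congr fun t ht => hρ t ht ψ hψ⟩
  obtain ⟨D, hDc, hD1, hD2⟩ := exists_countable_smooth_dense d
  have hall : ∀ᵐ t ∂(volume.restrict (Ioo 0 T)), ∀ ψ ∈ D,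
      ∫ x, ψ x * m (t, x) = weakPath m₀ w ψ t :=
    (ae_ball_iff hDc).2 fun ψ hψ => h.ae_eq_weakPath hT hm hw (hD1 ψ hψ)
  filter_upwards [hall, ae_densityMeasure hm hpos hmass, ae_restrict_mem measurableSet_Ioo]
    with t h1 h2 h3
  rw [← h2.1]
  have hDcont : ∀ ψ ∈ D, Continuous ψ := fun ψ hψ =>
    SpaceContDiff.continuous (ContDiff.of_le (hD1 ψ hψ) (by simp))
  refine integral_eq_of_smooth_dense hDcont hD2 fun ψ hψ => ?_
  rw [hρ t (Ioo_subset_Icc_self h3) ψ (hD1 ψ hψ), h2.2 ψ (hDcont ψ hψ), h1 ψ hψ]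

/-- `slice` rests on an arbitrary choice of representative; continuity at T together with the a.e.
identity forces its value on every smooth function. -/
theorem slice_spec_smooth (hT : 0 < T) (hm : Integrable m (vol d T)) (hw : Integrable w (vol d T))
    (hpos : ∀ᵐ z ∂(vol d T), 0 ≤ m z)
    (hmass : ∀ᵐ t ∂(volume.restrict (Ioo 0 T)), ∫ x, m (t, x) = 1) (h : ContinuityEq T m₀ m w) :
    IsProbabilityMeasure (slice T m T) ∧ ∀ ψ, SpaceContDiff ∞ ψ →
      ∫ x, ψ x ∂(slice T m T) = weakPath m₀ w ψ T := by
  have hex := exists_isWeakRep hT hm hw hpos hmass h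
  have hsl : slice T m T = (hex.choose T : Measure (Torus d)) := by
    unfold slice; rw [dif_pos hex]
  have hρ := hex.choose_spec
  rw [hsl]
  refine ⟨inferInstance, fun ψ hψ => ?_⟩
  have hψ1 : SpaceContDiff 1 ψ := ContDiff.of_le hψ (by simp)
  have hTm : T ∈ Icc 0 T := right_mem_Icc.2 hT.le
  have := neBot_nhds_inf_ae hT hTm
  have h1 := Tendsto.mono_left (hρ.cont ψ hψ T hTm) nhds_inf_ae_le_nhdsWithin
  have h2 : Tendsto (weakPath m₀ w ψ) _ (𝓝 (weakPath m₀ w ψ T)) :=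
    Tendsto.mono_left ((continuousOn_weakPath hT hw hψ1) T hTm) nhds_inf_ae_le_nhdsWithin
  refine tendsto_nhds_unique h1 (h2.congr' ?_)
  refine (inf_le_right : 𝓝 T ⊓ ae (volume.restrict (Ioo 0 T)) ≤ _) ?_
  filter_upwards [hρ.ae_eq, ae_densityMeasure hm hpos hmass, h.ae_eq_weakPath hT hm hw hψ]
    with s h3 h4 h5
  rw [← h5, h3, ← h4.1, h4.2 ψ hψ1.continuous]

/-- Extension to C¹ functions by mollification. The right-hand side is linear in w, which is what
makes the terminal cost tractable. -/
theorem slice_spec (hT : 0 < T) (hm : Integrable m (vol d T)) (hw : Integrable w (vol d T))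
    (hm₀ : Continuous m₀) (hpos : ∀ᵐ z ∂(vol d T), 0 ≤ m z)
    (hmass : ∀ᵐ t ∂(volume.restrict (Ioo 0 T)), ∫ x, m (t, x) = 1) (h : ContinuityEq T m₀ m w) 
    {ψ : Torus d → ℝ} (hψ : SpaceContDiff 1 ψ) :
    ∫ x, ψ x ∂(slice T m T) =
      (∫ x, ψ x * m₀ x) + ∫ z, inner ℝ (spaceGrad ψ z.2) (w z) ∂(vol d T) := by
  obtain ⟨hprob, hsm⟩ := slice_spec_smooth hT hm hw hpos hmass h
  obtain ⟨φs, h1, h2, h3, ⟨C, h4⟩, -⟩ := exists_smooth_seq (φ := fun _ => ψ) hψ.contDiff_lift T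
  let ψs : ℕ → Torus d → ℝ := fun k => φs k 0
  have hψs : ∀ k, SpaceContDiff ∞ (ψs k) := fun k =>
    (h1 k).comp (f := fun v : E d => ((0 : ℝ), v)) (by fun_prop)
  have hψs1 : ∀ k, SpaceContDiff 1 (ψs k) := fun k => ContDiff.of_le (hψs k) (by simp)
  have h1' : ∀ k, ContDiff ℝ 1 (lift (φs k)) := fun k => (h1 k).of_le (by simp)
  have h0 : (0 : ℝ) ∈ Icc 0 T := left_mem_Icc.2 hT.le
  have hbd : ∀ k x, |ψs k x| ≤ C := fun k x => by
    obtain ⟨v, rfl⟩ := isOpenQuotientMap_proj.surjective x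
    exact (h4 k 0 h0 v).1
  have hlim : ∀ x, Tendsto (fun k => ψs k x) atTop (𝓝 (ψ x)) := fun x => by
    obtain ⟨v, rfl⟩ := isOpenQuotientMap_proj.surjective x
    exact h2 (0, v)
  have hgl : ∀ x, Tendsto (fun k => spaceGrad (ψs k) x) atTop (𝓝 (spaceGrad ψ x)) := fun x => by
    obtain ⟨v, rfl⟩ := isOpenQuotientMap_proj.surjective x
    have e : spaceGrad ψ (proj v) = _ :=
      spaceGrad_eq_global (φ := fun _ => ψ) hψ.contDiff_lift 0 v
    simp only [ψs, spaceGrad_eq_global (h1' _), e]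
    refine ((InnerProductSpace.toDual ℝ (E d)).symm.continuous.tendsto _).comp ?_
    exact ((continuous_id.clm_comp (continuous_const
      (y := ContinuousLinearMap.inr ℝ ℝ (E d)))).tendsto _).comp (h3 (0, v))
  have hgb : ∀ k x, ‖spaceGrad (ψs k) x‖ ≤ C := fun k x => by
    obtain ⟨v, rfl⟩ := isOpenQuotientMap_proj.surjective x
    simp only [ψs, spaceGrad_eq_global (h1' _)]
    exact (norm_comp_inr_le _).trans (h4 k 0 h0 v).2
  have hC : 0 ≤ C := (abs_nonneg _).trans (hbd 0 0)
  have l1 := tendsto_integral_bounded (μ := slice T m T) (fun k => (hψs1 k).continuous) hbd hlim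
  obtain ⟨C', hC'⟩ := isCompact_univ.exists_bound_of_continuousOn hm₀.continuousOn
  have l2 := tendsto_integral_bounded (μ := volume) (g := fun k x => ψs k x * m₀ x)
    (g' := fun x => ψ x * m₀ x) (C := C * C')
    (fun k => (hψs1 k).continuous.mul hm₀) (fun k x => by
      rw [abs_mul]
      exact mul_le_mul (hbd k x) (hC' _ (mem_univ _)) (abs_nonneg _) hC)
    fun x => (hlim x).mul_const _
  have l3 := tendsto_pairing (m := fun _ => 0) (integrable_zero _ _ _) hw (a := fun _ _ => 0)
    (a' := fun _ => 0) (b := fun k z => spaceGrad (ψs k) z.2) (b' := fun z => spaceGrad ψ z.2)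
    (C := C) (fun _ => aestronglyMeasurable_zero)
    (fun k => ((hψs1 k).continuous_spaceGrad.comp continuous_snd).aestronglyMeasurable)
    (fun k t _ x => ⟨by simpa using hC, hgb k x⟩) fun t _ x => ⟨tendsto_const_nhds, hgl x⟩
  simp only [mul_zero, zero_add] at l3
  refine tendsto_nhds_unique l1 ((l2.add l3).congr fun k => ?_)
  rw [hsm _ (hψs k), weakPath_end hT hw (hψs1 k)]

end Representative

/-! ### The continuity equation tested with `C¹([0,T] × 𝕋^d)` -/

section ClosedStrip

/-- A smooth function vanishing on `(-∞, 1]` and equal to the identity on `[2, ∞)`. -/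
def ramp (s : ℝ) : ℝ := s * Real.smoothTransition (s - 1)

theorem contDiff_ramp : ContDiff ℝ ∞ ramp :=
  contDiff_id.mul (Real.smoothTransition.contDiff.comp (contDiff_id.sub contDiff_const))

theorem ramp_of_le {s : ℝ} (h : s ≤ 1) : ramp s = 0 := by
  rw [ramp, Real.smoothTransition.zero_of_nonpos (by linarith), mul_zero]

theorem ramp_of_ge {s : ℝ} (h : 2 ≤ s) : ramp s = s := by
  rw [ramp, Real.smoothTransition.one_of_one_le (by linarith), mul_one]

theorem ramp_nonneg (s : ℝ) : 0 ≤ ramp s := by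
  rcases le_total s 1 with h | h
  · rw [ramp_of_le h]
  · exact mul_nonneg (by linarith) (Real.smoothTransition.nonneg _)

theorem ramp_le (s : ℝ) : ramp s ≤ max s 0 := by
  rcases le_total s 1 with h | h
  · rw [ramp_of_le h]; exact le_max_right _ _
  · refine le_trans ?_ (le_max_left _ _)
    exact mul_le_of_le_one_right (by linarith) (Real.smoothTransition.le_one _)

theorem hasDerivAt_ramp (s : ℝ) : HasDerivAt ramp (deriv ramp s) s :=
  (contDiff_ramp.differentiable (by simp) s).hasDerivAt

theorem deriv_ramp_of_gt {s : ℝ} (h : 2 < s) : deriv ramp s = 1 := by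
  have : ramp =ᶠ[𝓝 s] id := by
    filter_upwards [lt_mem_nhds h] with u hu using ramp_of_ge hu.le
  rw [this.deriv_eq, deriv_id]

theorem exists_bound_deriv_ramp : ∃ M, 1 ≤ M ∧ ∀ s, |deriv ramp s| ≤ M := by
  obtain ⟨M, hM⟩ := isCompact_Icc.exists_bound_of_continuousOn (s := Icc (0 : ℝ) 3)
    (contDiff_ramp.continuous_deriv (by simp)).continuousOn
  refine ⟨max M 1, le_max_right _ _, fun s => ?_⟩
  by_cases h1 : s < 1
  · have : ramp =ᶠ[𝓝 s] fun _ => 0 := by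
      filter_upwards [gt_mem_nhds h1] with u hu using ramp_of_le hu.le
    rw [this.deriv_eq, deriv_const, abs_zero]
    exact zero_le_one.trans (le_max_right _ _)
  by_cases h2 : 2 < s
  · rw [deriv_ramp_of_gt h2, abs_one]; exact le_max_right _ _
  · exact (hM s ⟨by linarith, by linarith⟩).trans (le_max_left _ _)

/-- A smooth map `ℝ → [0,T]`, equal to `T` near `T` and close to the identity on `(0,T)`. -/
def clock (T N t : ℝ) : ℝ := T - ramp (N * T - ramp (N * t)) / N

variable {T N : ℝ}

theorem contDiff_clock : ContDiff ℝ ∞ (clock T N) := by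
  have h1 : ContDiff ℝ ∞ fun t : ℝ => ramp (N * t) :=
    contDiff_ramp.comp (contDiff_const.mul contDiff_id)
  have h2 : ContDiff ℝ ∞ fun t : ℝ => ramp (N * T - ramp (N * t)) :=
    contDiff_ramp.comp (contDiff_const.sub h1)
  exact contDiff_const.sub (h2.div_const N)

theorem hasDerivAt_clock (hN : 0 < N) (t : ℝ) : HasDerivAt (clock T N)
    (deriv ramp (N * T - ramp (N * t)) * deriv ramp (N * t)) t := by
  have h0 : HasDerivAt (fun t : ℝ => N * t) N t := by simpa using (hasDerivAt_id t).const_mul N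
  have h1 : HasDerivAt (fun t : ℝ => ramp (N * t)) (deriv ramp (N * t) * N) t :=
    (hasDerivAt_ramp _).comp t h0
  have h2 : HasDerivAt (fun t : ℝ => N * T - ramp (N * t)) (-(deriv ramp (N * t) * N)) t :=
    h1.const_sub _
  have h3 : HasDerivAt (fun t : ℝ => ramp (N * T - ramp (N * t))) _ t :=
    (hasDerivAt_ramp _).comp t h2
  refine ((h3.div_const N).const_sub T).congr_deriv ?_
  field_simp

theorem clock_mem (hT : 0 < T) (hN : 0 < N) (t : ℝ) : clock T N t ∈ Icc 0 T := by
  have h1 : 0 ≤ ramp (N * T - ramp (N * t)) / N := div_nonneg (ramp_nonneg _) hN.le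
  have h2 : ramp (N * T - ramp (N * t)) / N ≤ T := by
    rw [div_le_iff₀ hN, mul_comm T N]
    refine (ramp_le _).trans (max_le ?_ (by positivity))
    linarith [ramp_nonneg (N * t)]
  exact ⟨by unfold clock; linarith, by unfold clock; linarith⟩

theorem clock_of_ge (hN : 0 < N) (hNT : 3 ≤ N * T) {t : ℝ} (ht : T - 1 / N ≤ t) :
    clock T N t = T := by
  have h1 : N * T - 1 ≤ N * t := by
    have := mul_le_mul_of_nonneg_left ht hN.le
    rw [mul_sub, mul_one_div_cancel hN.ne'] at this
    exact this
  rw [clock, ramp_of_ge (s := N * t) (by linarith), ramp_of_le (by linarith), zero_div, sub_zero]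

theorem clock_eq_self (hN : 0 < N) {t : ℝ} (h1 : 2 ≤ N * t) (h2 : 2 ≤ N * (T - t)) :
    clock T N t = t := by
  rw [clock, ramp_of_ge h1, ramp_of_ge (by linarith [mul_sub N T t])]
  field_simp
  ring

theorem clock_zero (hN : 0 < N) (hNT : 3 ≤ N * T) : clock T N 0 = 0 := by
  rw [clock, mul_zero, ramp_of_le (s := 0) (by norm_num), sub_zero, ramp_of_ge (by linarith)]
  field_simp
  ring

variable {d : ℕ} {m : ℝ × Torus d → ℝ} {w : ℝ × Torus d → E d} {m₀ : Torus d → ℝ}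

/-- ζ(clock(t),x) is C¹ on all of ℝ × 𝕋^d and vanishes near T, hence is a legitimate test. As N → ∞
the clock becomes the identity near each t in (0,T), with derivative bounded independently of N, and
dominated convergence applies. -/
theorem weak_identity_of_vanishing (hT : 0 < T)
    (hm : Integrable m (vol d T)) (hw : Integrable w (vol d T)) (hm₀ : Continuous m₀)
    (h : ContinuityEq T m₀ m w) {ζ : ℝ → Torus d → ℝ} (hζ : IsC1 T ζ) (hz : ∀ x, ζ T x = 0) :
    (∫ z, (derivWithin (fun s => ζ s z.2) (Icc 0 T) z.1 * m z +
      inner ℝ (spaceGrad (ζ z.1) z.2) (w z)) ∂(vol d T)) + ∫ x, ζ 0 x * m₀ x = 0 := by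
  have hI : UniqueDiffOn ℝ (Icc 0 T) := uniqueDiffOn_Icc hT
  have hζ' : ContDiffOn ℝ 1 (lift ζ) (Icc 0 T ×ˢ univ) := hζ
  -- The shift by 3 gives NT ≥ 3, so that the clock is exact at time 0 and equal to T from T - 1/N
  -- on.
  let N : ℕ → ℝ := fun k => (k + 3) / T
  have hN : ∀ k, 0 < N k := fun k => by positivity
  have hNT : ∀ k, 3 ≤ N k * T := fun k => by
    simp only [N]; rw [div_mul_cancel₀ _ hT.ne']; linarith [(Nat.cast_nonneg k : (0 : ℝ) ≤ k)]
  have hNlim : Tendsto N atTop atTop :=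
    (tendsto_atTop_add_const_right _ _ tendsto_natCast_atTop_atTop).atTop_div_const hT
  let ζs : ℕ → ℝ → Torus d → ℝ := fun k t x => ζ (clock T (N k) t) x
  have hζs : ∀ k, ContDiff ℝ 1 (lift (ζs k)) := fun k => by
    have h1 : ContDiff ℝ 1 fun z : ℝ × E d => (clock T (N k) z.1, z.2) :=
      ((contDiff_clock.of_le (by simp)).comp contDiff_fst).prodMk contDiff_snd
    exact hζ'.comp_contDiff h1 fun z => ⟨clock_mem hT (hN k) _, mem_univ _⟩
  have hder : ∀ k t x, HasDerivAt (fun s => ζs k s x)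
      (derivWithin (fun s => ζ s x) (Icc 0 T) (clock T (N k) t) *
        (deriv ramp (N k * T - ramp (N k * t)) * deriv ramp (N k * t))) t := fun k t x => by
    obtain ⟨v, rfl⟩ := isOpenQuotientMap_proj.surjective x
    have h1 := hasDerivWithinAt_time hζ' (clock_mem hT (hN k) t) v
    rw [← derivWithin_time hI hζ' (clock_mem hT (hN k) t) v] at h1
    have h2 := h1.comp t (hasDerivAt_clock (hN k) t).hasDerivWithinAt (s := univ)
      fun s _ => clock_mem hT (hN k) s
    exact hasDerivWithinAt_univ.1 h2
  obtain ⟨M, hM1, hM⟩ := exists_bound_deriv_ramp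
  obtain ⟨C₀, hC₀, hb₀⟩ := exists_bound_strip (continuousOn_of_lift hζ')
  obtain ⟨C₁, hC₁, hb₁⟩ := exists_bound_strip (continuousOn_derivWithin_time hI hζ')
  obtain ⟨C₂, hC₂, hb₂⟩ := exists_bound_strip (continuousOn_spaceGrad hI hζ')
  have hlim := tendsto_weakForm hT hm hw hm₀ (φ := ζ) hζs (C := C₀ + C₁ * (M * M) + C₂)
    (a' := fun z => derivWithin (fun s => ζ s z.2) (Icc 0 T) z.1)
    (b' := fun z => spaceGrad (ζ z.1) z.2)
    (fun k t ht x => by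
      have hM0 : 0 ≤ C₁ * (M * M) := by positivity
      have hmem := clock_mem hT (hN k) t
      refine ⟨?_, ?_, ?_⟩
      · exact (hb₀ _ hmem x).trans (by linarith)
      · rw [(hder k t x).deriv, abs_mul, abs_mul]
        have : |derivWithin (fun s => ζ s x) (Icc 0 T) (clock T (N k) t)| *
            (|deriv ramp (N k * T - ramp (N k * t))| * |deriv ramp (N k * t)|) ≤
            C₁ * (M * M) := by
          gcongr
          · exact hb₁ _ hmem x
          · exact hM _
          · exact hM _
        linarith
      · exact (hb₂ _ hmem x).trans (by linarith))
    (fun x => by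
      refine tendsto_const_nhds.congr fun k => ?_
      simp only [ζs, clock_zero (hN k) (hNT k)])
    (fun t ht x => by
      have ev : ∀ᶠ k in atTop, 2 < N k * t ∧ 2 < N k * (T - t) :=
        ((hNlim.atTop_mul_const ht.1).eventually_gt_atTop 2).and
          ((hNlim.atTop_mul_const (sub_pos.2 ht.2)).eventually_gt_atTop 2)
      refine ⟨tendsto_const_nhds.congr' ?_, tendsto_const_nhds.congr' ?_⟩
      · filter_upwards [ev] with k hk
        rw [(hder k t x).deriv, clock_eq_self (hN k) hk.1.le hk.2.le, ramp_of_ge hk.1.le,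
          deriv_ramp_of_gt hk.1, deriv_ramp_of_gt (by linarith [hk.2, mul_sub (N k) T t]), mul_one,
          mul_one]
      · filter_upwards [ev] with k hk
        simp only [ζs, clock_eq_self (hN k) hk.1.le hk.2.le])
  refine tendsto_nhds_unique hlim (tendsto_const_nhds.congr fun k => ?_)
  refine (h.weakForm_eq_zero hT hm hw hm₀ (hζs k) (τ := T - 1 / N k)
    (by have : 0 < 1 / N k := one_div_pos.2 (hN k)
        linarith) fun t ht x => ?_).symm
  simp only [ζs, clock_of_ge (hN k) (hNT k) ht, hz]

theorem IsC1.spaceContDiff_end (hT : 0 < T) {φ : ℝ → Torus d → ℝ} (hφ : IsC1 T φ) :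
    SpaceContDiff 1 (φ T) := by
  have h1 : ContDiff ℝ 1 fun v : E d => ((T, v) : ℝ × E d) := contDiff_const.prodMk contDiff_id
  exact ContDiffOn.comp_contDiff (g := fun z : ℝ × E d => φ z.1 (proj z.2)) hφ h1
    fun v => ⟨right_mem_Icc.2 hT.le, mem_univ _⟩

/-- The continuity equation tested with a `C¹` function up to the boundary. -/
theorem weak_identity (hT : 0 < T) (hm : Integrable m (vol d T)) (hw : Integrable w (vol d T))
    (hm₀ : Continuous m₀) (hpos : ∀ᵐ z ∂(vol d T), 0 ≤ m z)
    (hmass : ∀ᵐ t ∂(volume.restrict (Ioo 0 T)), ∫ x, m (t, x) = 1) (h : ContinuityEq T m₀ m w)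
    {φ : ℝ → Torus d → ℝ} (hφ : IsC1 T φ) :
    ∫ z, (derivWithin (fun s => φ s z.2) (Icc 0 T) z.1 * m z +
      inner ℝ (spaceGrad (φ z.1) z.2) (w z)) ∂(vol d T) =
      ∫ x, φ T x ∂(slice T m T) - ∫ x, φ 0 x * m₀ x := by
  have hI : UniqueDiffOn ℝ (Icc 0 T) := uniqueDiffOn_Icc hT
  have hφ' : ContDiffOn ℝ 1 (lift φ) (Icc 0 T ×ˢ univ) := hφ
  have hφT := hφ.spaceContDiff_end hT
  have hφTl : ContDiffOn ℝ 1 (lift fun _ => φ T) (Icc 0 T ×ˢ univ) := hφT.contDiff_lift.contDiffOn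
  -- Removing the terminal value, extended constantly in time, leaves a function vanishing at T; the
  -- removed part is evaluated by `slice_spec`.
  have hζ : IsC1 T fun t x => φ t x - φ T x := ContDiffOn.sub hφ' hφTl
  have h1 := weak_identity_of_vanishing hT hm hw hm₀ h hζ fun x => sub_self _
  have h2 := slice_spec hT hm hw hm₀ hpos hmass h hφT
  have i1 : Integrable (fun z => derivWithin (fun s => φ s z.2) (Icc 0 T) z.1 * m z +
      inner ℝ (spaceGrad (φ z.1) z.2) (w z)) (vol d T) := by
    obtain ⟨C₁, hC₁, hb₁⟩ := exists_bound_strip (continuousOn_derivWithin_time hI hφ')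
    obtain ⟨C₂, hC₂, hb₂⟩ := exists_bound_strip (continuousOn_spaceGrad hI hφ')
    exact integrable_pairing hm hw
      (continuousOn_aestronglyMeasurable_vol (continuousOn_derivWithin_time hI hφ'))
      (continuousOn_aestronglyMeasurable_vol (continuousOn_spaceGrad hI hφ')) (C := C₁ + C₂)
      fun t ht x => ⟨(hb₁ t (Ioo_subset_Icc_self ht) x).trans (by linarith),
        (hb₂ t (Ioo_subset_Icc_self ht) x).trans (by linarith)⟩
  have i2 := integrable_flux hw hφT
  have e1 : ∫ z, (derivWithin (fun s => φ s z.2 - φ T z.2) (Icc 0 T) z.1 * m z +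
      inner ℝ (spaceGrad (fun x => φ z.1 x - φ T x) z.2) (w z)) ∂(vol d T) =
      ∫ z, (derivWithin (fun s => φ s z.2) (Icc 0 T) z.1 * m z +
        inner ℝ (spaceGrad (φ z.1) z.2) (w z)) ∂(vol d T) -
      ∫ z, inner ℝ (spaceGrad (φ T) z.2) (w z) ∂(vol d T) := by
    rw [← integral_sub i1 i2]
    refine integral_congr_ae ?_
    filter_upwards [ae_vol_mem d T] with z hz
    obtain ⟨t, x⟩ := z
    obtain ⟨v, rfl⟩ := isOpenQuotientMap_proj.surjective x
    have ht : t ∈ Icc 0 T := Ioo_subset_Icc_self hz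
    simp only
    rw [derivWithin_sub_const, spaceGrad_proj, spaceGrad_proj, spaceGrad_proj]
    have g1 := (hasFDerivAt_space hφ' ht v).differentiableAt
    have g2 : DifferentiableAt ℝ (fun u => φ T (proj u)) v := hφT.differentiable one_ne_zero v
    simp only [gradient]
    rw [fderiv_fun_sub g1 g2, map_sub, inner_sub_left]
    ring
  have e2 : ∫ x, (φ 0 x - φ T x) * m₀ x = (∫ x, φ 0 x * m₀ x) - ∫ x, φ T x * m₀ x := by
    have hc0 : Continuous fun x => φ 0 x := by
      have := (continuousOn_of_lift hφ').comp_continuous (f := fun x : Torus d => ((0 : ℝ), x))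
        (by fun_prop) fun x => ⟨left_mem_Icc.2 hT.le, mem_univ _⟩
      exact this
    rw [← integral_sub]
    · simp only [sub_mul]
    · exact (hc0.mul hm₀).integrable_of_hasCompactSupport (HasCompactSupport.of_compactSpace _)
    · exact (hφT.continuous.mul hm₀).integrable_of_hasCompactSupport
        (HasCompactSupport.of_compactSpace _)
  rw [e1, e2] at h1
  linarith

end ClosedStrip

/-! ### The energy as a functional on `L¹ × L¹` -/

section Energy

variable {d : ℕ} {q r T : ℝ} {f : Torus d → ℝ → ℝ} {H : Torus d → E d → ℝ}

/-- `K` and `C` are constants in the coercivity estimate of the running cost. -/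
structure IsCoercive (H : Torus d → E d → ℝ) (f : Torus d → ℝ → ℝ) (q ς K C : ℝ) : Prop where
  one_lt_left : 1 < q
  one_lt_right : 1 < ς
  pos : 0 < K
  nonneg : 0 ≤ C
  le : ∀ x (m : ℝ) (w : E d) (a : ℝ), runningCost H f x m w ≤ a →
    |m| ^ q + ‖w‖ ^ ς ≤ K * (a + C)

theorem exists_isCoercive (hH : IsHamiltonian r H) (hf : IsCoupling q f) :
    ∃ K C, IsCoercive H f q (r.conjExponent * q / (r.conjExponent + q - 1)) K C := by
  obtain ⟨K, hK, C, hC, h⟩ := exists_coercive hH hf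
  have hq := hf.one_lt
  have hρ : 1 < r.conjExponent := (Real.HolderConjugate.conjExponent hH.one_lt).symm.lt
  refine ⟨K, C, hq, ?_, hK, hC, fun x m w a ha => ?_⟩
  · rw [lt_div_iff₀ (by linarith)]
    nlinarith
  · rw [abs_of_nonneg ((runningCost_le_iff hH hf x m w a).1 ha).1]
    exact h x m w a ha

variable {ς K C : ℝ}

theorem IsCoercive.neg_le (hc : IsCoercive H f q ς K C) (x : Torus d) (m : ℝ) (w : E d) :
    ((-C : ℝ) : EReal) ≤ runningCost H f x m w := by
  by_contra h
  obtain ⟨a, h1, h2⟩ := EReal.lt_iff_exists_real_btwn.1 (not_le.1 h)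
  have h3 := hc.le x m w a h1.le
  have h4 : a < -C := EReal.coe_lt_coe_iff.1 h2
  have h5 : 0 ≤ |m| ^ q + ‖w‖ ^ ς := by positivity
  nlinarith [hc.pos]

/-- The running cost, shifted so as to be nonnegative. -/
def shiftedCost (H : Torus d → E d → ℝ) (f : Torus d → ℝ → ℝ) (C : ℝ) (x : Torus d) (m : ℝ)
    (w : E d) : ENNReal := (runningCost H f x m w + (C : EReal)).toENNReal

theorem IsCoercive.coe_shiftedCost (hc : IsCoercive H f q ς K C) (x : Torus d) (m : ℝ) (w : E d) :
    (shiftedCost H f C x m w : EReal) = runningCost H f x m w + (C : EReal) := by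
  refine EReal.coe_toENNReal ?_
  have := add_le_add_left (hc.neg_le x m w) (C : EReal)
  rwa [← EReal.coe_add, neg_add_cancel, EReal.coe_zero] at this

theorem IsCoercive.shiftedCost_le_iff (hc : IsCoercive H f q ς K C) {x : Torus d} {m : ℝ} {w : E d}
    {b : ℝ} (hb : 0 ≤ b) :
    shiftedCost H f C x m w ≤ ENNReal.ofReal b ↔ runningCost H f x m w ≤ ((b - C : ℝ) : EReal) := by
  rw [← EReal.coe_ennreal_le_coe_ennreal_iff, hc.coe_shiftedCost, EReal.coe_ennreal_ofReal,
    max_eq_left hb, EReal.coe_sub]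
  rw [EReal.le_sub_iff_add_le (Or.inl (EReal.coe_ne_bot _)) (Or.inl (EReal.coe_ne_top _))]

theorem lowerSemicontinuous_shiftedCost (hH : IsHamiltonian r H) (hf : IsCoupling q f)
    (hc : IsCoercive H f q ς K C) :
    LowerSemicontinuous fun y : Torus d × ℝ × E d => shiftedCost H f C y.1 y.2.1 y.2.2 := by
  rw [lowerSemicontinuous_iff_isClosed_preimage]
  intro b
  by_cases hb : b = ⊤
  · simp [hb]
  have h1 := lowerSemicontinuous_iff_isClosed_preimage.1 (lowerSemicontinuous_runningCost hH hf)
    ((b.toReal - C : ℝ) : EReal)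
  convert h1 using 1
  ext y
  simp only [mem_preimage, mem_Iic]
  rw [← hc.shiftedCost_le_iff ENNReal.toReal_nonneg, ENNReal.ofReal_toReal hb]

theorem measurable_shiftedCost (hH : IsHamiltonian r H) (hf : IsCoupling q f)
    (hc : IsCoercive H f q ς K C) :
    Measurable fun y : Torus d × ℝ × E d => shiftedCost H f C y.1 y.2.1 y.2.2 :=
  (lowerSemicontinuous_shiftedCost hH hf hc).measurable

theorem shiftedCost_convex (hH : IsHamiltonian r H) (hf : IsCoupling q f)
    (hc : IsCoercive H f q ς K C) (x : Torus d) (m n : ℝ) (v w : E d) {s t : ℝ} (hs : 0 < s)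
    (ht : 0 < t) (hst : s + t = 1) :
    shiftedCost H f C x (s * m + t * n) (s • v + t • w) ≤
      ENNReal.ofReal s * shiftedCost H f C x m v + ENNReal.ofReal t * shiftedCost H f C x n w := by
  by_cases hm : shiftedCost H f C x m v = ⊤
  · rw [hm, ENNReal.mul_top (by simpa using hs), top_add]; exact le_top
  by_cases hn : shiftedCost H f C x n w = ⊤
  · rw [hn, ENNReal.mul_top (by simpa using ht), add_top]; exact le_top
  have h1 := (hc.shiftedCost_le_iff ENNReal.toReal_nonneg).1 (ENNReal.ofReal_toReal hm).ge
  have h2 := (hc.shiftedCost_le_iff ENNReal.toReal_nonneg).1 (ENNReal.ofReal_toReal hn).ge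
  have h3 := convex_runningCost hH hf x hs.le ht.le hst h1 h2
  rw [← ENNReal.ofReal_toReal hm, ← ENNReal.ofReal_toReal hn, ← ENNReal.ofReal_mul hs.le,
    ← ENNReal.ofReal_mul ht.le, ← ENNReal.ofReal_add (by positivity) (by positivity),
    hc.shiftedCost_le_iff (by positivity)]
  convert h3 using 2
  linear_combination C * hst

theorem shiftedCost_strict (hH : IsHamiltonian r H) (hf : IsCoupling q f)
    (hc : IsCoercive H f q ς K C) {x : Torus d} {m n : ℝ} {v w : E d}
    (hm : shiftedCost H f C x m v ≠ ⊤) (hn : shiftedCost H f C x n w ≠ ⊤)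
    (hmid : ENNReal.ofReal (1 / 2) * shiftedCost H f C x m v +
        ENNReal.ofReal (1 / 2) * shiftedCost H f C x n w ≤
      shiftedCost H f C x (1 / 2 * m + 1 / 2 * n) ((1 / 2 : ℝ) • v + (1 / 2 : ℝ) • w)) :
    m = n ∧ v = w := by
  have h1 := (hc.shiftedCost_le_iff ENNReal.toReal_nonneg).1 (ENNReal.ofReal_toReal hm).ge
  have h2 := (hc.shiftedCost_le_iff ENNReal.toReal_nonneg).1 (ENNReal.ofReal_toReal hn).ge
  refine strictConvex_runningCost hH hf x h1 h2 ?_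
  rw [← ENNReal.ofReal_toReal hm, ← ENNReal.ofReal_toReal hn, ← ENNReal.ofReal_mul (by norm_num),
    ← ENNReal.ofReal_mul (by norm_num), ← ENNReal.ofReal_add (by positivity) (by positivity),
    ← EReal.coe_ennreal_le_coe_ennreal_iff, hc.coe_shiftedCost, EReal.coe_ennreal_ofReal,
    max_eq_left (by positivity)] at hmid
  have h3 := EReal.sub_le_sub hmid (le_refl (C : EReal))
  rw [EReal.add_sub_cancel_right, ← EReal.coe_sub] at h3
  convert h3 using 2
  ring

/-- The space `L¹ × L¹` in which the optimal control problem for the continuity equation is set. -/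
abbrev PairSpace (d : ℕ) (T : ℝ) := Lp ℝ 1 (vol d T) × Lp (E d) 1 (vol d T)

/-- The integral of the shifted running cost. -/
def energy (H : Torus d → E d → ℝ) (f : Torus d → ℝ → ℝ) (C : ℝ) (p : PairSpace d T) : ENNReal :=
  ∫⁻ z, shiftedCost H f C z.2 (p.1 z) (p.2 z) ∂(vol d T)

theorem measurable_coe (p : PairSpace d T) :
    Measurable fun z : ℝ × Torus d => (z.2, p.1 z, p.2 z) :=
  measurable_snd.prodMk ((Lp.stronglyMeasurable p.1).measurable.prodMk
    (Lp.stronglyMeasurable p.2).measurable)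

theorem measurable_energy_integrand (hH : IsHamiltonian r H) (hf : IsCoupling q f)
    (hc : IsCoercive H f q ς K C) (p : PairSpace d T) :
    Measurable fun z : ℝ × Torus d => shiftedCost H f C z.2 (p.1 z) (p.2 z) :=
  (measurable_shiftedCost hH hf hc).comp (measurable_coe p)

theorem ae_combination (p p' : PairSpace d T) (s t : ℝ) : ∀ᵐ z ∂(vol d T),
    (s • p + t • p').1 z = s * p.1 z + t * p'.1 z ∧
    (s • p + t • p').2 z = s • p.2 z + t • p'.2 z := by
  filter_upwards [Lp.coeFn_add (s • p.1) (t • p'.1), Lp.coeFn_smul s p.1, Lp.coeFn_smul t p'.1,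
    Lp.coeFn_add (s • p.2) (t • p'.2), Lp.coeFn_smul s p.2, Lp.coeFn_smul t p'.2]
    with z h1 h2 h3 h4 h5 h6
  simp only [Prod.fst_add, Prod.smul_fst, Prod.snd_add, Prod.smul_snd, h1, h4, Pi.add_apply, h2, h3,
    h5, h6, Pi.smul_apply, smul_eq_mul, and_self]

theorem energy_convex (hH : IsHamiltonian r H) (hf : IsCoupling q f)
    (hc : IsCoercive H f q ς K C) (p p' : PairSpace d T) {s t : ℝ} (hs : 0 < s)
    (ht : 0 < t) (hst : s + t = 1) :
    energy H f C (s • p + t • p') ≤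
      ENNReal.ofReal s * energy H f C p + ENNReal.ofReal t * energy H f C p' := by
  unfold energy
  rw [← lintegral_const_mul' _ _ ENNReal.ofReal_ne_top,
    ← lintegral_const_mul' _ _ ENNReal.ofReal_ne_top,
    ← lintegral_add_left ((measurable_energy_integrand hH hf hc p).const_mul _)]
  refine lintegral_mono_ae ?_
  filter_upwards [ae_combination p p' s t] with z hz
  rw [hz.1, hz.2]
  exact shiftedCost_convex hH hf hc _ _ _ _ _ hs ht hst

/-- One subsequence for both components; with Fatou's lemma in `energy_le_liminf` it yields lower
semicontinuity of the energy for the L¹ topology. -/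
theorem exists_subseq_tendsto_ae {p : ℕ → PairSpace d T} {p' : PairSpace d T}
    (h : Tendsto p atTop (𝓝 p')) : ∃ ns : ℕ → ℕ, StrictMono ns ∧ ∀ᵐ z ∂(vol d T),
      Tendsto (fun k => ((p (ns k)).1 z, (p (ns k)).2 z)) atTop (𝓝 (p'.1 z, p'.2 z)) := by
  have h1 : Tendsto (fun n => (p n).1) atTop (𝓝 p'.1) := (continuous_fst.tendsto _).comp h
  have h2 : Tendsto (fun n => (p n).2) atTop (𝓝 p'.2) := (continuous_snd.tendsto _).comp h
  obtain ⟨ns, hns, hns'⟩ := (tendstoInMeasure_of_tendsto_Lp h1).exists_seq_tendsto_ae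
  obtain ⟨ms, hms, hms'⟩ := (tendstoInMeasure_of_tendsto_Lp
    (h2.comp hns.tendsto_atTop)).exists_seq_tendsto_ae
  refine ⟨ns ∘ ms, hns.comp hms, ?_⟩
  filter_upwards [hns', hms'] with z h3 h4
  exact (h3.comp hms.tendsto_atTop).prodMk_nhds h4

theorem _root_.LowerSemicontinuous.le_liminf_comp {X : Type*} [TopologicalSpace X]
    {g : X → ENNReal} (hg : LowerSemicontinuous g) {u : ℕ → X} {x : X}
    (hu : Tendsto u atTop (𝓝 x)) : g x ≤ liminf (fun k => g (u k)) atTop :=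
  le_of_forall_lt fun c hc => by
    obtain ⟨c', h1, h2⟩ := exists_between hc
    exact h1.trans_le (le_liminf_of_le (h := (hu.eventually (hg x c' h2)).mono fun _ h => h.le))

theorem energy_le_liminf (hH : IsHamiltonian r H) (hf : IsCoupling q f)
    (hc : IsCoercive H f q ς K C) {p : ℕ → PairSpace d T} {p' : PairSpace d T}
    (h : ∀ᵐ z ∂(vol d T), Tendsto (fun k => ((p k).1 z, (p k).2 z)) atTop (𝓝 (p'.1 z, p'.2 z))) :
    energy H f C p' ≤ liminf (fun k => energy H f C (p k)) atTop := by
  have h1 : energy H f C p' ≤ ∫⁻ z, liminf (fun k => shiftedCost H f C z.2 ((p k).1 z)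
      ((p k).2 z)) atTop ∂(vol d T) := by
    refine lintegral_mono_ae ?_
    filter_upwards [h] with z hz
    exact (lowerSemicontinuous_shiftedCost hH hf hc).le_liminf_comp
      (u := fun k => (z.2, (p k).1 z, (p k).2 z)) (x := (z.2, p'.1 z, p'.2 z))
      (tendsto_const_nhds.prodMk_nhds hz)
  exact h1.trans (lintegral_liminf_le fun k => measurable_energy_integrand hH hf hc _)

theorem lowerSemicontinuous_energy (hH : IsHamiltonian r H) (hf : IsCoupling q f)
    (hc : IsCoercive H f q ς K C) : LowerSemicontinuous (energy H f C : PairSpace d T → ENNReal) := by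
  rw [lowerSemicontinuous_iff_isClosed_preimage]
  intro b
  refine IsSeqClosed.isClosed fun p p' hp hlim => ?_
  obtain ⟨ns, -, hns⟩ := exists_subseq_tendsto_ae hlim
  have h1 : ∀ k, energy H f C (p (ns k)) ≤ b := fun k => hp _
  have h2 := energy_le_liminf hH hf hc (p := fun k => p (ns k)) hns
  exact h2.trans (liminf_le_of_frequently_le' (Frequently.of_forall h1))

theorem IsCoercive.lintegral_le (hc : IsCoercive H f q ς K C) (p : PairSpace d T) :
    ∫⁻ z, ENNReal.ofReal (|p.1 z| ^ q + ‖p.2 z‖ ^ ς) ∂(vol d T) ≤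
      ENNReal.ofReal K * energy H f C p := by
  unfold energy
  rw [← lintegral_const_mul' _ _ ENNReal.ofReal_ne_top]
  refine lintegral_mono fun z => ?_
  by_cases hz : shiftedCost H f C z.2 (p.1 z) (p.2 z) = ⊤
  · rw [hz, ENNReal.mul_top (by simpa using hc.pos)]; exact le_top
  have h1 := (hc.shiftedCost_le_iff ENNReal.toReal_nonneg).1 (ENNReal.ofReal_toReal hz).ge
  have h2 := hc.le _ _ _ _ h1
  rw [sub_add_cancel] at h2
  rw [← ENNReal.ofReal_toReal hz, ← ENNReal.ofReal_mul hc.pos.le]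
  exact ENNReal.ofReal_le_ofReal h2

/-- The cost is at least -C and the measure is finite, so its negative part has finite integral and
no ∞ - ∞ occurs. -/
theorem eintegral_eq (hH : IsHamiltonian r H) (hf : IsCoupling q f)
    (hc : IsCoercive H f q ς K C) (p : PairSpace d T) :
    eintegral (vol d T) (fun z => kinetic H z.2 (p.1 z) (p.2 z) + F f z.2 (p.1 z)) =
      (energy H f C p : EReal) - ((C * (vol d T).real univ : ℝ) : EReal) := by
  set g : ℝ × Torus d → EReal := fun z => runningCost H f z.2 (p.1 z) (p.2 z) with hg
  change eintegral (vol d T) g = _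
  have hgm : Measurable g :=
    (lowerSemicontinuous_runningCost hH hf).measurable.comp (measurable_coe p)
  have hgC : ∀ z, ((-C : ℝ) : EReal) ≤ g z := fun z => hc.neg_le _ _ _
  -- That is, (g+C)⁺ + g⁻ = g⁺ + C for g ≥ -C: subtraction is avoided until finiteness is known.
  have hpt : ∀ z, shiftedCost H f C z.2 (p.1 z) (p.2 z) + (-(g z)).toENNReal =
      (g z).toENNReal + ENNReal.ofReal C := by
    intro z
    have h1 := hgC z
    change (g z + (C : EReal)).toENNReal + (-(g z)).toENNReal = _
    generalize g z = y at h1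
    induction y with
    | bot => simp at h1
    | top => simp
    | coe y =>
      have h2 : -C ≤ y := EReal.coe_le_coe_iff.1 h1
      rw [← EReal.coe_add, ← EReal.coe_neg, EReal.real_coe_toENNReal, EReal.real_coe_toENNReal,
        EReal.real_coe_toENNReal]
      have hC := hc.nonneg
      rcases le_total 0 y with hy | hy
      · rw [ENNReal.ofReal_of_nonpos (neg_nonpos.2 hy), add_zero, ENNReal.ofReal_add hy hC]
      · rw [ENNReal.ofReal_of_nonpos hy, zero_add,
          ← ENNReal.ofReal_add (by linarith) (by linarith)]
        congr 1; ring
  have hint : energy H f C p + ∫⁻ z, (-(g z)).toENNReal ∂(vol d T) =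
      ∫⁻ z, (g z).toENNReal ∂(vol d T) + ENNReal.ofReal (C * (vol d T).real univ) := by
    unfold energy
    rw [← lintegral_add_left (measurable_energy_integrand hH hf hc p)]
    simp only [hpt]
    rw [lintegral_add_right _ measurable_const, lintegral_const, ENNReal.ofReal_mul hc.nonneg,
      measureReal_def, ENNReal.ofReal_toReal (measure_ne_top _ _)]
  have hneg : ∫⁻ z, (-(g z)).toENNReal ∂(vol d T) ≠ ⊤ := by
    refine ne_top_of_le_ne_top (b := ∫⁻ _, ENNReal.ofReal C ∂(vol d T)) ?_ (lintegral_mono fun z => ?_)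
    · rw [lintegral_const]
      exact ENNReal.mul_ne_top ENNReal.ofReal_ne_top (measure_ne_top _ _)
    · rw [← EReal.real_coe_toENNReal]
      refine EReal.toENNReal_le_toENNReal ?_
      have := EReal.neg_le_neg_iff.2 (hgC z)
      rwa [← EReal.coe_neg, neg_neg] at this
  have hC0 : 0 ≤ C * (vol d T).real univ := mul_nonneg hc.nonneg measureReal_nonneg
  unfold eintegral
  generalize (∫⁻ z, (-(g z)).toENNReal ∂(vol d T)) = n at hint hneg
  generalize (∫⁻ z, (g z).toENNReal ∂(vol d T)) = l at hint
  generalize energy H f C p = e at hint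
  generalize C * (vol d T).real univ = c at hint hC0
  lift n to NNReal using hneg
  by_cases hl : l = ⊤
  · subst hl
    rw [top_add, ENNReal.add_eq_top] at hint
    obtain rfl : e = ⊤ := hint.resolve_right ENNReal.coe_ne_top
    rfl
  · have he : e ≠ ⊤ := by
      rintro rfl
      rw [top_add] at hint
      exact (ENNReal.add_ne_top.2 ⟨hl, ENNReal.ofReal_ne_top⟩) hint.symm
    lift l to NNReal using hl
    lift e to NNReal using he
    have h3 := congrArg ENNReal.toReal hint
    rw [ENNReal.toReal_add ENNReal.coe_ne_top ENNReal.coe_ne_top,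
      ENNReal.toReal_add ENNReal.coe_ne_top ENNReal.ofReal_ne_top, ENNReal.toReal_ofReal hC0] at h3
    simp only [ENNReal.coe_toReal] at h3
    have e1 : ∀ y : NNReal, (((y : ENNReal)) : EReal) = ((y : ℝ) : EReal) := fun y => rfl
    rw [e1, e1, e1, ← EReal.coe_sub, ← EReal.coe_sub]
    congr 1
    linarith

end Energy

/-! ### The constraint set as a closed convex subset of L¹ × L¹. -/

section Admissible

variable {d : ℕ} {T : ℝ} {m₀ : Torus d → ℝ}

theorem integrable_fst (p : PairSpace d T) : Integrable (p.1 : ℝ × Torus d → ℝ) (vol d T) :=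
  L1.integrable_coeFn p.1

theorem integrable_snd (p : PairSpace d T) : Integrable (p.2 : ℝ × Torus d → E d) (vol d T) :=
  L1.integrable_coeFn p.2

theorem exists_pairing {a : ℝ × Torus d → ℝ} {b : ℝ × Torus d → E d}
    (ha : AEStronglyMeasurable a (vol d T)) (hb : AEStronglyMeasurable b (vol d T)) {C : ℝ}
    (hbd : ∀ t ∈ Ioo 0 T, ∀ x, ‖a (t, x)‖ ≤ C ∧ ‖b (t, x)‖ ≤ C) :
    ∃ Λ : PairSpace d T →L[ℝ] ℝ, ∀ p, Λ p =
      ∫ z, (a z * p.1 z + inner ℝ (b z) (p.2 z)) ∂(vol d T) := by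
  have hint := fun p : PairSpace d T =>
    integrable_pairing (integrable_fst p) (integrable_snd p) ha hb hbd
  have hlin : ∀ (s t : ℝ) (p p' : PairSpace d T),
      ∫ z, (a z * (s • p + t • p').1 z + inner ℝ (b z) ((s • p + t • p').2 z)) ∂(vol d T) =
      s * ∫ z, (a z * p.1 z + inner ℝ (b z) (p.2 z)) ∂(vol d T) +
      t * ∫ z, (a z * p'.1 z + inner ℝ (b z) (p'.2 z)) ∂(vol d T) := by
    intro s t p p'
    rw [← integral_const_mul, ← integral_const_mul,
      ← integral_add ((hint p).const_mul s) ((hint p').const_mul t)]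
    refine integral_congr_ae ?_
    filter_upwards [ae_combination p p' s t] with z hz
    rw [hz.1, hz.2, inner_add_right, inner_smul_right, inner_smul_right]
    ring
  let Λ : PairSpace d T →ₗ[ℝ] ℝ :=
    { toFun := fun p => ∫ z, (a z * p.1 z + inner ℝ (b z) (p.2 z)) ∂(vol d T)
      map_add' := fun p p' => by simpa only [one_smul, one_mul] using hlin 1 1 p p'
      map_smul' := fun s p => by
        simpa only [zero_smul, add_zero, zero_mul, smul_eq_mul, RingHom.id_apply] using
          hlin s 0 p 0 }
  refine ⟨Λ.mkContinuous (|C| + |C|) fun p => ?_, fun p => rfl⟩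
  have h1 : ‖∫ z, (a z * p.1 z + inner ℝ (b z) (p.2 z)) ∂(vol d T)‖ ≤
      ∫ z, (|C| * ‖p.1 z‖ + |C| * ‖p.2 z‖) ∂(vol d T) := by
    refine norm_integral_le_of_norm_le
      (((integrable_fst p).norm.const_mul _).add ((integrable_snd p).norm.const_mul _)) ?_
    filter_upwards [ae_vol_mem d T] with z hz
    have h2 := hbd z.1 hz z.2
    refine (norm_add_le _ _).trans (add_le_add ?_ ((norm_inner_le_norm _ _).trans ?_))
    · rw [norm_mul]
      exact mul_le_mul_of_nonneg_right (h2.1.trans (le_abs_self C)) (norm_nonneg _)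
    · exact mul_le_mul_of_nonneg_right (h2.2.trans (le_abs_self C)) (norm_nonneg _)
  rw [integral_add ((integrable_fst p).norm.const_mul _) ((integrable_snd p).norm.const_mul _),
    integral_const_mul, integral_const_mul, ← L1.norm_eq_integral_norm,
    ← L1.norm_eq_integral_norm] at h1
  refine h1.trans ?_
  rw [add_mul]
  gcongr
  · exact norm_fst_le p
  · exact norm_snd_le p

theorem IsTest.exists_pairing {φ : ℝ → Torus d → ℝ} (hφ : IsTest T φ) :
    ∃ Λ : PairSpace d T →L[ℝ] ℝ, ∀ p, Λ p = ∫ z, (deriv (fun s => φ s z.2) z.1 * p.1 z +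
      inner ℝ (spaceGrad (φ z.1) z.2) (p.2 z)) ∂(vol d T) := by
  have h1 : ContDiff ℝ 1 (lift φ) := hφ.1.of_le (by exact_mod_cast le_top)
  have ha := (continuous_deriv_time h1).continuousOn (s := Icc 0 T ×ˢ univ)
  have hb := (continuous_spaceGrad h1).continuousOn (s := Icc 0 T ×ˢ univ)
  obtain ⟨C, -, hC⟩ := exists_bound_strip ha
  obtain ⟨C', -, hC'⟩ := exists_bound_strip hb
  exact MFG.exists_pairing (continuousOn_aestronglyMeasurable_vol ha)
    (continuousOn_aestronglyMeasurable_vol hb) (C := max C C') fun t ht x =>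
      ⟨(hC t (Ioo_subset_Icc_self ht) x).trans (le_max_left _ _),
        (hC' t (Ioo_subset_Icc_self ht) x).trans (le_max_right _ _)⟩

theorem spaceGrad_const (c : ℝ) (x : Torus d) : spaceGrad (fun _ => c) x = 0 := by
  simp [spaceGrad]

theorem spaceContDiff_const (c : ℝ) {n : WithTop ℕ∞} : SpaceContDiff n (fun _ : Torus d => c) :=
  contDiff_const

/-- The unit mass condition is automatic: the continuity equation tested with constants in space
conserves the mass of m₀. The remaining conditions are a cone and linear equations. -/
theorem mem_K1_iff (hT : 0 < T) (hmass : ∫ x, m₀ x = 1) {p : PairSpace d T} :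
    p ∈ K1 T m₀ ↔ 0 ≤ p.1 ∧ ContinuityEq T m₀ p.1 p.2 := by
  rw [← Lp.coeFn_nonneg]
  refine ⟨fun h => ⟨h.1, h.2.2⟩, fun h => ⟨h.1, ?_, h.2⟩⟩
  filter_upwards [h.2.ae_eq_weakPath hT (integrable_fst p) (integrable_snd p)
    (spaceContDiff_const 1)] with t ht
  simpa [weakPath, spaceGrad_const, hmass] using ht

theorem K1_eq (hT : 0 < T) (hmass : ∫ x, m₀ x = 1) : ∃ Λ : {φ // IsTest (d := d) T φ} →
    PairSpace d T →L[ℝ] ℝ, K1 T m₀ = {p | 0 ≤ p.1} ∩ ⋂ φ, {p | Λ φ p = -∫ x, φ.1 0 x * m₀ x} := by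
  choose Λ hΛ using fun φ : {φ // IsTest (d := d) T φ} => φ.2.exists_pairing
  refine ⟨Λ, Set.ext fun p => ?_⟩
  rw [mem_K1_iff hT hmass]
  simp only [mem_inter_iff, mem_ofPred_eq, mem_iInter, hΛ, eq_neg_iff_add_eq_zero, Subtype.forall]
  rfl

theorem isClosed_K1 (hT : 0 < T) (hmass : ∫ x, m₀ x = 1) : IsClosed (K1 T m₀) := by
  obtain ⟨Λ, h⟩ := K1_eq hT hmass
  rw [h]
  exact (isClosed_le continuous_const continuous_fst).inter
    (isClosed_iInter fun φ => isClosed_eq (Λ φ).continuous continuous_const)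

theorem convex_K1 (hT : 0 < T) (hmass : ∫ x, m₀ x = 1) : Convex ℝ (K1 T m₀) := by
  obtain ⟨Λ, h⟩ := K1_eq hT hmass
  rw [h]
  refine Convex.inter (fun p hp p' hp' s t hs ht _ => ?_) (convex_iInter fun φ => ?_)
  · have h1 : 0 ≤ p.1 := hp
    have h2 : 0 ≤ p'.1 := hp'
    change 0 ≤ (s • p + t • p').1
    rw [← Lp.coeFn_nonneg] at h1 h2 ⊢
    filter_upwards [h1, h2, ae_combination p p' s t] with z h3 h4 h5
    rw [h5.1]
    exact add_nonneg (mul_nonneg hs h3) (mul_nonneg ht h4)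
  · exact convex_hyperplane (Λ φ).isLinear _

/-! ### The terminal cost -/

/-- The terminal cost `∫ φ_T dm(T)`. -/
def terminalCost (φT : Torus d → ℝ) (p : PairSpace d T) : ℝ := ∫ x, φT x ∂(slice T p.1 T)

theorem abs_terminalCost_le (hT : 0 < T) {φT : Torus d → ℝ} {M : ℝ} (h : ∀ x, |φT x| ≤ M)
    {p : PairSpace d T} (hp : p ∈ K1 T m₀) : |terminalCost φT p| ≤ M := by
  have := (slice_spec_smooth hT (integrable_fst p) (integrable_snd p) hp.1 hp.2.1 hp.2.2).1
  refine (norm_integral_le_of_norm_le_const (C := M)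
    (Eventually.of_forall fun x => (Real.norm_eq_abs _).trans_le (h x))).trans_eq ?_
  simp

/-- Replace φ_T by a uniformly close smooth ψ, for which the terminal cost is affine in w by
`slice_spec`; the error is uniform because m(T) is a probability measure. Continuity and affinity on
the constraint set pass to the uniform limit. -/
theorem exists_affine_near_terminalCost (hT : 0 < T) (hm₀ : Continuous m₀) {φT : Torus d → ℝ}
    (hφT : Continuous φT) {e : ℝ} (he : 0 < e) : ∃ (Λ : PairSpace d T →L[ℝ] ℝ) (c : ℝ),
      ∀ p ∈ K1 T m₀, |c + Λ p - terminalCost φT p| ≤ e := by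
  obtain ⟨ψ, hψ, hnear⟩ := exists_smooth_near hφT he
  have hψ1 : SpaceContDiff 1 ψ := hψ.of_le (by exact_mod_cast le_top)
  have hb : ContinuousOn (fun z : ℝ × Torus d => spaceGrad ψ z.2) (Icc 0 T ×ˢ univ) :=
    (hψ1.continuous_spaceGrad.comp continuous_snd).continuousOn
  obtain ⟨C, hC, hbd⟩ := exists_bound_strip hb
  obtain ⟨Λ, hΛ⟩ := exists_pairing (d := d) (T := T) (a := fun _ => 0) (b := fun z => spaceGrad ψ z.2)
    aestronglyMeasurable_const (continuousOn_aestronglyMeasurable_vol hb) (C := C)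
    fun t ht x => ⟨by simpa using hC, hbd t (Ioo_subset_Icc_self ht) x⟩
  refine ⟨Λ, ∫ x, ψ x * m₀ x, fun p hp => ?_⟩
  have h1 := slice_spec_smooth hT (integrable_fst p) (integrable_snd p) hp.1 hp.2.1 hp.2.2
  have := h1.1
  have h2 := slice_spec hT (integrable_fst p) (integrable_snd p) hm₀ hp.1 hp.2.1 hp.2.2 hψ1
  simp only [hΛ, zero_mul, zero_add]
  rw [← h2]
  exact abs_integral_sub_le hφT hψ1.continuous hnear

theorem continuousOn_terminalCost (hT : 0 < T) (hm₀ : Continuous m₀) {φT : Torus d → ℝ}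
    (hφT : Continuous φT) : ContinuousOn (terminalCost φT) (K1 (d := d) T m₀) := by
  refine continuousOn_of_uniform_approx_of_continuousOn fun u hu => ?_
  obtain ⟨e, he, hue⟩ := Metric.mem_uniformity_dist.1 hu
  obtain ⟨Λ, c, h⟩ := exists_affine_near_terminalCost hT hm₀ hφT (half_pos he)
  refine ⟨fun p => c + Λ p, (continuous_const.add Λ.continuous).continuousOn, fun p hp => hue ?_⟩
  rw [dist_comm, Real.dist_eq]
  exact (h p hp).trans_lt (half_lt_self he)

theorem terminalCost_affine (hT : 0 < T) (hm₀ : Continuous m₀) (hmass : ∫ x, m₀ x = 1)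
    {φT : Torus d → ℝ} (hφT : Continuous φT) {p p' : PairSpace d T} (hp : p ∈ K1 T m₀)
    (hp' : p' ∈ K1 T m₀) {s t : ℝ} (hs : 0 < s) (ht : 0 < t) (hst : s + t = 1) :
    terminalCost φT (s • p + t • p') = s * terminalCost φT p + t * terminalCost φT p' := by
  refine eq_of_abs_sub_le_all fun e he => ?_
  obtain ⟨Λ, c, h⟩ := exists_affine_near_terminalCost hT hm₀ hφT (half_pos he)
  have h1 := h p hp
  have h2 := h p' hp'
  have h3 := h _ (convex_K1 hT hmass hp hp' hs.le ht.le hst)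
  rw [map_add, map_smul, map_smul, smul_eq_mul, smul_eq_mul] at h3
  rw [abs_le] at h1 h2 h3 ⊢
  obtain rfl : t = 1 - s := by linarith
  constructor <;> nlinarith

/-! ### A competitor of finite energy -/

theorem integrable_density (hm₀ : Continuous m₀) :
    Integrable (fun z : ℝ × Torus d => m₀ z.2) (vol d T) := by
  obtain ⟨C, -, hC⟩ := exists_bound_strip (d := d) (T := T) (g := fun z => m₀ z.2)
    (hm₀.comp continuous_snd).continuousOn
  refine Integrable.of_bound (hm₀.comp continuous_snd).aestronglyMeasurable C ?_
  filter_upwards [ae_vol_mem d T] with z hz using hC z.1 (Ioo_subset_Icc_self hz) z.2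

/-- The pair `(m₀, 0)`. -/
def stationary (T : ℝ) (hm₀ : Continuous m₀) : PairSpace d T :=
  ((integrable_density hm₀).toL1 _, 0)

theorem stationary_ae (hm₀ : Continuous m₀) : ∀ᵐ z ∂(vol d T),
    (stationary T hm₀).1 z = m₀ z.2 ∧ (stationary T hm₀).2 z = 0 := by
  filter_upwards [(integrable_density hm₀).coeFn_toL1 (μ := vol d T),
    Lp.coeFn_zero (E d) 1 (vol d T)] with z h1 h2
  exact ⟨h1, h2⟩

theorem stationary_mem_K1 (hT : 0 < T) (hm₀ : Continuous m₀) (hpos : ∀ x, 0 < m₀ x)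
    (hmass : ∫ x, m₀ x = 1) : stationary T hm₀ ∈ K1 T m₀ := by
  rw [mem_K1_iff hT hmass]
  constructor
  · rw [← Lp.coeFn_nonneg]
    filter_upwards [stationary_ae (T := T) hm₀] with z hz
    rw [hz.1]; exact (hpos _).le
  intro φ hφ
  obtain ⟨hφ, τ, hτ, hz⟩ := hφ
  have h1 : ContDiff ℝ 1 (lift φ) := hφ.of_le (by exact_mod_cast le_top)
  have h2 : ∫ z, (deriv (fun s => φ s z.2) z.1 * (stationary T hm₀).1 z +
      inner ℝ (spaceGrad (φ z.1) z.2) ((stationary T hm₀).2 z)) ∂(vol d T) =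
      ∫ z, deriv (fun s => φ s z.2) z.1 * m₀ z.2 ∂(vol d T) := by
    refine integral_congr_ae ?_
    filter_upwards [stationary_ae (T := T) hm₀] with z hz
    rw [hz.1, hz.2, inner_zero_right, add_zero]
  have hcont : Continuous fun z : ℝ × Torus d => deriv (fun s => φ s z.2) z.1 * m₀ z.2 :=
    (continuous_deriv_time h1).mul (hm₀.comp continuous_snd)
  have hint : Integrable (fun z : ℝ × Torus d => deriv (fun s => φ s z.2) z.1 * m₀ z.2)
      (vol d T) := by
    obtain ⟨C, -, hC⟩ := exists_bound_strip (d := d) (T := T) hcont.continuousOn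
    refine Integrable.of_bound hcont.aestronglyMeasurable C ?_
    filter_upwards [ae_vol_mem d T] with z hz using hC z.1 (Ioo_subset_Icc_self hz) z.2
  rw [h2, vol, integral_prod_symm _ hint, ← eq_neg_iff_add_eq_zero, ← integral_neg]
  refine integral_congr_ae (Eventually.of_forall fun x => ?_)
  have h3 : ∫ t in (0 : ℝ)..T, deriv (fun s => φ s x) t = φ T x - φ 0 x := by
    refine intervalIntegral.integral_eq_sub_of_hasDerivAt
      (f := fun s => φ s x) (fun t _ => hasDerivAt_time h1 t x) ?_
    exact ((continuous_deriv_time h1).comp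
      (by fun_prop : Continuous fun t : ℝ => (t, x))).intervalIntegrable _ _
  simp only
  rw [integral_mul_const, ← integral_Ioc_eq_integral_Ioo, ← intervalIntegral.integral_of_le hT.le,
    h3, hz T hτ.le]
  ring

end Admissible

/-! ### Compactness of the sublevel sets of energy plus a convex term. -/

section Sublevel

variable {d : ℕ} {q r ς K C T : ℝ} {f : Torus d → ℝ → ℝ} {H : Torus d → E d → ℝ}

/-- The points of `S` where the energy plus `A` is at most `c`. -/
def sublevel (H : Torus d → E d → ℝ) (f : Torus d → ℝ → ℝ) (C : ℝ) (S : Set (PairSpace d T))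
    (A : PairSpace d T → ℝ) (c : ℝ) : Set (PairSpace d T) :=
  {p | p ∈ S ∧ energy H f C p ≠ ⊤ ∧ (energy H f C p).toReal + A p ≤ c}

theorem mem_sublevel_iff {S : Set (PairSpace d T)} {A : PairSpace d T → ℝ} {c : ℝ}
    {p : PairSpace d T} : p ∈ sublevel H f C S A c ↔
      p ∈ S ∧ A p ≤ c ∧ energy H f C p ≤ ENNReal.ofReal (c - A p) := by
  refine and_congr_right fun _ => ⟨fun ⟨h1, h2⟩ => ?_, fun ⟨h1, h2⟩ => ?_⟩
  · have h3 : (0 : ℝ) ≤ (energy H f C p).toReal := ENNReal.toReal_nonneg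
    refine ⟨by linarith, ?_⟩
    rw [← ENNReal.ofReal_toReal h1]
    exact ENNReal.ofReal_le_ofReal (by linarith)
  · have h3 := ne_top_of_le_ne_top ENNReal.ofReal_ne_top h2
    refine ⟨h3, ?_⟩
    have h4 := ENNReal.toReal_mono ENNReal.ofReal_ne_top h2
    rw [ENNReal.toReal_ofReal (by linarith)] at h4
    linarith

theorem energy_combination (hH : IsHamiltonian r H) (hf : IsCoupling q f)
    (hc : IsCoercive H f q ς K C) {p p' : PairSpace d T} (hp : energy H f C p ≠ ⊤)
    (hp' : energy H f C p' ≠ ⊤) {s t : ℝ} (hs : 0 < s) (ht : 0 < t) (hst : s + t = 1) :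
    energy H f C (s • p + t • p') ≠ ⊤ ∧ (energy H f C (s • p + t • p')).toReal ≤
      s * (energy H f C p).toReal + t * (energy H f C p').toReal := by
  have h1 := energy_convex hH hf hc p p' hs ht hst
  have h2 : ENNReal.ofReal s * energy H f C p ≠ ⊤ := ENNReal.mul_ne_top ENNReal.ofReal_ne_top hp
  have h3 : ENNReal.ofReal t * energy H f C p' ≠ ⊤ := ENNReal.mul_ne_top ENNReal.ofReal_ne_top hp'
  have h4 := ENNReal.add_ne_top.2 ⟨h2, h3⟩
  refine ⟨ne_top_of_le_ne_top h4 h1, ?_⟩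
  have h5 := ENNReal.toReal_mono h4 h1
  rwa [ENNReal.toReal_add h2 h3, ENNReal.toReal_mul, ENNReal.toReal_mul,
    ENNReal.toReal_ofReal hs.le, ENNReal.toReal_ofReal ht.le] at h5

theorem convex_sublevel (hH : IsHamiltonian r H) (hf : IsCoupling q f)
    (hc : IsCoercive H f q ς K C) {S : Set (PairSpace d T)} (hS : Convex ℝ S)
    {A : PairSpace d T → ℝ} (hA : ConvexOn ℝ S A) (c : ℝ) :
    Convex ℝ (sublevel H f C S A c) := by
  refine convex_iff_forall_pos.2 fun p hp p' hp' s t hs ht hst => ?_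
  have h1 := energy_combination hH hf hc hp.2.1 hp'.2.1 hs ht hst
  have h2 := hA.2 hp.1 hp'.1 hs.le ht.le hst
  refine ⟨hS hp.1 hp'.1 hs.le ht.le hst, h1.1, ?_⟩
  have h3 := mul_le_mul_of_nonneg_left hp.2.2 hs.le
  have h4 := mul_le_mul_of_nonneg_left hp'.2.2 ht.le
  have h5 : s * c + t * c = c := by rw [← add_mul, hst, one_mul]
  simp only [smul_eq_mul] at h2
  linarith [h1.2]

/-- The set is a preimage of the closed epigraph of the energy under p ↦ (p, c - A p), which is
continuous on `S`. -/
theorem isClosed_sublevel (hH : IsHamiltonian r H) (hf : IsCoupling q f)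
    (hc : IsCoercive H f q ς K C) {S : Set (PairSpace d T)} (hS : IsClosed S)
    {A : PairSpace d T → ℝ} (hA : ContinuousOn A S) (c : ℝ) :
    IsClosed (sublevel H f C S A c) := by
  have h1 : ContinuousOn (fun p => (p, ENNReal.ofReal (c - A p))) S :=
    continuousOn_id.prodMk
      (ENNReal.continuous_ofReal.comp_continuousOn (continuousOn_const.sub hA))
  have h2 := (hA.preimage_isClosed_of_isClosed hS (isClosed_Iic (a := c))).inter
    (h1.preimage_isClosed_of_isClosed hS (lowerSemicontinuous_energy hH hf hc).isClosed_epigraph)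
  convert h2 using 1
  ext p
  rw [mem_sublevel_iff]
  simp only [mem_inter_iff, mem_preimage, mem_Iic, mem_ofPred_eq]
  tauto

/-- The term `A` may be negative, but by at most half the energy plus a constant. Hence the energy
is at most 2(M+D) on all the sets, and coercivity turns this into L^q and L^ς bounds. -/
theorem nonempty_iInter_sublevel (hH : IsHamiltonian r H) (hf : IsCoupling q f)
    (hc : IsCoercive H f q ς K C) {ι : Type*} [Nonempty ι] {S : ι → Set (PairSpace d T)}
    (hScl : ∀ i, IsClosed (S i)) (hScv : ∀ i, Convex ℝ (S i)) {A : PairSpace d T → ℝ}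
    (hAct : ∀ i, ContinuousOn A (S i)) (hAcv : ∀ i, ConvexOn ℝ (S i) A) {D : ℝ}
    (hA : ∀ i, ∀ p ∈ S i, energy H f C p ≠ ⊤ → -(1 / 2 * (energy H f C p).toReal) - D ≤ A p)
    {c : ι → ℝ} {M : ℝ} (hcM : ∀ i, c i ≤ M)
    (hne : ∀ i, (sublevel H f C (S i) A (c i)).Nonempty)
    (hdir : Directed (· ⊇ ·) fun i => sublevel H f C (S i) A (c i)) :
    (⋂ i, sublevel H f C (S i) A (c i)).Nonempty := by
  refine nonempty_iInter_of_bounded (M := ENNReal.ofReal (K * (2 * (M + D)))) _ hdir hne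
    (fun i => isClosed_sublevel hH hf hc (hScl i) (hAct i) _)
    (fun i => convex_sublevel hH hf hc (hScv i) (hAcv i) _)
    hc.one_lt_left hc.one_lt_right ENNReal.ofReal_ne_top fun i p hp => ?_
  have h1 := hA i p hp.1 hp.2.1
  have h2 : (energy H f C p).toReal ≤ 2 * (M + D) := by linarith [hp.2.2, hcM i]
  have h3 : ENNReal.ofReal K * energy H f C p ≤ ENNReal.ofReal (K * (2 * (M + D))) := by
    rw [ENNReal.ofReal_mul hc.pos.le]
    gcongr
    rw [← ENNReal.ofReal_toReal hp.2.1]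
    exact ENNReal.ofReal_le_ofReal h2
  have h4 := (hc.lintegral_le p).trans h3
  constructor
  · refine (lintegral_mono fun z => ENNReal.ofReal_le_ofReal ?_).trans h4
    rw [Real.norm_eq_abs]
    exact le_add_of_nonneg_right (by positivity)
  · exact (lintegral_mono fun z => ENNReal.ofReal_le_ofReal
      (le_add_of_nonneg_left (by positivity))).trans h4

end Sublevel

/-! ### Existence, uniqueness and integrability of the minimizer. -/

section Existence

variable {d : ℕ} {q r ς K C T : ℝ} {f : Torus d → ℝ → ℝ} {H : Torus d → E d → ℝ}
  {m₀ : Torus d → ℝ}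

/-- The tangent at m₀(x), evaluated at 1 where the primitive vanishes, gives F(x,m₀) ≤
f(x,m₀)(m₀-1). This is continuous in x because m₀ > 0, hence bounded on the torus; the kinetic part
at zero flux is at most C m₀. -/
theorem exists_runningCost_le (hH : IsHamiltonian r H) (hf : IsCoupling q f)
    (hm₀ : Continuous m₀) (hpos : ∀ x, 0 < m₀ x) :
    ∃ a : ℝ, ∀ x, runningCost H f x (m₀ x) 0 ≤ a := by
  obtain ⟨C, hC, hg⟩ := hH.growth
  have h1 : Continuous fun x => m₀ x * C + f x (m₀ x) * (m₀ x - 1) := by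
    have h2 : Continuous fun x => f x (m₀ x) :=
      hf.cont.comp_continuous (f := fun x => (x, m₀ x)) (by fun_prop) fun x => ⟨trivial, hpos x⟩
    exact (hm₀.mul continuous_const).add (h2.mul (hm₀.sub continuous_const))
  obtain ⟨a, ha⟩ := (isCompact_range h1).bddAbove
  refine ⟨a, fun x => (runningCost_le_iff hH hf x _ _ _).2 ⟨(hpos x).le, fun p s hs => ?_⟩⟩
  refine le_trans ?_ (ha ⟨x, rfl⟩)
  have h2 := hf.tangent_le x hs (hpos x)
  have h3 := hf.tangent_le x (hpos x) one_pos
  rw [primitive_one, tangent] at h3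
  have h4 : -C ≤ H x p := by
    refine le_trans ?_ (hg x p).1
    have : 0 ≤ 1 / (r * C) * ‖p‖ ^ r := by
      have := hH.one_lt; positivity
    linarith
  simp only [minorant, inner_zero_right]
  nlinarith [hpos x, mul_le_mul_of_nonneg_left h4 (hpos x).le]

theorem energy_stationary_ne_top (hH : IsHamiltonian r H) (hf : IsCoupling q f)
    (hc : IsCoercive H f q ς K C) (hm₀ : Continuous m₀) (hpos : ∀ x, 0 < m₀ x) :
    energy H f C (stationary T hm₀) ≠ ⊤ := by
  obtain ⟨a, ha⟩ := exists_runningCost_le hH hf hm₀ hpos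
  refine ne_top_of_le_ne_top (b := ∫⁻ _, ENNReal.ofReal (max (a + C) 0) ∂(vol d T)) ?_
    (lintegral_mono_ae ?_)
  · rw [lintegral_const]
    exact ENNReal.mul_ne_top ENNReal.ofReal_ne_top (measure_ne_top _ _)
  · filter_upwards [stationary_ae (T := T) hm₀] with z hz
    rw [hz.1, hz.2, hc.shiftedCost_le_iff (le_max_right _ _)]
    refine (ha z.2).trans (EReal.coe_le_coe_iff.2 ?_)
    linarith [le_max_left (a + C) 0]

theorem B_eq (hH : IsHamiltonian r H) (hf : IsCoupling q f) (hc : IsCoercive H f q ς K C)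
    (φT : Torus d → ℝ) {p : PairSpace d T} (hp : energy H f C p ≠ ⊤) :
    B T H f φT p = (((energy H f C p).toReal + terminalCost φT p -
      C * (vol d T).real univ : ℝ) : EReal) := by
  have h : (energy H f C p : EReal) = (((energy H f C p).toReal : ℝ) : EReal) := by
    obtain ⟨e, he⟩ := WithTop.ne_top_iff_exists.1 hp
    rw [← he]
    rfl
  rw [B, eintegral_eq hH hf hc, h, ← EReal.coe_sub]
  change ((terminalCost φT p : ℝ) : EReal) + _ = _
  rw [← EReal.coe_add, EReal.coe_eq_coe_iff]
  ring

theorem B_eq_top (hH : IsHamiltonian r H) (hf : IsCoupling q f) (hc : IsCoercive H f q ς K C)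
    (φT : Torus d → ℝ) {p : PairSpace d T} (hp : energy H f C p = ⊤) : B T H f φT p = ⊤ := by
  rw [B, eintegral_eq hH hf hc, hp]
  rfl

theorem isMinOn_B_iff (hH : IsHamiltonian r H) (hf : IsCoupling q f)
    (hc : IsCoercive H f q ς K C) {φT : Torus d → ℝ} {S : Set (PairSpace d T)}
    (hS : ∃ p ∈ S, energy H f C p ≠ ⊤) {p : PairSpace d T} :
    IsMinOn (B T H f φT) S p ↔ energy H f C p ≠ ⊤ ∧ ∀ p' ∈ S, energy H f C p' ≠ ⊤ →
      (energy H f C p).toReal + terminalCost φT p ≤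
        (energy H f C p').toReal + terminalCost φT p' := by
  have hcmp : ∀ p p' : PairSpace d T, energy H f C p ≠ ⊤ → energy H f C p' ≠ ⊤ →
      (B T H f φT p ≤ B T H f φT p' ↔ (energy H f C p).toReal + terminalCost φT p ≤
        (energy H f C p').toReal + terminalCost φT p') := by
    intro p p' h1 h2
    rw [B_eq hH hf hc _ h1, B_eq hH hf hc _ h2, EReal.coe_le_coe_iff, sub_le_sub_iff_right]
  rw [isMinOn_iff]
  constructor
  · intro h
    have h1 : energy H f C p ≠ ⊤ := by
      intro h2
      obtain ⟨p', h3, h4⟩ := hS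
      have h5 := h p' h3
      rw [B_eq_top hH hf hc _ h2, B_eq hH hf hc _ h4, top_le_iff] at h5
      exact EReal.coe_ne_top _ h5
    exact ⟨h1, fun p' h2 h3 => (hcmp _ _ h1 h3).1 (h p' h2)⟩
  · rintro ⟨h1, h2⟩ p' h3
    by_cases h4 : energy H f C p' = ⊤
    · rw [B_eq_top hH hf hc _ h4]; exact le_top
    · exact (hcmp _ _ h1 h4).2 (h2 p' h3 h4)

theorem convexOn_terminalCost (hT : 0 < T) (hm₀ : Continuous m₀) (hmass : ∫ x, m₀ x = 1)
    {φT : Torus d → ℝ} (hφT : Continuous φT) :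
    ConvexOn ℝ (K1 T m₀) (terminalCost (T := T) φT) :=
  convexOn_iff_forall_pos.2 ⟨convex_K1 hT hmass, fun _ hp _ hp' _ _ hs ht hst =>
    (terminalCost_affine hT hm₀ hmass hφT hp hp' hs ht hst).le⟩

/-- Direct method: a minimizer is a common point of the sublevel sets at heights `c + 1/(n+1)` above
the infimum `c`. -/
theorem exists_isMinOn_B (hH : IsHamiltonian r H) (hf : IsCoupling q f)
    (hc : IsCoercive H f q ς K C) (hT : 0 < T) (hm₀ : Continuous m₀) (hpos : ∀ x, 0 < m₀ x)
    (hmass : ∫ x, m₀ x = 1) {φT : Torus d → ℝ} (hφT : Continuous φT) :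
    ∃ p ∈ K1 T m₀, IsMinOn (B T H f φT) (K1 T m₀) p := by
  obtain ⟨M, hM⟩ := (isCompact_range (hφT.abs)).bddAbove
  replace hM : ∀ x, |φT x| ≤ M := fun x => hM ⟨x, rfl⟩
  set J : PairSpace d T → ℝ := fun p => (energy H f C p).toReal + terminalCost φT p with hJ
  set D : Set (PairSpace d T) := {p | p ∈ K1 T m₀ ∧ energy H f C p ≠ ⊤} with hD
  have hst : stationary T hm₀ ∈ D :=
    ⟨stationary_mem_K1 hT hm₀ hpos hmass, energy_stationary_ne_top hH hf hc hm₀ hpos⟩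
  have hbdd : BddBelow (J '' D) := by
    refine ⟨-M, ?_⟩
    rintro _ ⟨p, hp, rfl⟩
    have h1 := (abs_le.1 (abs_terminalCost_le hT hM hp.1)).1
    have h2 : 0 ≤ (energy H f C p).toReal := ENNReal.toReal_nonneg
    simp only [hJ]; linarith
  set c := sInf (J '' D) with hcdef
  have hsub : ∀ n : ℕ, ∃ p ∈ D, J p < c + 1 / ((n : ℝ) + 1) := fun n => by
    obtain ⟨_, ⟨p, hp, rfl⟩, h⟩ := exists_lt_of_csInf_lt (s := J '' D) ⟨_, _, hst, rfl⟩
      (lt_add_of_pos_right c (Nat.one_div_pos_of_nat (n := n)))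
    exact ⟨p, hp, h⟩
  obtain ⟨p, hp⟩ := nonempty_iInter_sublevel hH hf hc (ι := ℕ) (S := fun _ => K1 T m₀)
    (fun _ => isClosed_K1 hT hmass) (fun _ => convex_K1 hT hmass)
    (fun _ => continuousOn_terminalCost hT hm₀ hφT)
    (fun _ => convexOn_terminalCost hT hm₀ hmass hφT) (D := M)
    (fun _ p hp _ => by
      have h1 := (abs_le.1 (abs_terminalCost_le hT hM hp)).1
      have h2 : 0 ≤ (energy H f C p).toReal := ENNReal.toReal_nonneg
      linarith)
    (c := fun n => c + 1 / ((n : ℝ) + 1)) (M := c + 1)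
    (fun n => by
      gcongr
      exact (div_le_one (by positivity)).2 (by linarith [(Nat.cast_nonneg n : (0 : ℝ) ≤ n)]))
    (fun n => by
      obtain ⟨p, hp, h⟩ := hsub n
      exact ⟨p, hp.1, hp.2, h.le⟩)
    (directed_of_isDirected_le fun i j hij p hp => ⟨hp.1, hp.2.1, hp.2.2.trans (by gcongr)⟩)
  rw [mem_iInter] at hp
  refine ⟨p, (hp 0).1, (isMinOn_B_iff hH hf hc ⟨_, hst⟩).2 ⟨(hp 0).2.1, fun p' h1 h2 => ?_⟩⟩
  have h3 : J p ≤ c := by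
    have h4 : Tendsto (fun n : ℕ => c + 1 / ((n : ℝ) + 1)) atTop (𝓝 (c + 0)) :=
      tendsto_const_nhds.add tendsto_one_div_add_atTop_nhds_zero_nat
    rw [add_zero] at h4
    exact ge_of_tendsto' h4 fun n => (hp n).2.2
  exact h3.trans (csInf_le hbdd ⟨p', ⟨h1, h2⟩, rfl⟩)

/-- The terminal cost being affine, minimality makes the energy of the midpoint equal to the average
of the energies. The convexity inequality between the integrands is then an equality a.e., and
pointwise strict convexity concludes. -/
theorem eq_of_isMinOn_B (hH : IsHamiltonian r H) (hf : IsCoupling q f)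
    (hc : IsCoercive H f q ς K C) (hT : 0 < T) (hm₀ : Continuous m₀) (hpos : ∀ x, 0 < m₀ x)
    (hmass : ∫ x, m₀ x = 1) {φT : Torus d → ℝ} (hφT : Continuous φT) {p p' : PairSpace d T}
    (hp : p ∈ K1 T m₀) (hmin : IsMinOn (B T H f φT) (K1 T m₀) p)
    (hp' : p' ∈ K1 T m₀) (hmin' : IsMinOn (B T H f φT) (K1 T m₀) p') : p = p' := by
  have hst : ∃ p ∈ K1 T m₀, energy H f C p ≠ ⊤ :=
    ⟨_, stationary_mem_K1 hT hm₀ hpos hmass, energy_stationary_ne_top hH hf hc hm₀ hpos⟩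
  obtain ⟨he, hle⟩ := (isMinOn_B_iff hH hf hc hst).1 hmin
  obtain ⟨he', hle'⟩ := (isMinOn_B_iff hH hf hc hst).1 hmin'
  have hhalf : (0 : ℝ) < 1 / 2 := by norm_num
  have hK := convex_K1 hT hmass hp hp' hhalf.le hhalf.le (by norm_num)
  have hE := energy_combination hH hf hc he he' hhalf hhalf (by norm_num)
  have hτ := terminalCost_affine hT hm₀ hmass hφT hp hp' hhalf hhalf (by norm_num)
  have h1 := hle _ hK hE.1
  have h2 := hle' _ hK hE.1
  set e := fun p : PairSpace d T => fun z : ℝ × Torus d => shiftedCost H f C z.2 (p.1 z) (p.2 z)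
  set pm := (1 / 2 : ℝ) • p + (1 / 2 : ℝ) • p' with hpm
  have hconv : ∀ᵐ z ∂(vol d T), e pm z ≤
      ENNReal.ofReal (1 / 2) * e p z + ENNReal.ofReal (1 / 2) * e p' z := by
    filter_upwards [ae_combination p p' (1 / 2) (1 / 2)] with z hz
    simp only [e, hpm]
    rw [hz.1, hz.2]
    exact shiftedCost_convex hH hf hc _ _ _ _ _ hhalf hhalf (by norm_num)
  have hsum : ∫⁻ z, (ENNReal.ofReal (1 / 2) * e p z + ENNReal.ofReal (1 / 2) * e p' z) ∂(vol d T) ≤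
      energy H f C pm := by
    rw [lintegral_add_left ((measurable_energy_integrand hH hf hc p).const_mul _),
      lintegral_const_mul' _ _ ENNReal.ofReal_ne_top, lintegral_const_mul' _ _ ENNReal.ofReal_ne_top]
    change ENNReal.ofReal (1 / 2) * energy H f C p + ENNReal.ofReal (1 / 2) * energy H f C p' ≤ _
    rw [← ENNReal.ofReal_toReal he, ← ENNReal.ofReal_toReal he', ← ENNReal.ofReal_toReal hE.1,
      ← ENNReal.ofReal_mul hhalf.le, ← ENNReal.ofReal_mul hhalf.le,
      ← ENNReal.ofReal_add (by positivity) (by positivity)]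
    exact ENNReal.ofReal_le_ofReal (by linarith)
  have heq := ae_eq_of_ae_le_of_lintegral_le hconv hE.1
    (((measurable_energy_integrand hH hf hc p).const_mul _).add
      ((measurable_energy_integrand hH hf hc p').const_mul _)).aemeasurable hsum
  have hfin := ae_lt_top (measurable_energy_integrand hH hf hc p) he
  have hfin' := ae_lt_top (measurable_energy_integrand hH hf hc p') he'
  have hall : ∀ᵐ z ∂(vol d T), p.1 z = p'.1 z ∧ p.2 z = p'.2 z := by
    filter_upwards [heq, hfin, hfin', ae_combination p p' (1 / 2) (1 / 2)] with z h3 h4 h5 h6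
    refine shiftedCost_strict hH hf hc h4.ne h5.ne ?_
    rw [← h6.1, ← h6.2]
    exact h3.ge
  exact Prod.ext (Lp.ext (hall.mono fun z h => h.1)) (Lp.ext (hall.mono fun z h => h.2))

theorem memLp_of_energy_ne_top (hc : IsCoercive H f q ς K C) {p : PairSpace d T}
    (hp : energy H f C p ≠ ⊤) :
    MemLp p.1 (ENNReal.ofReal q) (vol d T) ∧ MemLp p.2 (ENNReal.ofReal ς) (vol d T) := by
  have h1 := ne_top_of_le_ne_top (ENNReal.mul_ne_top ENNReal.ofReal_ne_top hp) (hc.lintegral_le p)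
  have key : ∀ {V : Type} [NormedAddCommGroup V] (u : ℝ × Torus d → V) {a : ℝ}, 0 < a →
      AEStronglyMeasurable u (vol d T) → (∀ z, ‖u z‖ ^ a ≤ |p.1 z| ^ q + ‖p.2 z‖ ^ ς) →
      MemLp u (ENNReal.ofReal a) (vol d T) := by
    intro V _ u a ha hu hle
    refine ⟨hu, ?_⟩
    rw [eLpNorm_lt_top_iff_lintegral_rpow_enorm_lt_top (by simpa using ha) ENNReal.ofReal_ne_top,
      ENNReal.toReal_ofReal ha.le]
    refine lt_of_le_of_lt (lintegral_mono fun z => ?_) h1.lt_top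
    rw [← ofReal_norm, ENNReal.ofReal_rpow_of_nonneg (norm_nonneg _) ha.le]
    exact ENNReal.ofReal_le_ofReal (hle z)
  have hq := hc.one_lt_left
  have hς := hc.one_lt_right
  exact ⟨key _ (by linarith) (Lp.aestronglyMeasurable _) fun z =>
      le_add_of_nonneg_right (by positivity),
    key _ (by linarith) (Lp.aestronglyMeasurable _) fun z => le_add_of_nonneg_left (by positivity)⟩

end Existence

/-! ### Integrals with values in the extended reals -/

section EIntegral

variable {α : Type*} [MeasurableSpace α] {μ : Measure α}

theorem eintegral_mono_ae {g g' : α → EReal} (h : ∀ᵐ z ∂μ, g z ≤ g' z) :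
    eintegral μ g ≤ eintegral μ g' := by
  refine EReal.sub_le_sub (EReal.coe_ennreal_le_coe_ennreal_iff.2 (lintegral_mono_ae ?_))
    (EReal.coe_ennreal_le_coe_ennreal_iff.2 (lintegral_mono_ae ?_))
  · exact h.mono fun z hz => EReal.toENNReal_le_toENNReal hz
  · exact h.mono fun z hz => EReal.toENNReal_le_toENNReal (EReal.neg_le_neg_iff.2 hz)

theorem eintegral_coe {h : α → ℝ} (hh : Integrable h μ) :
    eintegral μ (fun z => (h z : EReal)) = ((∫ z, h z ∂μ : ℝ) : EReal) := by
  unfold eintegral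
  simp only [← EReal.coe_neg, EReal.real_coe_toENNReal]
  rw [integral_eq_lintegral_pos_part_sub_lintegral_neg_part hh, EReal.coe_sub]
  have h1 : ∀ y : ENNReal, y ≠ ⊤ → (y : EReal) = ((y.toReal : ℝ) : EReal) := fun y hy => by
    lift y to NNReal using hy
    rfl
  rw [h1 _ hh.lintegral_lt_top.ne, h1 _ (Integrable.lintegral_lt_top (f := fun a => -h a) hh.neg).ne]

end EIntegral

/-! ### Fenchel's inequality and weak duality. -/

section Duality

variable {d : ℕ} {q r ς K C T : ℝ} {f : Torus d → ℝ → ℝ} {H : Torus d → E d → ℝ}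
  {m₀ : Torus d → ℝ}

theorem le_Fstar (f : Torus d → ℝ → ℝ) (x : Torus d) (a m : ℝ) :
    ((a * m : ℝ) : EReal) - F f x m ≤ Fstar f x a := by
  refine le_trans (le_of_eq ?_) (le_iSup _ m)
  simp [mul_comm]

/-- With F replaced by its tangent at s, the supremum over m ≥ 0 is attained at m = 0 because a ≤
f(x,s). The hypothesis on (f(x,s)-a)s measures how far s is from being optimal. -/
theorem IsCoupling.Fstar_le (hf : IsCoupling q f) {x : Torus d} {a s ε : ℝ} (hs : 0 < s)
    (h1 : a ≤ f x s) (h2 : (f x s - a) * s ≤ ε) :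
    Fstar f x a ≤ ((a * s - primitive f x s + ε : ℝ) : EReal) := by
  refine iSup_le fun m => ?_
  have hin : inner ℝ a m = a * m := by simp [mul_comm]
  rw [hin]
  rcases lt_or_ge m 0 with hm | hm
  · rw [F_of_neg f x hm, EReal.sub_top]
    exact bot_le
  · refine (EReal.sub_le_sub le_rfl (hf.tangent_le_F x m hs)).trans ?_
    rw [← EReal.coe_sub, EReal.coe_le_coe_iff, tangent]
    nlinarith [mul_nonneg (sub_nonneg.2 h1) hm]

/-- A measurable choice of near-maximizers in the definition of `F^*`. -/
theorem IsCoupling.exists_selection (hf : IsCoupling q f) {a : ℝ × Torus d → ℝ}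
    (ha : Measurable a) {M : ℝ} (hM : ∀ z, |a z| ≤ M) {ε : ℝ} (hε : 0 < ε) :
    ∃ s : ℝ × Torus d → ℝ, Measurable s ∧ (∃ R, ∀ z, s z ≤ R) ∧
      ∀ z, 0 < s z ∧ a z ≤ f z.2 (s z) ∧ (f z.2 (s z) - a z) * s z ≤ ε := by
  obtain ⟨N, hN⟩ := (isCompact_range (hf.continuous_apply one_pos).abs).bddAbove
  replace hN : ∀ x, |f x 1| ≤ N := fun x => hN ⟨x, rfl⟩
  have hN0 : 0 ≤ N := (abs_nonneg _).trans (hN 0)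
  have hM0 : 0 ≤ M := (abs_nonneg _).trans (hM 0)
  -- If f(x,·) is bounded below near 0 and a lies under its range, no exact maximizer s > 0 exists.
  -- The floor δ then serves, with (f(x,δ)-a)δ ≤ (N+M+1)δ ≤ ε.
  set δ := min 1 (ε / (N + M + 1)) with hδ
  have hδ0 : 0 < δ := lt_min one_pos (by positivity)
  have hδ1 : δ ≤ 1 := min_le_left _ _
  have hδN : ∀ x, f x δ ≤ N := fun x =>
    ((hf.mono x).monotoneOn hδ0 (mem_Ioi.2 one_pos) hδ1).trans ((le_abs_self _).trans (hN x))
  obtain ⟨R, hR1, hR⟩ : ∃ R, 1 ≤ R ∧ ∀ x, max M N ≤ f x R := by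
    obtain ⟨c, hc, hg⟩ := hf.growth
    have h1 := (tendsto_rpow_atTop (sub_pos.2 hf.one_lt)).eventually_ge_atTop (c * (max M N + c))
    obtain ⟨R, h2, h3⟩ := (h1.and (eventually_ge_atTop 1)).exists
    refine ⟨R, h3, fun x => le_trans ?_ (hg x R h3).1⟩
    rw [le_sub_iff_add_le, one_div, inv_mul_eq_div, le_div_iff₀' hc]
    exact h2
  have hex : ∀ z : ℝ × Torus d, ∃ s ∈ Icc δ R, f z.2 s = max (a z) (f z.2 δ) := by
    intro z
    have h1 : ContinuousOn (f z.2) (Icc δ R) :=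
      (hf.continuousOn z.2).mono fun s hs => hδ0.trans_le hs.1
    exact intermediate_value_Icc (hδ1.trans hR1) h1 ⟨le_max_right _ _,
      max_le (((le_abs_self _).trans (hM z)).trans ((le_max_left _ _).trans (hR _)))
        ((hδN _).trans ((le_max_right _ _).trans (hR _)))⟩
  choose s hs hfs using hex
  refine ⟨s, measurable_of_Iic fun c => ?_, ⟨R, fun z => (hs z).2⟩, fun z => ?_⟩
  · rcases lt_or_ge c δ with hc | hc
    · convert MeasurableSet.empty
      ext z
      simpa using hc.trans_le (hs z).1
    -- By strict monotonicity, s ≤ c exactly when the prescribed value of f is at most f(x,c), a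
    -- comparison of two measurable functions.
    · have h1 : s ⁻¹' Iic c = {z | max (a z) (f z.2 δ) ≤ f z.2 c} := by
        ext z
        simp only [mem_preimage, mem_Iic, mem_ofPred_eq]
        rw [← hfs z]
        exact ((hf.mono z.2).le_iff_le (hδ0.trans_le (hs z).1) (hδ0.trans_le hc)).symm
      rw [h1]
      exact measurableSet_le (ha.max ((hf.continuous_apply hδ0).measurable.comp measurable_snd))
        ((hf.continuous_apply (hδ0.trans_le hc)).measurable.comp measurable_snd)
  · have h1 : 0 < s z := hδ0.trans_le (hs z).1
    refine ⟨h1, (le_max_left _ _).trans_eq (hfs z).symm, ?_⟩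
    rcases le_total (f z.2 δ) (a z) with h | h
    · rw [hfs z, max_eq_left h, sub_self, zero_mul]
      exact hε.le
    · have h2 : s z = δ := ((hf.mono z.2).injOn h1 hδ0 ((hfs z).trans (max_eq_right h)))
      rw [h2]
      have h3 := (abs_le.1 (hM z)).1
      have h4 : f z.2 δ - a z ≤ N + M + 1 := by linarith [hδN z.2]
      calc (f z.2 δ - a z) * δ ≤ (N + M + 1) * (ε / (N + M + 1)) :=
            mul_le_mul h4 (min_le_right _ _) hδ0.le (by positivity)
        _ = ε := by field_simp

theorem exists_cost (hH : IsHamiltonian r H) (hf : IsCoupling q f)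
    (hc : IsCoercive H f q ς K C) {p : PairSpace d T} (hp : energy H f C p ≠ ⊤) :
    ∃ ρ : ℝ × Torus d → ℝ, Integrable ρ (vol d T) ∧
      ∫ z, ρ z ∂(vol d T) = (energy H f C p).toReal - C * (vol d T).real univ ∧
      ∀ᵐ z ∂(vol d T), runningCost H f z.2 (p.1 z) (p.2 z) = ρ z := by
  have hmeas := measurable_energy_integrand hH hf hc p
  have h1 := integrable_toReal_of_lintegral_ne_top hmeas.aemeasurable hp
  refine ⟨fun z => (shiftedCost H f C z.2 (p.1 z) (p.2 z)).toReal - C,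
    h1.sub (integrable_const C), ?_, ?_⟩
  · rw [integral_sub h1 (integrable_const C), integral_const,
      integral_toReal hmeas.aemeasurable (ae_lt_top hmeas hp), smul_eq_mul, mul_comm]
    rfl
  · filter_upwards [ae_lt_top hmeas hp] with z hz
    have h2 := hc.coe_shiftedCost z.2 (p.1 z) (p.2 z)
    lift shiftedCost H f C z.2 (p.1 z) (p.2 z) to NNReal using hz.ne with e
    change ((e : ℝ) : EReal) = _ at h2
    rw [EReal.coe_sub, ENNReal.coe_toReal, h2, EReal.add_sub_cancel_right]

/-- Fenchel's inequalities F^*(a) ≥ am - F(m) and mL(x,w/m) ≥ -⟨Dφ,w⟩ - mH(x,Dφ), with a = -∂_tφ +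
H(x,Dφ), bound F^*(a) below by -(m∂_tφ + ⟨Dφ,w⟩) minus the cost. `weak_identity` evaluates the
integral of this bound. -/
theorem neg_B_le_A (hH : IsHamiltonian r H) (hf : IsCoupling q f) (hc : IsCoercive H f q ς K C)
    (hT : 0 < T) (hm₀ : Continuous m₀) {φT : Torus d → ℝ} {φ : ℝ → Torus d → ℝ}
    (hφ : φ ∈ K0 T φT) {p : PairSpace d T} (hp : p ∈ K1 T m₀) :
    -B T H f φT p ≤ A T H f m₀ φ := by
  by_cases he : energy H f C p = ⊤
  · rw [B_eq_top hH hf hc _ he, EReal.neg_top]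
    exact bot_le
  obtain ⟨ρ, hρ, hρint, hρeq⟩ := exists_cost hH hf hc he
  have hid := weak_identity hT (integrable_fst p) (integrable_snd p) hm₀ hp.1 hp.2.1 hp.2.2 hφ.1
  have hterm : ∫ x, φ T x ∂(slice T p.1 T) = terminalCost φT p := by
    simp only [hφ.2]; rfl
  have hint : Integrable (fun z => derivWithin (fun s => φ s z.2) (Icc 0 T) z.1 * p.1 z +
      inner ℝ (spaceGrad (φ z.1) z.2) (p.2 z)) (vol d T) := by
    have ha := continuousOn_derivWithin_time (uniqueDiffOn_Icc hT) hφ.1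
    have hb := continuousOn_spaceGrad (uniqueDiffOn_Icc hT) hφ.1
    obtain ⟨R, -, hR⟩ := exists_bound_strip ha
    obtain ⟨R', -, hR'⟩ := exists_bound_strip hb
    exact integrable_pairing (integrable_fst p) (integrable_snd p)
      (continuousOn_aestronglyMeasurable_vol ha) (continuousOn_aestronglyMeasurable_vol hb)
      (C := max R R') fun t ht x =>
        ⟨(hR t (Ioo_subset_Icc_self ht) x).trans (le_max_left _ _),
          (hR' t (Ioo_subset_Icc_self ht) x).trans (le_max_right _ _)⟩
  have h1 : Integrable (fun z => -((derivWithin (fun s => φ s z.2) (Icc 0 T) z.1 * p.1 z +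
      inner ℝ (spaceGrad (φ z.1) z.2) (p.2 z)) + ρ z)) (vol d T) := (hint.add hρ).neg
  have h2 := eintegral_mono_ae (μ := vol d T)
    (g := fun z => ((-((derivWithin (fun s => φ s z.2) (Icc 0 T) z.1 * p.1 z +
      inner ℝ (spaceGrad (φ z.1) z.2) (p.2 z)) + ρ z) : ℝ) : EReal))
    (g' := fun z => Fstar f z.2 (-(derivWithin (fun s => φ s z.2) (Icc 0 T) z.1)
        + H z.2 (spaceGrad (φ z.1) z.2))) ?_
  · rw [B_eq hH hf hc _ he, A, ← EReal.coe_neg]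
    refine le_trans (le_of_eq ?_) (EReal.sub_le_sub h2 le_rfl)
    rw [eintegral_coe h1, integral_neg, integral_add hint hρ, hid, hρint, hterm, ← EReal.coe_sub,
      EReal.coe_eq_coe_iff]
    ring
  · filter_upwards [hρeq, hp.1] with z hz hpos
    refine le_trans ?_ (le_Fstar f z.2 _ (p.1 z))
    have h4 := hH.le_kinetic z.2 hpos (p.2 z) (spaceGrad (φ z.1) z.2)
    unfold runningCost at hz
    have hF := hf.tangent_le_F z.2 (p.1 z) one_pos
    generalize kinetic H z.2 (p.1 z) (p.2 z) = k at hz h4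
    generalize F f z.2 (p.1 z) = l at hz hF
    have hk : k ≠ ⊥ := ne_bot_of_le_ne_bot (EReal.coe_ne_bot _) h4
    have hl : l ≠ ⊥ := ne_bot_of_le_ne_bot (EReal.coe_ne_bot _) hF
    have hk' : k ≠ ⊤ := by
      rintro rfl
      rw [EReal.top_add_of_ne_bot hl] at hz
      exact EReal.coe_ne_top _ hz.symm
    have hl' : l ≠ ⊤ := by
      rintro rfl
      rw [EReal.add_top_of_ne_bot hk] at hz
      exact EReal.coe_ne_top _ hz.symm
    lift k to ℝ using ⟨hk', hk⟩
    lift l to ℝ using ⟨hl', hl⟩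
    rw [← EReal.coe_add, EReal.coe_eq_coe_iff] at hz
    rw [EReal.coe_le_coe_iff] at h4
    rw [← EReal.coe_sub, EReal.coe_le_coe_iff]
    linarith

end Duality

/-! ### Lagrange multipliers for finitely many affine constraints -/

/-- Separation of an open box under height c from the convex set of pairs (constraint value, height
above G). The lower bound on G is assumed for constraints violated by less than δ, which makes the
box open and the multiplier of G nonzero. -/
theorem exists_multiplier {X : Type*} [AddCommGroup X] [Module ℝ X] {ι : Type*} [Fintype ι]
    {D : Set X} {G : X → ℝ} (hG : ConvexOn ℝ D G) (Λ : ι → X →ₗ[ℝ] ℝ) (b : ι → ℝ)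
    (hfeas : ∃ x ∈ D, ∀ i, Λ i x + b i = 0) {δ c : ℝ} (hδ : 0 < δ)
    (h : ∀ x ∈ D, (∀ i, |Λ i x + b i| < δ) → c ≤ G x) :
    ∃ l : ι → ℝ, ∀ x ∈ D, c ≤ G x + ∑ i, l i * (Λ i x + b i) := by
  classical
  set U : Set ((ι → ℝ) × ℝ) := Metric.ball 0 δ ×ˢ Iio c with hU
  set V : Set ((ι → ℝ) × ℝ) := {y | ∃ x ∈ D, (∀ i, y.1 i = Λ i x + b i) ∧ G x ≤ y.2} with hV
  have hUc : Convex ℝ U := (convex_ball 0 δ).prod (convex_Iio c)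
  have hUo : IsOpen U := Metric.isOpen_ball.prod isOpen_Iio
  have hVc : Convex ℝ V := by
    rintro y ⟨x, hx, h1, h2⟩ y' ⟨x', hx', h1', h2'⟩ s t hs ht hst
    refine ⟨s • x + t • x', hG.1 hx hx' hs ht hst, fun i => ?_, ?_⟩
    · simp only [Prod.fst_add, Prod.smul_fst, Pi.add_apply, Pi.smul_apply, smul_eq_mul, map_add,
        map_smul, h1, h1']
      linear_combination (b i) * hst
    · refine (hG.2 hx hx' hs ht hst).trans ?_
      simp only [Prod.snd_add, Prod.smul_snd, smul_eq_mul]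
      gcongr
  have hdisj : Disjoint U V := by
    rw [Set.disjoint_left]
    rintro y ⟨hy1, hy2⟩ ⟨x, hx, h1, h2⟩
    refine absurd (h x hx fun i => ?_) (not_le.2 (h2.trans_lt hy2))
    rw [← h1 i, ← Real.norm_eq_abs]
    exact (norm_le_pi_norm y.1 i).trans_lt (mem_ball_zero_iff.1 hy1)
  obtain ⟨g, u, hgU, hgV⟩ := geometric_hahn_banach_open hUc hUo hVc hdisj
  set μ := g (0, 1) with hμ
  have hsplit : ∀ y s, g (y, s) = ∑ i, y i * g (Pi.single i 1, 0) + s * μ := by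
    intro y s
    have h1 : ((y, s) : (ι → ℝ) × ℝ) = (y, 0) + s • (0, 1) := by simp
    have h2 := ((g : (ι → ℝ) × ℝ →ₗ[ℝ] ℝ).comp (LinearMap.inl ℝ (ι → ℝ) ℝ)).pi_apply_eq_sum_univ y
    rw [h1, map_add, map_smul, smul_eq_mul]
    congr 1
    refine h2.trans (Finset.sum_congr rfl fun i _ => ?_)
    simp only [smul_eq_mul, LinearMap.comp_apply, LinearMap.inl_apply, ContinuousLinearMap.coe_coe]
    congr 3
    ext j
    simp [Pi.single_apply, eq_comm]
  have hlow : ∀ s < c, s * μ < u := fun s hs => by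
    have := hgU (0, s) ⟨Metric.mem_ball_self hδ, hs⟩
    rw [hsplit] at this
    simpa using this
  have hup : ∀ x ∈ D, u ≤ ∑ i, (Λ i x + b i) * g (Pi.single i 1, 0) + G x * μ := fun x hx => by
    rw [← hsplit (fun i => Λ i x + b i)]
    exact hgV _ ⟨x, hx, fun i => rfl, le_rfl⟩
  -- A feasible point puts (0, G x) in V, while the box reaches below it on the same vertical line;
  -- hence the separating functional cannot be horizontal.
  have hμ0 : 0 < μ := by
    obtain ⟨x, hx, h0⟩ := hfeas
    have h1 := hup x hx
    simp only [h0, zero_mul, Finset.sum_const_zero, zero_add] at h1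
    have h2 := hlow (min c (G x) - 1) (by linarith [min_le_left c (G x)])
    have h3 := min_le_right c (G x)
    by_contra h4
    nlinarith
  have hcu : c * μ ≤ u := by
    by_contra h1
    have h2 := hlow (u / μ) (by rw [div_lt_iff₀ hμ0]; linarith)
    rw [div_mul_cancel₀ _ hμ0.ne'] at h2
    exact lt_irrefl _ h2
  refine ⟨fun i => g (Pi.single i 1, 0) / μ, fun x hx => ?_⟩
  have h1 := hcu.trans (hup x hx)
  rw [← le_div_iff₀ hμ0, add_div, mul_div_cancel_right₀ _ hμ0.ne', Finset.sum_div, add_comm] at h1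
  refine h1.trans_eq ?_
  congr 1
  exact Finset.sum_congr rfl fun i _ => by ring

/-! ### Linear combinations of test functions -/

section Combination

variable {d : ℕ} {T : ℝ} {m₀ : Torus d → ℝ}

theorem spaceGrad_add_smul {ψ η : Torus d → ℝ} (hψ : SpaceContDiff 1 ψ) (hη : SpaceContDiff 1 η)
    (c : ℝ) (x : Torus d) :
    spaceGrad (fun y => ψ y + c * η y) x = spaceGrad ψ x + c • spaceGrad η x := by
  obtain ⟨v, rfl⟩ := isOpenQuotientMap_proj.surjective x
  rw [spaceGrad_proj, spaceGrad_proj, spaceGrad_proj]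
  have h1 := (ContDiff.differentiable hψ one_ne_zero) v
  have h2 := (ContDiff.differentiable hη one_ne_zero) v
  unfold gradient
  rw [fderiv_fun_add h1 (h2.const_mul c), fderiv_const_mul h2, map_add, map_smul]

theorem spaceContDiff_slice {n : WithTop ℕ∞} {φ : ℝ → Torus d → ℝ} (h : ContDiff ℝ n (lift φ))
    (t : ℝ) : SpaceContDiff n (φ t) :=
  h.comp (f := fun v : E d => (t, v)) (by fun_prop)

theorem isTest_zero (hT : 0 < T) : IsTest T (fun _ _ => 0 : ℝ → Torus d → ℝ) :=
  ⟨contDiff_const, 0, hT, fun _ _ _ => rfl⟩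

theorem IsTest.contDiff_one {φ : ℝ → Torus d → ℝ} (hφ : IsTest T φ) : ContDiff ℝ 1 (lift φ) :=
  hφ.1.of_le (by exact_mod_cast le_top)

theorem IsTest.add_smul {φ ψ : ℝ → Torus d → ℝ} (hφ : IsTest T φ) (hψ : IsTest T ψ) (c : ℝ) :
    IsTest T fun t x => φ t x + c * ψ t x := by
  obtain ⟨h1, τ, hτ, h2⟩ := hφ
  obtain ⟨h3, σ, hσ, h4⟩ := hψ
  refine ⟨h1.add (contDiff_const.mul h3), max τ σ, max_lt hτ hσ, fun t ht x => ?_⟩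
  simp only [h2 t ((le_max_left _ _).trans ht), h4 t ((le_max_right _ _).trans ht), mul_zero,
    add_zero]

theorem deriv_add_smul {φ ψ : ℝ → Torus d → ℝ} (hφ : ContDiff ℝ 1 (lift φ))
    (hψ : ContDiff ℝ 1 (lift ψ)) (c t : ℝ) (x : Torus d) :
    deriv (fun s => φ s x + c * ψ s x) t = deriv (fun s => φ s x) t + c * deriv (fun s => ψ s x) t :=
  ((hasDerivAt_time hφ t x).add ((hasDerivAt_time hψ t x).const_mul c)).deriv

theorem integrable_test {φ : ℝ → Torus d → ℝ} (hφ : ContDiff ℝ 1 (lift φ)) (p : PairSpace d T) :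
    Integrable (fun z => deriv (fun s => φ s z.2) z.1 * p.1 z +
      inner ℝ (spaceGrad (φ z.1) z.2) (p.2 z)) (vol d T) := by
  have ha := (continuous_deriv_time hφ).continuousOn (s := Icc 0 T ×ˢ univ)
  have hb := (continuous_spaceGrad hφ).continuousOn (s := Icc 0 T ×ˢ univ)
  obtain ⟨C, -, hC⟩ := exists_bound_strip ha
  obtain ⟨C', -, hC'⟩ := exists_bound_strip hb
  exact integrable_pairing (integrable_fst p) (integrable_snd p)
    (continuousOn_aestronglyMeasurable_vol ha) (continuousOn_aestronglyMeasurable_vol hb)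
    (C := max C C') fun t ht x =>
      ⟨(hC t (Ioo_subset_Icc_self ht) x).trans (le_max_left _ _),
        (hC' t (Ioo_subset_Icc_self ht) x).trans (le_max_right _ _)⟩

theorem integrable_of_continuous_torus {g : Torus d → ℝ} (hg : Continuous g) :
    Integrable g :=
  hg.integrable_of_hasCompactSupport (HasCompactSupport.of_compactSpace g)

theorem weakForm_add_smul (hm₀ : Continuous m₀) {φ ψ : ℝ → Torus d → ℝ}
    (hφ : ContDiff ℝ 1 (lift φ)) (hψ : ContDiff ℝ 1 (lift ψ)) (c : ℝ) (p : PairSpace d T) :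
    weakForm T m₀ p.1 p.2 (fun t x => φ t x + c * ψ t x) =
      weakForm T m₀ p.1 p.2 φ + c * weakForm T m₀ p.1 p.2 ψ := by
  have h0 : ∀ {φ : ℝ → Torus d → ℝ}, ContDiff ℝ 1 (lift φ) →
      Integrable fun x => φ 0 x * m₀ x := fun h =>
    integrable_of_continuous_torus ((spaceContDiff_slice h 0).continuous.mul hm₀)
  have h1 : ∫ z, (deriv (fun s => φ s z.2 + c * ψ s z.2) z.1 * p.1 z +
      inner ℝ (spaceGrad (fun x => φ z.1 x + c * ψ z.1 x) z.2) (p.2 z)) ∂(vol d T) =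
      ∫ z, (deriv (fun s => φ s z.2) z.1 * p.1 z +
        inner ℝ (spaceGrad (φ z.1) z.2) (p.2 z)) ∂(vol d T) +
      c * ∫ z, (deriv (fun s => ψ s z.2) z.1 * p.1 z +
        inner ℝ (spaceGrad (ψ z.1) z.2) (p.2 z)) ∂(vol d T) := by
    rw [← integral_const_mul, ← integral_add (integrable_test hφ p)
      ((integrable_test hψ p).const_mul c)]
    refine integral_congr_ae (Eventually.of_forall fun z => ?_)
    simp only
    rw [deriv_add_smul hφ hψ, spaceGrad_add_smul (spaceContDiff_slice hφ _)
      (spaceContDiff_slice hψ _), inner_add_left, real_inner_smul_left]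
    ring
  have h2 : ∫ x, (φ 0 x + c * ψ 0 x) * m₀ x = (∫ x, φ 0 x * m₀ x) + c * ∫ x, ψ 0 x * m₀ x := by
    rw [← integral_const_mul, ← integral_add (h0 hφ) ((h0 hψ).const_mul c)]
    refine integral_congr_ae (Eventually.of_forall fun x => ?_)
    simp only
    ring
  simp only [weakForm, h1, h2]
  ring

theorem exists_isTest_sum (hT : 0 < T) (hm₀ : Continuous m₀) {ι : Type*} (J : Finset ι)
    {φ : ι → ℝ → Torus d → ℝ} (hφ : ∀ i, IsTest T (φ i)) (l : ι → ℝ) :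
    ∃ ψ, IsTest T ψ ∧ ∀ p : PairSpace d T, weakForm T m₀ p.1 p.2 ψ =
      ∑ i ∈ J, l i * weakForm T m₀ p.1 p.2 (φ i) := by
  classical
  induction J using Finset.induction_on with
  | empty => exact ⟨_, isTest_zero hT, fun p => by simp [weakForm, spaceGrad_const]⟩
  | insert i J hi ih =>
    obtain ⟨ψ, hψ, h⟩ := ih
    refine ⟨_, hψ.add_smul (hφ i) (l i), fun p => ?_⟩
    rw [weakForm_add_smul hm₀ hψ.contDiff_one (hφ i).contDiff_one, h, Finset.sum_insert hi, add_comm]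

end Combination

/-! ### Absence of a duality gap. -/

section StrongDuality

variable {d : ℕ} {q r ς K C T : ℝ} {f : Torus d → ℝ → ℝ} {H : Torus d → E d → ℝ}
  {m₀ : Torus d → ℝ}

theorem nonneg_of_energy_ne_top (hH : IsHamiltonian r H) (hf : IsCoupling q f)
    (hc : IsCoercive H f q ς K C) {p : PairSpace d T} (hp : energy H f C p ≠ ⊤) : 0 ≤ p.1 := by
  obtain ⟨ρ, -, -, hρ⟩ := exists_cost hH hf hc hp
  rw [← Lp.coeFn_nonneg]
  filter_upwards [hρ] with z hz
  exact ((runningCost_le_iff hH hf _ _ _ _).1 hz.le).1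

/-- Young's inequality absorbs a term linear in w into half of the energy, so that adding φ_T to the
Lagrangian keeps it coercive. -/
theorem IsCoercive.abs_integral_inner_le (hc : IsCoercive H f q ς K C) {R : ℝ} (hR : 0 ≤ R) :
    ∃ D, ∀ b : ℝ × Torus d → E d, (∀ z, ‖b z‖ ≤ R) → ∀ p : PairSpace d T,
      energy H f C p ≠ ⊤ → |∫ z, inner ℝ (b z) (p.2 z) ∂(vol d T)| ≤
        1 / 2 * (energy H f C p).toReal + D := by
  have hK := hc.pos
  obtain ⟨K', hK', h1⟩ := exists_mul_le_rpow hc.one_lt_right hR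
    (e := 1 / (2 * K)) (by positivity)
  refine ⟨K' * (vol d T).real univ, fun b hb p hp => ?_⟩
  have h2 : ∫⁻ z, ENNReal.ofReal ‖inner ℝ (b z) (p.2 z)‖ ∂(vol d T) ≤
      ENNReal.ofReal (1 / 2) * energy H f C p + ENNReal.ofReal (K' * (vol d T).real univ) := by
    calc _ ≤ ∫⁻ z, (ENNReal.ofReal (1 / (2 * K)) *
          ENNReal.ofReal (|p.1 z| ^ q + ‖p.2 z‖ ^ ς) + ENNReal.ofReal K') ∂(vol d T) := by
          refine lintegral_mono fun z => ?_
          rw [← ENNReal.ofReal_mul (by positivity), ← ENNReal.ofReal_add (by positivity) hK']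
          refine ENNReal.ofReal_le_ofReal ((norm_inner_le_norm _ _).trans
            ((mul_le_mul_of_nonneg_right (hb z) (norm_nonneg _)).trans
              ((h1 _ (norm_nonneg _)).trans ?_)))
          gcongr
          exact le_add_of_nonneg_left (by positivity)
      _ = ENNReal.ofReal (1 / (2 * K)) *
          ∫⁻ z, ENNReal.ofReal (|p.1 z| ^ q + ‖p.2 z‖ ^ ς) ∂(vol d T) +
          ENNReal.ofReal (K' * (vol d T).real univ) := by
          rw [lintegral_add_right _ measurable_const, lintegral_const_mul' _ _ ENNReal.ofReal_ne_top,
            lintegral_const, ENNReal.ofReal_mul hK', measureReal_def,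
            ENNReal.ofReal_toReal (measure_ne_top _ _)]
      _ ≤ ENNReal.ofReal (1 / (2 * K)) * (ENNReal.ofReal K * energy H f C p) +
          ENNReal.ofReal (K' * (vol d T).real univ) := by
          gcongr
          exact hc.lintegral_le p
      _ = _ := by
          rw [← mul_assoc, ← ENNReal.ofReal_mul (by positivity)]
          congr 3
          field_simp
  have h3 : ENNReal.ofReal (1 / 2) * energy H f C p ≠ ⊤ := ENNReal.mul_ne_top ENNReal.ofReal_ne_top hp
  refine (norm_integral_le_lintegral_norm _).trans
    ((ENNReal.toReal_mono (ENNReal.add_ne_top.2 ⟨h3, ENNReal.ofReal_ne_top⟩) h2).trans_eq ?_)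
  rw [ENNReal.toReal_add h3 ENNReal.ofReal_ne_top, ENNReal.toReal_mul,
    ENNReal.toReal_ofReal (by norm_num),
    ENNReal.toReal_ofReal (mul_nonneg hK' measureReal_nonneg)]

theorem weakForm_const (φT : Torus d → ℝ) (p : PairSpace d T) :
    weakForm T m₀ p.1 p.2 (fun _ => φT) =
      (∫ z, inner ℝ (spaceGrad φT z.2) (p.2 z) ∂(vol d T)) + ∫ x, φT x * m₀ x := by
  simp [weakForm]

/-- If `c` is below the values of `ℬ` on `𝒦₁`, up to normalization, then a function in `𝒦₀`
multiplies the constraint so that `c` is below the resulting Lagrangian. -/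
theorem exists_multiplier_K0 (hH : IsHamiltonian r H) (hf : IsCoupling q f)
    (hc : IsCoercive H f q ς K C) (hT : 0 < T) (hm₀ : Continuous m₀) (hpos : ∀ x, 0 < m₀ x)
    (hmass : ∫ x, m₀ x = 1) {φT : Torus d → ℝ} (hφT : SpaceContDiff 1 φT) {c : ℝ}
    (hlt : ∀ p ∈ K1 T m₀, energy H f C p ≠ ⊤ → c < (energy H f C p).toReal + terminalCost φT p) :
    ∃ φ : ℝ → Torus d → ℝ, ContDiff ℝ 1 (lift φ) ∧ (∀ x, φ T x = φT x) ∧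
      ∀ p : PairSpace d T, energy H f C p ≠ ⊤ →
        c ≤ (energy H f C p).toReal + weakForm T m₀ p.1 p.2 φ := by
  classical
  obtain ⟨R, hR0, hR⟩ := exists_bound_strip (d := d) (T := T) (g := fun z => spaceGrad φT z.2)
    (hφT.continuous_spaceGrad.comp continuous_snd).continuousOn
  replace hR : ∀ x, ‖spaceGrad φT x‖ ≤ R := fun x => hR 0 ⟨le_rfl, hT.le⟩ x
  obtain ⟨Λ₀, hΛ₀⟩ := exists_pairing (d := d) (T := T) (a := fun _ => 0)
    (b := fun z => spaceGrad φT z.2) aestronglyMeasurable_const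
    (hφT.continuous_spaceGrad.comp continuous_snd).aestronglyMeasurable (C := R)
    fun t _ x => ⟨by simpa using hR0, hR x⟩
  -- On the constraint set this equals the terminal cost, by `slice_spec`. Unlike the terminal cost,
  -- it is affine and continuous on the whole of L¹ × L¹.
  set A₀ : PairSpace d T → ℝ := fun p => weakForm T m₀ p.1 p.2 (fun _ => φT) with hA₀
  have hA₀' : ∀ p, A₀ p = Λ₀ p + ∫ x, φT x * m₀ x := fun p => by
    simp only [hA₀, weakForm_const, hΛ₀, zero_mul, zero_add]
  have hAct : Continuous A₀ := by
    simp only [funext hA₀']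
    exact Λ₀.continuous.add continuous_const
  have hAcv : ∀ {S : Set (PairSpace d T)}, Convex ℝ S → ConvexOn ℝ S A₀ := fun {S} hS => by
    simp only [funext hA₀']
    exact ((Λ₀ : PairSpace d T →ₗ[ℝ] ℝ).convexOn hS).add_const _
  obtain ⟨D, hD⟩ := hc.abs_integral_inner_le (d := d) (T := T) hR0
  have hAlow : ∀ p, energy H f C p ≠ ⊤ →
      -(1 / 2 * (energy H f C p).toReal) - (D - ∫ x, φT x * m₀ x) ≤ A₀ p := fun p hp => by
    simp only [hA₀, weakForm_const]
    have h1 := (abs_le.1 (hD (fun z => spaceGrad φT z.2) (fun z => hR z.2) p hp)).1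
    linarith
  let ι := {φ : ℝ → Torus d → ℝ // IsTest T φ}
  choose Λ hΛ using fun φ : ι => φ.2.exists_pairing
  have hform : ∀ (i : ι) (p : PairSpace d T),
      weakForm T m₀ p.1 p.2 i.1 = Λ i p + ∫ x, i.1 0 x * m₀ x := fun i p => by
    rw [hΛ]; rfl
  have hfeas : ∀ p ∈ K1 T m₀, ∀ i : ι, weakForm T m₀ p.1 p.2 i.1 = 0 := fun p hp i => hp.2.2 i.1 i.2
  -- Relaxed problem: finitely many tests, each satisfied up to 1/(n+1). The intersection of all
  -- these sets is the set of solutions of the continuity equation.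
  let S : Finset ι × ℕ → Set (PairSpace d T) := fun k =>
    {p | ∀ i ∈ k.1, |weakForm T m₀ p.1 p.2 i.1| ≤ 1 / ((k.2 : ℝ) + 1)}
  have hS : ∀ k, S k = ⋂ i ∈ k.1, {p | |Λ i p + ∫ x, i.1 0 x * m₀ x| ≤ 1 / ((k.2 : ℝ) + 1)} :=
    fun k => by ext p; simp only [S, hform, mem_ofPred_eq, mem_iInter]
  have hScl : ∀ k, IsClosed (S k) := fun k => by
    rw [hS]
    exact isClosed_biInter fun i _ => isClosed_le ((Λ i).continuous.add continuous_const).abs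
      continuous_const
  have hScv : ∀ k, Convex ℝ (S k) := fun k => by
    rw [hS]
    refine convex_iInter₂ fun i _ => ?_
    have h1 : {p | |Λ i p + ∫ x, i.1 0 x * m₀ x| ≤ 1 / ((k.2 : ℝ) + 1)} =
        (Λ i : PairSpace d T →ₗ[ℝ] ℝ) ⁻¹' Metric.closedBall (-∫ x, i.1 0 x * m₀ x)
          (1 / ((k.2 : ℝ) + 1)) := by
      ext p
      simp [Real.dist_eq]
    rw [h1]
    exact (convex_closedBall _ _).linear_preimage _
  have hmono : ∀ {k k' : Finset ι × ℕ}, k ≤ k' → S k' ⊆ S k := fun {k k'} h p hp i hi =>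
    (hp i (h.1 hi)).trans (one_div_le_one_div_of_le (by positivity) (by gcongr; exact h.2))
  -- Otherwise compactness would give a common point. It solves the continuity equation, is
  -- nonnegative by finiteness of its energy, and has value at most c, contrary to `hlt`.
  obtain ⟨k, hk⟩ : ∃ k, ¬(sublevel H f C (S k) A₀ c).Nonempty := by
    by_contra! hne
    obtain ⟨p, hp⟩ := nonempty_iInter_sublevel hH hf hc hScl hScv (fun _ => hAct.continuousOn)
      (fun k => hAcv (hScv k)) (fun _ p _ hp => hAlow p hp) (c := fun _ => c) (fun _ => le_rfl) hne
      (directed_of_isDirected_le fun k k' h p hp => ⟨hmono h hp.1, hp.2⟩)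
    rw [mem_iInter] at hp
    have hp1 : p ∈ K1 T m₀ := by
      refine (mem_K1_iff hT hmass).2 ⟨nonneg_of_energy_ne_top hH hf hc (hp (∅, 0)).2.1,
        fun φ hφ => ?_⟩
      change weakForm T m₀ p.1 p.2 φ = 0
      have h1 : |weakForm T m₀ p.1 p.2 φ| ≤ 0 :=
        ge_of_tendsto' tendsto_one_div_add_atTop_nhds_zero_nat fun n =>
          (hp ({⟨φ, hφ⟩}, n)).1 ⟨φ, hφ⟩ (Finset.mem_singleton_self _)
      exact abs_nonpos_iff.1 h1
    have h2 := slice_spec hT (integrable_fst p) (integrable_snd p) hm₀ hp1.1 hp1.2.1 hp1.2.2 hφT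
    have h3 := hlt p hp1 (hp (∅, 0)).2.1
    have h4 := (hp (∅, 0)).2.2
    simp only [hA₀, weakForm_const] at h4
    rw [terminalCost, h2] at h3
    linarith
  have hDcv : ConvexOn ℝ {p : PairSpace d T | energy H f C p ≠ ⊤}
      fun p => (energy H f C p).toReal + A₀ p := by
    have h1 : ConvexOn ℝ {p : PairSpace d T | energy H f C p ≠ ⊤}
        fun p => (energy H f C p).toReal := by
      refine convexOn_iff_forall_pos.2 ⟨convex_iff_forall_pos.2 fun p hp p' hp' s t hs ht hst =>
        (energy_combination hH hf hc hp hp' hs ht hst).1, fun p hp p' hp' s t hs ht hst =>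
        (energy_combination hH hf hc hp hp' hs ht hst).2⟩
    exact h1.add (hAcv h1.1)
  -- The tolerance of the relaxed problem is the δ of the multiplier lemma, and `stationary` is the
  -- feasible point.
  obtain ⟨l, hl⟩ := exists_multiplier hDcv (fun i : k.1 => (Λ i.1 : PairSpace d T →ₗ[ℝ] ℝ))
    (fun i => ∫ x, i.1.1 0 x * m₀ x) (δ := 1 / ((k.2 : ℝ) + 1)) (c := c)
    ⟨stationary T hm₀, energy_stationary_ne_top hH hf hc hm₀ hpos, fun i => by
      rw [ContinuousLinearMap.coe_coe, ← hform]
      exact hfeas _ (stationary_mem_K1 hT hm₀ hpos hmass) _⟩ (by positivity)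
    (fun p hp h => by
      by_contra! h1
      refine hk ⟨p, fun i hi => ?_, hp, h1.le⟩
      rw [hform]
      exact (h ⟨i, hi⟩).le)
  obtain ⟨ψ, hψ, hψ'⟩ := exists_isTest_sum hT hm₀ (m₀ := m₀) Finset.univ
    (φ := fun i : k.1 => i.1.1) (fun i => i.1.2) l
  refine ⟨fun t x => φT x + 1 * ψ t x, hφT.contDiff_lift.add (contDiff_const.mul hψ.contDiff_one),
    fun x => ?_, fun p hp => ?_⟩
  · obtain ⟨-, τ, hτ, h0⟩ := hψ
    simp only [h0 T hτ.le, mul_zero, add_zero]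
  · rw [weakForm_add_smul hm₀ hφT.contDiff_lift hψ.contDiff_one, hψ', one_mul, ← add_assoc]
    refine (hl p hp).trans_eq ?_
    congr 1
    refine Finset.sum_congr rfl fun i _ => ?_
    rw [hform]
    rfl

theorem IsHamiltonian.inner_gradient_le (hH : IsHamiltonian r H) (x : Torus d) (p p₀ : E d) :
    inner ℝ (gradient (H x) p₀) (p - p₀) ≤ H x p - H x p₀ := by
  have h1 : ConvexOn ℝ univ fun t : ℝ => H x (AffineMap.lineMap p₀ p t) :=
    (hH.conv x).comp_affineMap (AffineMap.lineMap p₀ p)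
  have h2 : HasDerivAt (fun t : ℝ => H x (AffineMap.lineMap p₀ p t))
      (inner ℝ (gradient (H x) p₀) (p - p₀)) 0 := by
    have h3 : HasFDerivAt (H x) (InnerProductSpace.toDual ℝ (E d) (gradient (H x) p₀))
        (AffineMap.lineMap p₀ p (0 : ℝ)) := by
      rw [AffineMap.lineMap_apply_zero]
      exact ((hH.diff x) p₀).hasGradientAt.hasFDerivAt
    exact h3.comp_hasDerivAt (0 : ℝ) AffineMap.hasDerivAt_lineMap
  have h4 := h1.le_slope_of_hasDerivAt (mem_univ _) (mem_univ _) one_pos h2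
  simpa [slope_def_field] using h4

/-- Equality case of Fenchel's inequality: for w = -m D_pH(x,p), convexity of H makes p the optimal
momentum. -/
theorem runningCost_feedback_le (hH : IsHamiltonian r H) (x : Torus d) {m : ℝ} (hm : 0 < m)
    (p : E d) : runningCost H f x m (-(m • gradient (H x) p)) ≤
      ((-inner ℝ p (-(m • gradient (H x) p)) - m * H x p + primitive f x m : ℝ) : EReal) := by
  rw [EReal.coe_add, runningCost, F_of_pos f x hm]
  refine add_le_add_left (hH.kinetic_le x hm.le fun p' => ?_) _
  have h1 := mul_le_mul_of_nonneg_left (hH.inner_gradient_le x p' p) hm.le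
  rw [inner_sub_right, real_inner_comm, real_inner_comm p] at h1
  simp only [inner_neg_right, inner_smul_right]
  linarith

theorem exists_bounded_pair {s : ℝ × Torus d → ℝ} {v : ℝ × Torus d → E d}
    (hs : AEStronglyMeasurable s (vol d T)) (hv : AEStronglyMeasurable v (vol d T)) {R : ℝ}
    (hbd : ∀ t ∈ Ioo 0 T, ∀ x, ‖s (t, x)‖ ≤ R ∧ ‖v (t, x)‖ ≤ R) :
    ∃ p : PairSpace d T, ∀ᵐ z ∂(vol d T), p.1 z = s z ∧ p.2 z = v z := by
  have h1 : Integrable s (vol d T) := Integrable.of_bound hs R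
    ((ae_vol_mem d T).mono fun z hz => (hbd z.1 hz z.2).1)
  have h2 : Integrable v (vol d T) := Integrable.of_bound hv R
    ((ae_vol_mem d T).mono fun z hz => (hbd z.1 hz z.2).2)
  refine ⟨(h1.toL1 s, h2.toL1 v), ?_⟩
  filter_upwards [h1.coeFn_toL1, h2.coeFn_toL1] with z h3 h4 using ⟨h3, h4⟩

/-- Here m is an ε-maximizer in F^* at -∂_tφ + H(x,Dφ), and w = -m D_pH(x,Dφ). Fenchel's inequality
is then an equality up to ε. Both are bounded, so the energy is finite. -/
theorem exists_near_optimal (hH : IsHamiltonian r H) (hf : IsCoupling q f)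
    (hc : IsCoercive H f q ς K C) {φ : ℝ → Torus d → ℝ} (hφ : ContDiff ℝ 1 (lift φ)) {ε : ℝ}
    (hε : 0 < ε) : ∃ p : PairSpace d T, energy H f C p ≠ ⊤ ∧ ∀ᵐ z ∂(vol d T),
      ∀ ρ : ℝ, runningCost H f z.2 (p.1 z) (p.2 z) = ρ →
        Fstar f z.2 (-(deriv (fun s => φ s z.2) z.1) + H z.2 (spaceGrad (φ z.1) z.2)) ≤
          ((-(deriv (fun s => φ s z.2) z.1 * p.1 z +
            inner ℝ (spaceGrad (φ z.1) z.2) (p.2 z)) - ρ + ε : ℝ) : EReal) := by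
  set b : ℝ × Torus d → ℝ := fun z => deriv (fun s => φ s z.2) z.1 with hb
  set P : ℝ × Torus d → E d := fun z => spaceGrad (φ z.1) z.2 with hP
  have hbc : Continuous b := continuous_deriv_time hφ
  have hPc : Continuous P := continuous_spaceGrad hφ
  set a : ℝ × Torus d → ℝ := fun z => -b z + H z.2 (P z) with ha
  have hac : Continuous a :=
    hbc.neg.add (hH.cont.comp (f := fun z : ℝ × Torus d => (z.2, P z)) (by fun_prop))
  have hgc : Continuous fun z : ℝ × Torus d => gradient (H z.2) (P z) :=
    hH.grad.comp (f := fun z : ℝ × Torus d => (z.2, P z)) (by fun_prop)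
  obtain ⟨M, hM0, hM⟩ := exists_bound_strip (d := d) (T := T) hac.continuousOn
  obtain ⟨N, hN0, hN⟩ := exists_bound_strip (d := d) (T := T) hgc.continuousOn
  obtain ⟨Nb, hNb0, hNb⟩ := exists_bound_strip (d := d) (T := T) hbc.continuousOn
  obtain ⟨NP, hNP0, hNP⟩ := exists_bound_strip (d := d) (T := T) hPc.continuousOn
  -- The selection needs a globally bounded slope; truncation at ±M changes nothing on the strip.
  obtain ⟨s, hsm, ⟨R, hR⟩, hs⟩ := hf.exists_selection (a := fun z => max (-M) (min M (a z)))
    (by fun_prop) (M := M) (fun z => abs_le.2 ⟨le_max_left _ _, max_le (by linarith)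
      (min_le_left _ _)⟩) hε
  have hR0 : 0 < R := (hs (0, 0)).1.trans_le (hR _)
  set v : ℝ × Torus d → E d := fun z => -(s z • gradient (H z.2) (P z)) with hv
  have hsR : ∀ z, ‖s z‖ ≤ R := fun z => by
    rw [Real.norm_eq_abs, abs_of_pos (hs z).1]; exact hR z
  have hvR : ∀ t ∈ Ioo 0 T, ∀ x, ‖v (t, x)‖ ≤ R * N := fun t ht x => by
    simp only [hv, norm_neg, norm_smul]
    exact mul_le_mul (hsR _) (hN t (Ioo_subset_Icc_self ht) x) (norm_nonneg _) hR0.le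
  obtain ⟨p, hp⟩ := exists_bounded_pair (d := d) (T := T) hsm.aestronglyMeasurable
    ((hsm.smul hgc.measurable).neg.aestronglyMeasurable (μ := vol d T)) (R := max R (R * N))
    fun t ht x => ⟨(hsR _).trans (le_max_left _ _), (hvR t ht x).trans (le_max_right _ _)⟩
  have hpt : ∀ᵐ z ∂(vol d T), Fstar f z.2 (a z) ≤
        ((a z * p.1 z - primitive f z.2 (p.1 z) + ε : ℝ) : EReal) ∧
      runningCost H f z.2 (p.1 z) (p.2 z) ≤ ((-(b z * p.1 z + inner ℝ (P z) (p.2 z)) -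
        (a z * p.1 z - primitive f z.2 (p.1 z)) : ℝ) : EReal) := by
    filter_upwards [hp, ae_vol_mem d T] with z hz ht
    have haz := abs_le.1 (hM z.1 (Ioo_subset_Icc_self ht) z.2)
    have h1 := hs z
    rw [min_eq_right haz.2, max_eq_right haz.1] at h1
    rw [hz.1, hz.2]
    refine ⟨hf.Fstar_le h1.1 h1.2.1 h1.2.2, (runningCost_feedback_le hH z.2 h1.1 (P z)).trans ?_⟩
    rw [EReal.coe_le_coe_iff]
    simp only [ha, Pi.neg_apply, Pi.smul_apply']
    apply le_of_eq
    ring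
  refine ⟨p, ?_, ?_⟩
  · set Q := max (Nb * R + NP * (R * N) + M + ε + C) 0 with hQ
    refine ne_top_of_le_ne_top (b := ∫⁻ _, ENNReal.ofReal Q ∂(vol d T)) ?_ (lintegral_mono_ae ?_)
    · rw [lintegral_const]
      exact ENNReal.mul_ne_top ENNReal.ofReal_ne_top (measure_ne_top _ _)
    · filter_upwards [hpt, hp, ae_vol_mem d T] with z hz hz' ht
      have ht' := Ioo_subset_Icc_self ht
      rw [hc.shiftedCost_le_iff (le_max_right _ _)]
      refine hz.2.trans (EReal.coe_le_coe_iff.2 ?_)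
      -- The competitor m = 1, where the primitive vanishes, bounds F^*(a) below by a. This controls
      -- the cost of the selected pair from above.
      have h1 : a z ≤ a z * p.1 z - primitive f z.2 (p.1 z) + ε := by
        have h2 := (le_Fstar f z.2 (a z) 1).trans hz.1
        rwa [F_of_pos f z.2 one_pos, primitive_one, ← EReal.coe_sub, EReal.coe_le_coe_iff, mul_one,
          sub_zero] at h2
      have h3 : |b z * p.1 z| ≤ Nb * R := by
        rw [abs_mul, hz'.1]
        exact mul_le_mul (hNb z.1 ht' z.2) (hsR z) (abs_nonneg _) hNb0
      have h4 : |inner ℝ (P z) (p.2 z)| ≤ NP * (R * N) := by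
        rw [hz'.2]
        exact (abs_real_inner_le_norm _ _).trans
          (mul_le_mul (hNP z.1 ht' z.2) (hvR z.1 ht z.2) (norm_nonneg _) hNP0)
      have h5 := (abs_le.1 (hM z.1 ht' z.2)).1
      have h6 := le_max_left (Nb * R + NP * (R * N) + M + ε + C) 0
      linarith [(abs_le.1 h3).1, (abs_le.1 h4).1]
  · filter_upwards [hpt] with z hz ρ hρ
    refine hz.1.trans (EReal.coe_le_coe_iff.2 ?_)
    rw [hρ, EReal.coe_le_coe_iff] at hz
    linarith [hz.2]

/-- At the near-optimal pair for φ, the Lagrangian equals -𝒜(φ) up to ε and normalization; its lower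
bound c thus becomes an upper bound on 𝒜(φ). -/
theorem A_le_of_le_weakForm (hH : IsHamiltonian r H) (hf : IsCoupling q f)
    (hc : IsCoercive H f q ς K C) {φ : ℝ → Torus d → ℝ} (hφ : ContDiff ℝ 1 (lift φ)) {c : ℝ}
    (hle : ∀ p : PairSpace d T, energy H f C p ≠ ⊤ →
      c ≤ (energy H f C p).toReal + weakForm T m₀ p.1 p.2 φ) {ε : ℝ} (hε : 0 < ε) :
    A T H f m₀ φ ≤ ((C * (vol d T).real univ - c + ε : ℝ) : EReal) := by
  set V := (vol d T).real univ with hV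
  have hV0 : 0 ≤ V := measureReal_nonneg
  obtain ⟨p, hp, hnear⟩ := exists_near_optimal (T := T) hH hf hc hφ
    (ε := ε / (V + 1)) (by positivity)
  obtain ⟨ρ, hρ, hρint, hρeq⟩ := exists_cost hH hf hc hp
  have hint := integrable_test hφ p
  have hneg : Integrable (fun z => -(deriv (fun s => φ s z.2) z.1 * p.1 z +
      inner ℝ (spaceGrad (φ z.1) z.2) (p.2 z))) (vol d T) := hint.neg
  have hsub : Integrable (fun z => -(deriv (fun s => φ s z.2) z.1 * p.1 z +
      inner ℝ (spaceGrad (φ z.1) z.2) (p.2 z)) - ρ z) (vol d T) := hneg.sub hρ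
  have hadd : Integrable (fun z => -(deriv (fun s => φ s z.2) z.1 * p.1 z +
      inner ℝ (spaceGrad (φ z.1) z.2) (p.2 z)) - ρ z + ε / (V + 1)) (vol d T) :=
    hsub.add (integrable_const _)
  have h2 := eintegral_mono_ae (μ := vol d T)
    (g := fun z => Fstar f z.2 (-(derivWithin (fun s => φ s z.2) (Icc 0 T) z.1)
        + H z.2 (spaceGrad (φ z.1) z.2)))
    (g' := fun z => ((-(deriv (fun s => φ s z.2) z.1 * p.1 z +
      inner ℝ (spaceGrad (φ z.1) z.2) (p.2 z)) - ρ z + ε / (V + 1) : ℝ) : EReal)) (by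
    filter_upwards [hnear, hρeq, ae_vol_mem d T] with z hz hz' ht
    rw [derivWithin_of_mem_nhds (Icc_mem_nhds ht.1 ht.2)]
    exact hz _ hz')
  rw [eintegral_coe hadd, integral_add hsub (integrable_const _),
    integral_sub hneg hρ, integral_neg, integral_const, hρint, smul_eq_mul] at h2
  have h3 := hle p hp
  have h4 : V * (ε / (V + 1)) ≤ ε := by
    rw [mul_div_assoc', div_le_iff₀ (by positivity)]
    nlinarith
  refine (EReal.sub_le_sub h2 le_rfl).trans ?_
  rw [← EReal.coe_sub, EReal.coe_le_coe_iff]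
  rw [weakForm] at h3
  linarith

theorem iInf_A_eq (hH : IsHamiltonian r H) (hf : IsCoupling q f)
    (hc : IsCoercive H f q ς K C) (hT : 0 < T) (hm₀ : Continuous m₀) (hpos : ∀ x, 0 < m₀ x)
    (hmass : ∫ x, m₀ x = 1) {φT : Torus d → ℝ} (hφT : SpaceContDiff 1 φT) {p : PairSpace d T}
    (hp : p ∈ K1 T m₀) (hmin : IsMinOn (B T H f φT) (K1 T m₀) p) :
    ⨅ φ ∈ K0 T φT, A T H f m₀ φ = -B T H f φT p := by
  refine le_antisymm ?_ (le_iInf₂ fun φ hφ => neg_B_le_A hH hf hc hT hm₀ hφ hp)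
  obtain ⟨he, hle⟩ := (isMinOn_B_iff hH hf hc ⟨_, stationary_mem_K1 hT hm₀ hpos hmass,
    energy_stationary_ne_top hH hf hc hm₀ hpos⟩).1 hmin
  rw [B_eq hH hf hc _ he, ← EReal.coe_neg]
  by_contra! h
  obtain ⟨y, h1, h2⟩ := EReal.lt_iff_exists_real_btwn.1 h
  rw [EReal.coe_lt_coe_iff] at h1
  set J := (energy H f C p).toReal + terminalCost φT p with hJ
  -- Half the distance from -ℬ to y. One ε is lost in choosing the level J - ε and one in bounding
  -- 𝒜(φ), so the resulting bound is exactly y.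
  set ε := (y + (J - C * (vol d T).real univ)) / 2 with hε
  have hε0 : 0 < ε := by rw [hε]; linarith
  obtain ⟨φ, hφ, hφe, hφle⟩ := exists_multiplier_K0 hH hf hc hT hm₀ hpos hmass hφT (c := J - ε)
    fun p' hp' he' => by linarith [hle p' hp' he']
  have h3 := A_le_of_le_weakForm hH hf hc hφ hφle hε0
  have h4 : ⨅ φ ∈ K0 T φT, A T H f m₀ φ ≤ A T H f m₀ φ := iInf₂_le φ ⟨hφ.contDiffOn, hφe⟩
  have h5 := (h2.trans_le h4).trans_le h3
  rw [EReal.coe_lt_coe_iff] at h5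
  linarith

end StrongDuality

end MFG

end

theorem theorem2p3 (d : ℕ) (T : ℝ) (hT : 0 < T) (r q : ℝ) (hq : 1 < q)
    (hrq : max (d * (q - 1)) 1 < r)
    -- the initial density and the terminal cost
    (m₀ : MFG.Torus d → ℝ) (hm₀_cont : Continuous m₀) (hm₀_pos : ∀ x, 0 < m₀ x)
    (hm₀_int : ∫ x, m₀ x = 1)
    (φT : MFG.Torus d → ℝ) (hφT : ∃ K, LipschitzWith K φT)
    -- the Hamiltonian
    (H : MFG.Torus d → MFG.E d → ℝ)
    (hH_cont : Continuous (fun z : MFG.Torus d × MFG.E d => H z.1 z.2))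
    (hH_conv : ∀ x, ConvexOn ℝ Set.univ (H x))
    (hH_diff : ∀ x, Differentiable ℝ (H x))
    (hH_grad : Continuous (fun z : MFG.Torus d × MFG.E d => gradient (H z.1) z.2))
    (hH_growth : ∃ C > 0, ∀ x p,
      1 / (r * C) * ‖p‖ ^ r - C ≤ H x p ∧ H x p ≤ C / r * ‖p‖ ^ r + C)
    -- the coupling
    (f : MFG.Torus d → ℝ → ℝ)
    (hf_cont : ContinuousOn (fun z : MFG.Torus d × ℝ => f z.1 z.2)
      (Set.univ ×ˢ Set.Ioi (0 : ℝ)))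
    (hf_mono : ∀ x, StrictMonoOn (f x) (Set.Ioi (0 : ℝ)))
    (hf_growth : ∃ C > 0, ∀ x, ∀ m ≥ 1,
      1 / C * m ^ (q - 1) - C ≤ f x m ∧ f x m ≤ C * m ^ (q - 1) + C) :
    -- the minimum of `ℬ` over `𝒦₁` is achieved by a unique pair
    (∃! p, p ∈ MFG.K1 T m₀ ∧ IsMinOn (MFG.B T H f φT) (MFG.K1 T m₀) p) ∧
    ∀ p ∈ MFG.K1 T m₀, IsMinOn (MFG.B T H f φT) (MFG.K1 T m₀) p →
      -- the minimizer has the stated integrability, with `r' = r / (r - 1)`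
      MeasureTheory.MemLp p.1 (ENNReal.ofReal q) (MFG.vol d T) ∧
      MeasureTheory.MemLp p.2 (ENNReal.ofReal
        (r.conjExponent * q / (r.conjExponent + q - 1))) (MFG.vol d T) ∧
      -- duality; `𝒦₀` is nonempty exactly when `φ_T` is of class `C¹`
      (MFG.SpaceContDiff 1 φT →
        ⨅ φ ∈ MFG.K0 T φT, MFG.A T H f m₀ φ = -MFG.B T H f φT p) := by
  have hr : 1 < r := (le_max_right _ _).trans_lt hrq
  have hH : MFG.IsHamiltonian r H := ⟨hr, hH_cont, hH_conv, hH_diff, hH_grad, hH_growth⟩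
  have hf : MFG.IsCoupling q f := ⟨hq, hf_cont, hf_mono, hf_growth⟩
  have hφ : Continuous φT := hφT.elim fun _ h => h.continuous
  obtain ⟨K, C, hc⟩ := MFG.exists_isCoercive hH hf
  obtain ⟨p, hp, hmin⟩ := MFG.exists_isMinOn_B hH hf hc hT hm₀_cont hm₀_pos hm₀_int hφ
  refine ⟨⟨p, ⟨hp, hmin⟩, fun p' h => MFG.eq_of_isMinOn_B hH hf hc hT hm₀_cont hm₀_pos hm₀_int hφ
    h.1 h.2 hp hmin⟩, fun p hp hmin => ?_⟩
  have he := ((MFG.isMinOn_B_iff hH hf hc ⟨_, MFG.stationary_mem_K1 hT hm₀_cont hm₀_pos hm₀_int,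
    MFG.energy_stationary_ne_top hH hf hc hm₀_cont hm₀_pos⟩).1 hmin).1
  exact ⟨(MFG.memLp_of_energy_ne_top hc he).1, (MFG.memLp_of_energy_ne_top hc he).2,
    fun hφT1 => MFG.iInf_A_eq hH hf hc hT hm₀_cont hm₀_pos hm₀_int hφT1 hp hmin⟩
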